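/- **Setting.** Let $S$ be a regular scheme (locally noetherian with regular local rings), $s\in\Gamma(S,\mathcal O_S)$, and $n,d$ positive integers. Let $\mathscr E_\bullet$ be an $s$-linked chain of rank $d$: vector bundles $\mathscr E_1,\dots,\mathscr E_n$ of rank $d$ on $S$ with maps $f_i:\mathscr E_i\to\mathscr E_{i+1}$ and $f^i:\mathscr E_{i+1}\to\mathscr E_i$ for $1\le i\le n-1$ such that $f_i f^i=s\cdot\mathrm{id}$ and $f^i f_i=s\cdot\mathrm{id}$, and such that on the fibers at every point where $s=0$ one has $\ker f^i=\operatorname{im} f_i$, $\ker f_i=\operatorname{im} f^i$, and (for $i\le n-2$) $\operatorname{im} f_i\cap\ker f_{i+1}=0$, $\operatorname{im} f^{i+1}\cap\ker f^i=0$. Let $r<d$. A *linked subbundle* of rank $r$ of $\mathscr E_\bullet$ consists of rank-$r$ subbundles $\mathscr F_i\subseteq\mathscr E_i$ with $f_i\mathscr F_i\subseteq\mathscr F_{i+1}$ and $f^i\mathscr F_{i+1}\subseteq\mathscr F_i$. The *linked Grassmannian* $LG=LG(r,\mathscr E_\bullet)$ is the $S$-scheme representing the functor that sends $T\to S$ to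 the set of linked subbundles of rank $r$ of $\mathscr E_\bullet|_T$. Let $m\in\frac12\mathbb Z$ with $1\le m\le n$. A *linked alternating form* of index $m$ on $\mathscr E_\bullet$ is a collection of bilinear pairings $\langle,\rangle_{i,j}:\mathscr E_i\times\mathscr E_j\to\mathcal O_S$, $1\le i,j\le n$, with $\langle,\rangle_{i,i}$ alternating, $\langle x,y\rangle_{i,j}=-\langle y,x\rangle_{j,i}$ for $i\ne j$, and, whenever the indices make sense, $$\langle f_{i-1}x,y\rangle_{i,j}=s^{\epsilon_{i,j}}\langle x,y\rangle_{i-1,j},\qquad \langle x,f_{j-1}y\rangle_{i,j}=s^{\epsilon_{i,j}}\langle x,y\rangle_{i,j-1},$$ $$\langle f^{i}x,y\rangle_{i,j}=s^{\epsilon^{i,j}}\langle x,y\rangle_{i+1,j},\qquad \langle x,f^{j}y\rangle_{i,j}=s^{\epsilon^{i,j}}\langle x,y\rangle_{i,j+1},$$ where $\epsilon_{i,j}$ is $1$ if $i+j>2m$ and $0$ otherwise, and $\epsilon^{i,j}$ is $1$ if $i+j<2m$ and $0$ otherwise. It is a *linked symplectic form* if moreover: 1. $\langle,\rangle_{i,j}$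 is nondegenerate (on all fibers) whenever $i+j=2m$; 2. if $2m<n+1$, then on all fibers where $s=0$ and for all $2m-1<i\le n$, the degeneracy of $\langle,\rangle_{i,i}$ is equal to $\ker f^{i-1}$; 3. if $2m>n+1$, then on all fibers where $s=0$ and for all $1\le i<2m-n$, the degeneracy of $\langle,\rangle_{i,i}$ is equal to $\ker f_i$. Given a linked symplectic form, the *linked symplectic Grassmannian* $LSG=LSG(r,\mathscr E_\bullet,\langle,\rangle_\bullet)$ is the closed subscheme of $LG$ parametrizing the linked subbundles $\mathscr F_\bullet$ that are isotropic, i.e. such that $\langle,\rangle_{i,j}$ vanishes on $\mathscr F_i\times\mathscr F_j$ for all $i,j$. **Theorem 1.2.** Let $z\in LSG$ be a point at which $LG$ is smooth over $S$. Then $LSG$ is smooth over $S$ at $z$, and $LSG$ has codimension $\binom r2$ in $LG$ at $z$ (that is, the ideal of $LSG$ in the local ring $\mathcal O_{LG,z}$ has height $\binom r2$). -/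

import Mathlib

open AlgebraicGeometry CategoryTheory

universe u

namespace LinkedSymplectic

noncomputable section

/-! ### Vector bundles, as sheaves of modules -/

/-- Restriction of sections of an `𝒪_X`-module. -/
def res {X : Scheme.{u}} (M : X.Modules) {U V : X.Opens} (h : V ≤ U) (x : Γ(M, U)) : Γ(M, V) :=
  M.presheaf.map (homOfLE h).op x

/-- Restriction of regular functions. -/
def resO {X : Scheme.{u}} {U V : X.Opens} (h : V ≤ U) (a : Γ(X, U)) : Γ(X, V) :=
  X.presheaf.map (homOfLE h).op a

/-- A family of sections over `U` is a frame of `M` over `U` if over every open `V ≤ U` its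
restriction is a basis of `M(V)` over `𝒪_X(V)`, that is, if it defines an isomorphism from a free
`𝒪_U`-module to `M|_U`. -/
def IsFrame {X : Scheme.{u}} (M : X.Modules) (U : X.Opens) {κ : Type} (e : κ → Γ(M, U)) : Prop :=
  ∀ (V : X.Opens) (h : V ≤ U),
    LinearIndependent Γ(X, V) (fun k => res M h (e k)) ∧
      Submodule.span Γ(X, V) (Set.range fun k => res M h (e k)) = ⊤

/-- `M` is a vector bundle of rank `d`: it is locally free of rank `d`. -/
def IsVectorBundle {X : Scheme.{u}} (M : X.Modules) (d : ℕ) : Prop :=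
  ∀ x : X, ∃ U : X.Opens, x ∈ U ∧ ∃ e : Fin d → Γ(M, U), IsFrame M U e

/-- A subbundle of rank `r` of `M`: a subsheaf of `𝒪_X`-modules which is locally spanned by the
first `r` members of a frame of `M` (so both it and the quotient are locally free, and it has
rank `r`). -/
structure Subbundle {X : Scheme.{u}} (M : X.Modules) (r : ℕ) where
  /-- the sections of the subbundle over an open subset -/
  sections : ∀ U : X.Opens, Submodule Γ(X, U) Γ(M, U)
  res_mem : ∀ {U V : X.Opens} (h : V ≤ U) (x : Γ(M, U)), x ∈ sections U → res M h x ∈ sections V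
  mem_of_locally : ∀ (U : X.Opens) (x : Γ(M, U)),
    (∀ p ∈ U, ∃ (V : X.Opens) (h : V ≤ U), p ∈ V ∧ res M h x ∈ sections V) → x ∈ sections U
  exists_frame : ∀ p : X, ∃ U : X.Opens, p ∈ U ∧
    ∃ (c : ℕ) (e : Fin r ⊕ Fin c → Γ(M, U)), IsFrame M U e ∧
      ∀ (V : X.Opens) (h : V ≤ U),
        sections V = Submodule.span Γ(X, V) (Set.range fun k : Fin r => res M h (e (Sum.inl k)))

/-! ### Pullbacks -/

/-- The pullback along `g : T ⟶ X` of an `𝒪_X`-module. -/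
abbrev pull {T X : Scheme.{u}} (g : T ⟶ X) (M : X.Modules) : T.Modules :=
  (Scheme.Modules.pullback g).obj M

/-- The pullback along `g : T ⟶ X` of a morphism of `𝒪_X`-modules. -/
abbrev pullMap {T X : Scheme.{u}} (g : T ⟶ X) {M N : X.Modules} (f : M ⟶ N) :
    pull g M ⟶ pull g N :=
  (Scheme.Modules.pullback g).map f

/-- The pullback along `g` of a section of `M`, a section of `g^* M`. -/
def pullSection {T X : Scheme.{u}} (g : T ⟶ X) (M : X.Modules) (W : X.Opens) (x : Γ(M, W)) :
    Γ(pull g M, g ⁻¹ᵁ W) :=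
  ((Scheme.Modules.pullbackPushforwardAdjunction g).unit.app M).app W x

/-- For `g = φ ≫ p`, the pullback along `φ` of a section of `p^* M`, as a section of `g^* M`
through the canonical isomorphism `φ^* p^* M ≅ g^* M`. -/
def pullSectionOver {T G X : Scheme.{u}} (φ : T ⟶ G) (p : G ⟶ X) (g : T ⟶ X) (h : φ ≫ p = g)
    (M : X.Modules) (W : G.Opens) (x : Γ(pull p M, W)) : Γ(pull g M, φ ⁻¹ᵁ W) :=
  ((Scheme.Modules.pullbackComp φ p ≪≫ Scheme.Modules.pullbackCongr h).hom.app M).app (φ ⁻¹ᵁ W)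
    (pullSection φ (pull p M) W x)

/-- For `g = φ ≫ p`, the subbundle `F'` of `g^* M` is the pullback along `φ` of the subbundle `F`
of `p^* M`: it is the subsheaf of modules generated by the pullbacks of the sections of `F`. -/
def Subbundle.IsPullback {T G X : Scheme.{u}} (φ : T ⟶ G) (p : G ⟶ X) (g : T ⟶ X)
    (h : φ ≫ p = g) {M : X.Modules} {r : ℕ} (F : Subbundle (pull p M) r)
    (F' : Subbundle (pull g M) r) : Prop :=
  ∀ (V : T.Opens) (x : Γ(pull g M, V)), x ∈ F'.sections V ↔
    ∀ t ∈ V, ∃ (W : G.Opens) (V' : T.Opens) (hV : V' ≤ V) (hW : V' ≤ φ ⁻¹ᵁ W), t ∈ V' ∧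
      res (pull g M) hV x ∈ Submodule.span Γ(T, V')
        {y | ∃ w ∈ F.sections W, y = res (pull g M) hW (pullSectionOver φ p g h M W w)}

/-- A bilinear pairing `M × N → 𝒪_X` of sheaves of modules. -/
structure Pairing {X : Scheme.{u}} (M N : X.Modules) where
  /-- the pairing on sections over an open subset -/
  app : ∀ U : X.Opens, Γ(M, U) →ₗ[Γ(X, U)] Γ(N, U) →ₗ[Γ(X, U)] Γ(X, U)
  app_res : ∀ {U V : X.Opens} (h : V ≤ U) (x : Γ(M, U)) (y : Γ(N, U)),
    app V (res M h x) (res N h y) = resO h (app U x y)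

/-- `B'` is the pullback of the pairing `B` along `g`: the (unique) pairing of `g^* M` and `g^* N`
with `⟨g^* x, g^* y⟩ = g^* ⟨x, y⟩` for all local sections `x` of `M` and `y` of `N`. -/
def Pairing.IsPullback {T X : Scheme.{u}} (g : T ⟶ X) {M N : X.Modules} (B : Pairing M N)
    (B' : Pairing (pull g M) (pull g N)) : Prop :=
  ∀ (W : X.Opens) (x : Γ(M, W)) (y : Γ(N, W)),
    B'.app (g ⁻¹ᵁ W) (pullSection g M W x) (pullSection g N W y) = g.app W (B.app W x y)

/-! ### Fibers -/

/-- The fiber of `M` at the point `x`: the global sections of the pullback to `Spec κ(x)`. -/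
abbrev Fiber {X : Scheme.{u}} (M : X.Modules) (x : X) : Type u :=
  Γ(pull (X.fromSpecResidueField x) M, ⊤)

/-- The map on fibers at `x` induced by a morphism of modules. -/
def fiberMap {X : Scheme.{u}} {M N : X.Modules} (f : M ⟶ N) (x : X) (v : Fiber M x) : Fiber N x :=
  (pullMap (X.fromSpecResidueField x) f).app ⊤ v

/-- The pairing `B` induces a nondegenerate pairing on the fibers at `x`. -/
def Pairing.NondegenerateAt {X : Scheme.{u}} {M N : X.Modules} (B : Pairing M N) (x : X) : Prop :=
  ∃ B' : Pairing (pull (X.fromSpecResidueField x) M) (pull (X.fromSpecResidueField x) N),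
    B.IsPullback (X.fromSpecResidueField x) B' ∧
      (∀ v : Fiber M x, (∀ w : Fiber N x, B'.app ⊤ v w = 0) → v = 0) ∧
      (∀ w : Fiber N x, (∀ v : Fiber M x, B'.app ⊤ v w = 0) → w = 0)

/-- On the fibers at `x`, the degeneracy of `B` (the vectors orthogonal to everything) is equal to
the kernel of `f`. -/
def Pairing.DegeneracyEqKerAt {X : Scheme.{u}} {M N : X.Modules} (B : Pairing M M) (f : M ⟶ N)
    (x : X) : Prop :=
  ∃ B' : Pairing (pull (X.fromSpecResidueField x) M) (pull (X.fromSpecResidueField x) M),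
    B.IsPullback (X.fromSpecResidueField x) B' ∧
      ∀ v : Fiber M x, (∀ w : Fiber M x, B'.app ⊤ v w = 0) ↔ fiberMap f x v = 0

/-! ### Linked bundles -/

/-- A chain `E_1, …, E_n` of modules with maps `f_i : E_i ⟶ E_{i+1}` and `f^i : E_{i+1} ⟶ E_i`.
The module `E_i` of the chain is `E` at the element `i - 1` of `Fin n`. -/
structure Chain (S : Scheme.{u}) (n : ℕ) where
  /-- the modules -/
  E : Fin n → S.Modules
  /-- the maps up -/
  up : ∀ i j : Fin n, i.val + 1 = j.val → (E i ⟶ E j)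
  /-- the maps down -/
  down : ∀ i j : Fin n, i.val + 1 = j.val → (E j ⟶ E i)

/-- The chain consists of vector bundles of rank `d` and is `s`-linked. -/
structure Chain.IsLinked {S : Scheme.{u}} {n : ℕ} (C : Chain S n) (d : ℕ) (s : Γ(S, ⊤)) :
    Prop where
  isVectorBundle : ∀ i, IsVectorBundle (C.E i) d
  down_up : ∀ i j h (U : S.Opens) (x : Γ(C.E i, U)),
    (C.down i j h).app U ((C.up i j h).app U x) = resO (le_top : U ≤ ⊤) s • x
  up_down : ∀ i j h (U : S.Opens) (x : Γ(C.E j, U)),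
    (C.up i j h).app U ((C.down i j h).app U x) = resO (le_top : U ≤ ⊤) s • x
  ker_down : ∀ x : S, S.Γevaluation x s = 0 → ∀ i j h (v : Fiber (C.E j) x),
    fiberMap (C.down i j h) x v = 0 ↔ ∃ w, fiberMap (C.up i j h) x w = v
  ker_up : ∀ x : S, S.Γevaluation x s = 0 → ∀ i j h (v : Fiber (C.E i) x),
    fiberMap (C.up i j h) x v = 0 ↔ ∃ w, fiberMap (C.down i j h) x w = v
  im_up_inf_ker_up : ∀ x : S, S.Γevaluation x s = 0 → ∀ i j k hij hjk (v : Fiber (C.E i) x),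
    fiberMap (C.up j k hjk) x (fiberMap (C.up i j hij) x v) = 0 →
      fiberMap (C.up i j hij) x v = 0
  im_down_inf_ker_down : ∀ x : S, S.Γevaluation x s = 0 → ∀ i j k hij hjk (v : Fiber (C.E k) x),
    fiberMap (C.down i j hij) x (fiberMap (C.down j k hjk) x v) = 0 →
      fiberMap (C.down j k hjk) x v = 0

/-- A linked subbundle of rank `r` of the pullback of the chain along `g : T ⟶ S`. -/
structure LinkedSubbundle {S : Scheme.{u}} {n : ℕ} (C : Chain S n) (r : ℕ) {T : Scheme.{u}}
    (g : T ⟶ S) where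
  /-- the subbundles -/
  F : ∀ i, Subbundle (pull g (C.E i)) r
  up_mem : ∀ i j h (U : T.Opens) (x : Γ(pull g (C.E i), U)), x ∈ (F i).sections U →
    (pullMap g (C.up i j h)).app U x ∈ (F j).sections U
  down_mem : ∀ i j h (U : T.Opens) (x : Γ(pull g (C.E j), U)), x ∈ (F j).sections U →
    (pullMap g (C.down i j h)).app U x ∈ (F i).sections U

/-- For `g = φ ≫ p`, the linked subbundle `F'` over `g` is the pullback along `φ` of the linked
subbundle `F` over `p`. -/
def LinkedSubbundle.IsPullback {S : Scheme.{u}} {n : ℕ} {C : Chain S n} {r : ℕ} {T G : Scheme.{u}}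
    (φ : T ⟶ G) (p : G ⟶ S) (g : T ⟶ S) (h : φ ≫ p = g) (F : LinkedSubbundle C r p)
    (F' : LinkedSubbundle C r g) : Prop :=
  ∀ i, Subbundle.IsPullback φ p g h (F.F i) (F'.F i)

/-- The linked Grassmannian `LG(r, E_•)`: the `S`-scheme representing the functor of linked
subbundles of rank `r`, with its universal linked subbundle. -/
structure LinkedGrassmannian {S : Scheme.{u}} {n : ℕ} (C : Chain S n) (r : ℕ) where
  /-- the underlying scheme -/
  scheme : Scheme.{u}
  /-- the structure morphism -/
  hom : scheme ⟶ S
  /-- the universal linked subbundle -/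
  univ : LinkedSubbundle C r hom
  existsUnique : ∀ (T : Scheme.{u}) (g : T ⟶ S) (F : LinkedSubbundle C r g),
    ∃! φ : T ⟶ scheme, ∃ h : φ ≫ hom = g, univ.IsPullback φ hom g h F

/-! ### Linked alternating and symplectic forms -/

/-- A family of pairings `⟨,⟩_{i,j} : E_i × E_j → 𝒪_S`. -/
abbrev Form {S : Scheme.{u}} {n : ℕ} (C : Chain S n) : Type u :=
  ∀ i j : Fin n, Pairing (C.E i) (C.E j)

/-- The exponent `ε_{i,j}`: it is `1` if `i + j > 2m` and `0` otherwise. The index `i` of the chain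
is `i.val + 1`, and `M` stands for `2m`. -/
def epsLower {n : ℕ} (M : ℕ) (i j : Fin n) : ℕ :=
  if M < (i.val + 1) + (j.val + 1) then 1 else 0

/-- The exponent `ε^{i,j}`: it is `1` if `i + j < 2m` and `0` otherwise. -/
def epsUpper {n : ℕ} (M : ℕ) (i j : Fin n) : ℕ :=
  if (i.val + 1) + (j.val + 1) < M then 1 else 0

/-- A linked bilinear form of index `m = M / 2`, a half-integer between `1` and `n`. -/
structure IsLinkedBilinear {S : Scheme.{u}} {n : ℕ} (C : Chain S n) (s : Γ(S, ⊤)) (M : ℕ)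
    (B : Form C) : Prop where
  two_le : 2 ≤ M
  le_two_mul : M ≤ 2 * n
  up_left : ∀ i i' j h (U : S.Opens) (x : Γ(C.E i, U)) (y : Γ(C.E j, U)),
    (B i' j).app U ((C.up i i' h).app U x) y =
      resO (le_top : U ≤ ⊤) s ^ epsLower M i' j * (B i j).app U x y
  up_right : ∀ i j j' h (U : S.Opens) (x : Γ(C.E i, U)) (y : Γ(C.E j, U)),
    (B i j').app U x ((C.up j j' h).app U y) =
      resO (le_top : U ≤ ⊤) s ^ epsLower M i j' * (B i j).app U x y
  down_left : ∀ i i' j h (U : S.Opens) (x : Γ(C.E i', U)) (y : Γ(C.E j, U)),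
    (B i j).app U ((C.down i i' h).app U x) y =
      resO (le_top : U ≤ ⊤) s ^ epsUpper M i j * (B i' j).app U x y
  down_right : ∀ i j j' h (U : S.Opens) (x : Γ(C.E i, U)) (y : Γ(C.E j', U)),
    (B i j).app U x ((C.down j j' h).app U y) =
      resO (le_top : U ≤ ⊤) s ^ epsUpper M i j * (B i j').app U x y

/-- A linked alternating form of index `m = M / 2`. -/
structure IsLinkedAlternating {S : Scheme.{u}} {n : ℕ} (C : Chain S n) (s : Γ(S, ⊤)) (M : ℕ)
    (B : Form C) : Prop extends IsLinkedBilinear C s M B where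
  self_eq_zero : ∀ i (U : S.Opens) (x : Γ(C.E i, U)), (B i i).app U x x = 0
  antisymm : ∀ i j, i ≠ j → ∀ (U : S.Opens) (x : Γ(C.E i, U)) (y : Γ(C.E j, U)),
    (B i j).app U x y = -(B j i).app U y x

/-- A linked symplectic form of index `m = M / 2`: a linked alternating form such that
* `⟨,⟩_{i,j}` is nondegenerate if `i + j = 2m`;
* if `2m < n + 1`, then on fibers where `s = 0` and for `2m - 1 < i ≤ n`, the degeneracy of
  `⟨,⟩_{i,i}` is equal to `ker f^{i-1}`;
* if `2m > n + 1`, then on fibers where `s = 0` and for `1 ≤ i < 2m - n`, the degeneracy of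
  `⟨,⟩_{i,i}` is equal to `ker f_i`. -/
structure IsLinkedSymplectic {S : Scheme.{u}} {n : ℕ} (C : Chain S n) (s : Γ(S, ⊤)) (M : ℕ)
    (B : Form C) : Prop extends IsLinkedAlternating C s M B where
  nondegenerate : ∀ i j : Fin n, (i.val + 1) + (j.val + 1) = M →
    ∀ x : S, (B i j).NondegenerateAt x
  degeneracy_down : M < n + 1 → ∀ x : S, S.Γevaluation x s = 0 →
    ∀ i j h, M < (j.val + 1) + 1 → (B j j).DegeneracyEqKerAt (C.down i j h) x
  degeneracy_up : n + 1 < M → ∀ x : S, S.Γevaluation x s = 0 →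
    ∀ i j h, (i.val + 1) + n < M → (B i i).DegeneracyEqKerAt (C.up i j h) x

/-- A linked subbundle over `g : T ⟶ S` is isotropic for the pullback along `g` of the form `B`. -/
def LinkedSubbundle.IsIsotropic {S : Scheme.{u}} {n : ℕ} {C : Chain S n} {r : ℕ} {T : Scheme.{u}}
    {g : T ⟶ S} (F : LinkedSubbundle C r g) (B : Form C) : Prop :=
  ∀ i j, ∃ B' : Pairing (pull g (C.E i)) (pull g (C.E j)), (B i j).IsPullback g B' ∧
    ∀ (U : T.Opens), ∀ x ∈ (F.F i).sections U, ∀ y ∈ (F.F j).sections U, B'.app U x y = 0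

/-- The closed subscheme of the linked Grassmannian parametrizing the linked subbundles which are
isotropic for `B`; for a linked symplectic form this is the linked symplectic Grassmannian. -/
structure IsotropicGrassmannian {S : Scheme.{u}} {n : ℕ} {C : Chain S n} {r : ℕ}
    (LG : LinkedGrassmannian C r) (B : Form C) where
  /-- the underlying scheme -/
  scheme : Scheme.{u}
  /-- the inclusion -/
  ι : scheme ⟶ LG.scheme
  isClosedImmersion : IsClosedImmersion ι
  /-- a `T`-point of the linked Grassmannian factors through the subscheme if and only if the
  corresponding linked subbundle is isotropic -/
  factors_iff : ∀ (T : Scheme.{u}) (φ : T ⟶ LG.scheme)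
    (F : LinkedSubbundle C r (φ ≫ LG.hom)),
      LG.univ.IsPullback φ LG.hom (φ ≫ LG.hom) rfl F →
        ((∃ ψ : T ⟶ scheme, ψ ≫ ι = φ) ↔ F.IsIsotropic B)

/-! ### Geometric notions -/

/-- A regular scheme: a locally noetherian scheme all of whose local rings are regular. -/
def IsRegularScheme (X : Scheme.{u}) : Prop :=
  IsLocallyNoetherian X ∧ ∀ x : X, IsRegularLocalRing (X.presheaf.stalk x)

/-- The point `x` is a smooth point of `X` over `S`. -/
def IsSmoothPoint {X S : Scheme.{u}} (p : X ⟶ S) (x : X) : Prop :=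
  ∃ U : X.Opens, x ∈ U ∧ Smooth (U.ι ≫ p)

/-- The codimension at `z` of a closed subscheme `Z` of `X`: the height of its ideal in the local
ring of `X`, which is the least codimension of an irreducible component of `Z` through `z`. -/
def codimAt {Z X : Scheme.{u}} (ι : Z ⟶ X) (z : Z) : ℕ∞ :=
  (RingHom.ker (ι.stalkMap z).hom).height

end

end LinkedSymplectic

/-! The question is local at the image `x` of `z`. Let `U` be an affine open of `S` over which all
`E_i` are free, `V` an affine neighbourhood of `x` inside the smooth locus and over `U`, and put `R
= Γ(S, U)`, `A = Γ(LG, V)`, `κ = κ(x)`. After shrinking `V`, the universal subbundles are the column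
spans of matrices `P_i` over `A`. The ring `A` is smooth over `R`, and the isotropic locus is cut
out in `V` by the ideal `J` of all entries of the matrices `P_iᵀ B_{ij} P_j`
(`IsotropicGrassmannian.ker_eq`). It suffices to find `r.choose 2` elements of `J` which generate it
near `x` and whose differentials at `x` are independent. The Jacobian criterion
(`exists_smooth_and_height_eq`) then gives smoothness, and Krull's height theorem together with
going down gives the codimension.

The generators come from an adapted frame: vectors `e_k ∈ F_{idx k}` in the fiber `F` at `x` whose
transports along the chain form a basis of every `F_j`. If `s ≠ 0` at `x`, all maps of the chain are
invertible and a basis of one `F_i` will do. If `s = 0`, such a frame exists once `ker (u_i | F_i) =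
v_i F_{i+1}` for all `i` (`IsLinkedSpace.exists_adapted_frame`), and this is where smoothness of the
linked Grassmannian is decisive. By representability every first order deformation of `F` is given
by a derivation `A → κ` (`LinkedGrassmannian.hasTangents`), and by smoothness it extends to second
order. If exactness failed, there would be a first order deformation with no such extension
(`exists_obstructed_deformation`, `IsLinkedMatrix.exact`).

Lift the `e_k` to sections over `A`. Transporting an argument of the form only multiplies it by a
power of `s`, so near `x` the ideal `J` is generated by the functions `⟨e_k, e_l⟩` with `k < l`
(`IsLinkedMatrix.exists_mul_mem`). Any vectors `w_k` are the first order variations of the `e_k` in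
some deformation, so a linear relation between the differentials of these functions yields an
antisymmetric matrix `c` with `∑ l, c k l * ⟨y, e_l⟩ = 0` for every `k` and every vector `y`. The
conditions on a symplectic form force `c = 0` (`IsSymplecticPairing.eq_zero_of_sum_eq_zero`):
directly by nondegeneracy when `idx k` has a partner index, and otherwise by the degeneracy
conditions and induction on the index. -/

namespace LinkedSymplectic

noncomputable section

/-! ### Pullback and restriction of sections. -/

variable {T G X : Scheme.{u}}

lemma pullSection_smul (g : T ⟶ X) (M : X.Modules) (W : X.Opens) (a : Γ(X, W)) (x : Γ(M, W)) :
    pullSection g M W (a • x) = g.app W a • pullSection g M W x :=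
  Scheme.Modules.Hom.app_smul _ a x

lemma pullSection_add (g : T ⟶ X) (M : X.Modules) (W : X.Opens) (x y : Γ(M, W)) :
    pullSection g M W (x + y) = pullSection g M W x + pullSection g M W y :=
  map_add _ x y

lemma hom_app_res {M N : X.Modules} (f : M ⟶ N) {U V : X.Opens} (h : V ≤ U) (x : Γ(M, U)) :
    f.app V (res M h x) = res N h (f.app U x) :=
  congr($(f.mapPresheaf.naturality (homOfLE h).op) x)

lemma pullSection_res (g : T ⟶ X) (M : X.Modules) {W W' : X.Opens} (h : W' ≤ W) (x : Γ(M, W)) :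
    pullSection g M W' (res M h x) = res (pull g M) (g.preimage_mono h) (pullSection g M W x) :=
  hom_app_res (((Scheme.Modules.pullbackPushforwardAdjunction g).unit.app M)) h x

lemma pullMap_pullSection (g : T ⟶ X) {M N : X.Modules} (f : M ⟶ N) (W : X.Opens) (x : Γ(M, W)) :
    (pullMap g f).app (g ⁻¹ᵁ W) (pullSection g M W x) = pullSection g N W (f.app W x) := by
  have := (Scheme.Modules.pullbackPushforwardAdjunction g).unit.naturality f
  exact congr(($(this.symm)).app W x)

/-- The inverse of the comparison `φ^* p^* ≅ (φ ≫ p)^*` is conjugate to the comparison of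
pushforwards, so it is compatible with the units of the adjunctions, and pulled back sections are
values of units. -/
lemma pullSectionOver_pullSection (φ : T ⟶ G) (p : G ⟶ X) (M : X.Modules) (W : X.Opens)
    (x : Γ(M, W)) :
    pullSectionOver φ p (φ ≫ p) rfl M (p ⁻¹ᵁ W) (pullSection p M W x) =
      pullSection (φ ≫ p) M W x := by
  have h1 := unit_conjugateEquiv ((Scheme.Modules.pullbackPushforwardAdjunction p).comp
    (Scheme.Modules.pullbackPushforwardAdjunction φ))
    (Scheme.Modules.pullbackPushforwardAdjunction (φ ≫ p))
    (Scheme.Modules.pullbackComp φ p).inv M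
  rw [Scheme.Modules.conjugateEquiv_pullbackComp_inv] at h1
  rw [Adjunction.comp_unit_app] at h1
  have h2 : pullSection φ (pull p M) (p ⁻¹ᵁ W) (pullSection p M W x) =
    ((Scheme.Modules.pullbackComp φ p).inv.app M).app _ (pullSection (φ ≫ p) M W x) :=
    congr(($h1).app W x)
  have h3 : (((Scheme.Modules.pullbackComp φ p).inv.app M) ≫
      ((Scheme.Modules.pullbackComp φ p).hom.app M)).app (φ ⁻¹ᵁ p ⁻¹ᵁ W)
      (pullSection (φ ≫ p) M W x) = pullSection (φ ≫ p) M W x := by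
    rw [Iso.inv_hom_id_app]; rfl
  have h4 : Scheme.Modules.pullbackComp φ p ≪≫ Scheme.Modules.pullbackCongr rfl =
      Scheme.Modules.pullbackComp φ p := by
    rw [Scheme.Modules.pullbackCongr, eqToIso_refl]
    exact Iso.trans_refl _
  rw [pullSectionOver, h2, h4]
  exact h3

/-- The component at `M` of a natural transformation out of a composite functor. -/
def compApp {P : X.Modules ⥤ G.Modules} {Q : G.Modules ⥤ T.Modules} {R : X.Modules ⥤ T.Modules}
    (α : P ⋙ Q ⟶ R) (M : X.Modules) : Q.obj (P.obj M) ⟶ R.obj M := α.app M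

lemma compApp_app {P : X.Modules ⥤ G.Modules} {Q : G.Modules ⥤ T.Modules}
    {R : X.Modules ⥤ T.Modules} (α : P ⋙ Q ⟶ R) (M : X.Modules) (W : T.Opens)
    (y : Γ(Q.obj (P.obj M), W)) : (α.app M).app W y = (compApp α M).app W y := rfl

/-- The canonical morphism `φ^* p^* M ⟶ g^* M` for `g = φ ≫ p`. -/
def pullComp (φ : T ⟶ G) (p : G ⟶ X) (g : T ⟶ X) (h : φ ≫ p = g) (M : X.Modules) :
    pull φ (pull p M) ⟶ pull g M :=
  compApp (Scheme.Modules.pullbackComp φ p ≪≫ Scheme.Modules.pullbackCongr h).hom M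

lemma pullSectionOver_eq (φ : T ⟶ G) (p : G ⟶ X) (g : T ⟶ X) (h : φ ≫ p = g) (M : X.Modules)
    (W : G.Opens) (x : Γ(pull p M, W)) :
    pullSectionOver φ p g h M W x =
      (pullComp φ p g h M).app (φ ⁻¹ᵁ W) (pullSection φ (pull p M) W x) := by
  rw [pullSectionOver, compApp_app]; rfl

lemma pullSectionOver_smul (φ : T ⟶ G) (p : G ⟶ X) (g : T ⟶ X) (h : φ ≫ p = g) (M : X.Modules)
    (W : G.Opens) (a : Γ(G, W)) (x : Γ(pull p M, W)) :
    pullSectionOver φ p g h M W (a • x) = φ.app W a • pullSectionOver φ p g h M W x := by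
  rw [pullSectionOver_eq, pullSectionOver_eq, pullSection_smul, Scheme.Modules.Hom.app_smul]

lemma pullSectionOver_add (φ : T ⟶ G) (p : G ⟶ X) (g : T ⟶ X) (h : φ ≫ p = g) (M : X.Modules)
    (W : G.Opens) (x y : Γ(pull p M, W)) :
    pullSectionOver φ p g h M W (x + y) =
      pullSectionOver φ p g h M W x + pullSectionOver φ p g h M W y := by
  rw [pullSectionOver_eq, pullSectionOver_eq, pullSectionOver_eq, pullSection_add, map_add]

lemma pullSectionOver_res (φ : T ⟶ G) (p : G ⟶ X) (g : T ⟶ X) (h : φ ≫ p = g) (M : X.Modules)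
    {W W' : G.Opens} (hW : W' ≤ W) (x : Γ(pull p M, W)) :
    pullSectionOver φ p g h M W' (res _ hW x) =
      res _ (φ.preimage_mono hW) (pullSectionOver φ p g h M W x) := by
  rw [pullSectionOver_eq, pullSectionOver_eq, pullSection_res]
  exact hom_app_res _ _ _

lemma res_smul {M : X.Modules} {U V : X.Opens} (h : V ≤ U) (a : Γ(X, U)) (x : Γ(M, U)) :
    res M h (a • x) = resO h a • res M h x :=
  M.map_smul (homOfLE h) a x

lemma res_add {M : X.Modules} {U V : X.Opens} (h : V ≤ U) (x y : Γ(M, U)) :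
    res M h (x + y) = res M h x + res M h y :=
  map_add _ x y

lemma res_res {M : X.Modules} {U V W : X.Opens} (h : V ≤ U) (h' : W ≤ V) (x : Γ(M, U)) :
    res M h' (res M h x) = res M (h'.trans h) x := by
  rw [res, res, ← ConcreteCategory.comp_apply, ← Functor.map_comp]; rfl

lemma res_self {M : X.Modules} {U : X.Opens} (h : U ≤ U) (x : Γ(M, U)) : res M h x = x := by
  rw [res, show (homOfLE h).op = 𝟙 _ from rfl, CategoryTheory.Functor.map_id]; rfl

lemma res_ext {M : X.Modules} {U : X.Opens} (x y : Γ(M, U))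
    (H : ∀ p ∈ U, ∃ (V : X.Opens) (h : V ≤ U), p ∈ V ∧ res M h x = res M h y) : x = y := by
  exact M.isSheaf.section_ext (fun p hp => H p hp)

/-- A morphism of `𝒪_X`-modules from a compatible family of maps on sections. -/
def homMk {M N : X.Modules} (φ : ∀ U : X.Opens, Γ(M, U) →+ Γ(N, U))
    (hs : ∀ (U : X.Opens) (a : Γ(X, U)) (x : Γ(M, U)), φ U (a • x) = a • φ U x)
    (hr : ∀ {U V : X.Opens} (h : V ≤ U) (x : Γ(M, U)), φ V (res M h x) = res N h (φ U x)) :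
    M ⟶ N where
  val := PresheafOfModules.homMk
    { app := fun U => AddCommGrpCat.ofHom (φ U.unop)
      naturality := fun U V i => by
        ext x
        exact hr (leOfHom i.unop) x }
    (fun U r m => hs U.unop r m)

/-- The structure sheaf as a module over itself. -/
def unitModule (X : Scheme.{u}) : X.Modules := SheafOfModules.unit X.ringCatSheaf

/-- The sections of `N` over opens intersected with `V`. -/
def localize (V : T.Opens) (N : T.Modules) : T.Modules :=
  (Scheme.Modules.pushforward V.ι).obj (N.restrict V.ι)

/-- This is the intersection of `V` and `W`, in the form for which a section of `localize V N` over
`W` is by definition a section of `N` over it; `toCut` and `ofCut` are therefore identities. -/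
def cut (V W : T.Opens) : T.Opens := V.ι ''ᵁ (V.ι ⁻¹ᵁ W)

lemma cut_le (V W : T.Opens) : cut V W ≤ W := V.ι.image_preimage_le W

lemma cut_le' (V W : T.Opens) : cut V W ≤ V := by
  rintro _ ⟨y, -, rfl⟩; exact y.2

lemma le_cut {V W : T.Opens} (h : W ≤ V) : W ≤ cut V W := fun y hy => ⟨⟨y, h hy⟩, hy, rfl⟩

lemma cut_mono {V W W' : T.Opens} (h : W' ≤ W) : cut V W' ≤ cut V W :=
  V.ι.image_mono (V.ι.preimage_mono h)

def ofCut {V : T.Opens} {N : T.Modules} {W : T.Opens} (x : Γ(N, cut V W)) :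
    Γ(localize V N, W) := x

def toCut {V : T.Opens} {N : T.Modules} {W : T.Opens} (x : Γ(localize V N, W)) :
    Γ(N, cut V W) := x

lemma toCut_smul {V : T.Opens} {N : T.Modules} {W : T.Opens} (a : Γ(T, W))
    (x : Γ(localize V N, W)) : toCut (a • x) = resO (cut_le V W) a • toCut x := by
  exact congr(($(V.ι.app_appIso_inv W)).hom a • (show Γ(N, V.ι ''ᵁ (V.ι ⁻¹ᵁ W)) from toCut x))

lemma toCut_res {V : T.Opens} {N : T.Modules} {W W' : T.Opens} (h : W' ≤ W)
    (x : Γ(localize V N, W)) : toCut (res _ h x) = res _ (cut_mono h) (toCut x) := rfl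

/-! ### Frames and coordinates. -/

namespace IsFrame
variable {M : X.Modules} {U : X.Opens} {κ : Type} {e : κ → Γ(M, U)}

/-- The basis of sections over a smaller open subset defined by a frame. -/
def basis (he : IsFrame M U e) {V : X.Opens} (h : V ≤ U) : Module.Basis κ Γ(X, V) Γ(M, V) :=
  Module.Basis.mk (he V h).1 (he V h).2.ge

lemma basis_apply (he : IsFrame M U e) {V : X.Opens} (h : V ≤ U) (k : κ) :
    he.basis h k = res M h (e k) := by simp [basis]

variable [Fintype κ]

/-- The coordinates of a section with respect to a frame. -/
def coord (he : IsFrame M U e) {V : X.Opens} (h : V ≤ U) : Γ(M, V) ≃ₗ[Γ(X, V)] (κ → Γ(X, V)) :=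
  (he.basis h).equivFun

lemma sum_coord (he : IsFrame M U e) {V : X.Opens} (h : V ≤ U) (x : Γ(M, V)) :
    ∑ k, he.coord h x k • res M h (e k) = x := by
  simpa only [basis_apply, coord] using (he.basis h).sum_equivFun x

lemma coord_res (he : IsFrame M U e) {V : X.Opens} (h : V ≤ U) [DecidableEq κ] (k : κ) :
    he.coord h (res M h (e k)) = Pi.single k 1 := by
  rw [coord, ← basis_apply he]
  ext l
  rw [Module.Basis.equivFun_self, Pi.single_apply]; simp [eq_comm]

lemma coord_eq (he : IsFrame M U e) {V : X.Opens} (h : V ≤ U) (c : κ → Γ(X, V)) (x : Γ(M, V))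
    (hx : x = ∑ k, c k • res M h (e k)) : he.coord h x = c := by
  classical
  subst hx
  rw [map_sum]
  simp only [map_smul, coord_res]
  ext l
  simp [Finset.sum_apply, Pi.single_apply]

lemma _root_.LinkedSymplectic.res_sum {M : X.Modules} {U V : X.Opens} (h : V ≤ U) {ι : Type*}
    (s : Finset ι) (x : ι → Γ(M, U)) : res M h (∑ k ∈ s, x k) = ∑ k ∈ s, res M h (x k) :=
  map_sum (M.presheaf.map (homOfLE h).op).hom _ _

lemma coord_res_apply (he : IsFrame M U e) {V W : X.Opens} (h : V ≤ U) (h' : W ≤ V)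
    (x : Γ(M, V)) (k : κ) :
    he.coord (h'.trans h) (res M h' x) k = resO h' (he.coord h x k) := by
  rw [he.coord_eq (h'.trans h) (fun k => resO h' (he.coord h x k))]
  conv_lhs => rw [← he.sum_coord h x, res_sum]
  simp only [res_smul, res_res]

/-- Linear coordinate functions dual to `e` give independence, and the reconstruction formula gives
generation. Frames are recognised in this way after pullback and after a change of basis. -/
lemma mk' (c : ∀ {V : X.Opens}, V ≤ U → Γ(M, V) → κ → Γ(X, V))
    (hsmul : ∀ {V : X.Opens} (h : V ≤ U) (a : Γ(X, V)) x, c h (a • x) = a • c h x)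
    (hadd : ∀ {V : X.Opens} (h : V ≤ U) (x y), c h (x + y) = c h x + c h y)
    [DecidableEq κ]
    (hc : ∀ {V : X.Opens} (h : V ≤ U) k, c h (res M h (e k)) = Pi.single k 1)
    (hs : ∀ {V : X.Opens} (h : V ≤ U) x, ∑ k, c h x k • res M h (e k) = x) : IsFrame M U e := by
  intro V h
  constructor
  · rw [Fintype.linearIndependent_iff]
    intro a ha k
    let f : Γ(M, V) →ₗ[Γ(X, V)] (κ → Γ(X, V)) :=
      { toFun := c h, map_add' := hadd h, map_smul' := hsmul h }
    have := congr(f $ha k)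
    rw [map_sum, map_zero, Finset.sum_apply] at this
    simpa [f, hsmul, hc, Pi.single_apply] using this
  · rw [eq_top_iff]
    intro x _
    rw [← hs h x]
    exact sum_mem fun k _ => Submodule.smul_mem _ _ (Submodule.subset_span ⟨k, rfl⟩)

omit [Fintype κ] in
lemma restrict (he : IsFrame M U e) {V : X.Opens} (h : V ≤ U) :
    IsFrame M V (fun k => res M h (e k)) := by
  intro W hW
  simpa only [res_res] using he W (hW.trans h)

end IsFrame

/-- By adjunction a morphism out of `g^* M` is its transpose, which records exactly the values on
pulled back sections. -/
lemma pullHom_ext (g : T ⟶ X) {M : X.Modules} {N : T.Modules} {a b : pull g M ⟶ N}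
    (H : ∀ (W : X.Opens) (x : Γ(M, W)), a.app _ (pullSection g M W x) =
      b.app _ (pullSection g M W x)) : a = b := by
  apply ((Scheme.Modules.pullbackPushforwardAdjunction g).homEquiv _ _).injective
  ext W x
  rw [Adjunction.homEquiv_unit, Adjunction.homEquiv_unit]
  exact H W x

/-- The morphism out of a pullback corresponding to a morphism into a pushforward. -/
def pullDesc (g : T ⟶ X) {M : X.Modules} {N : T.Modules}
    (f : M ⟶ (Scheme.Modules.pushforward g).obj N) : pull g M ⟶ N :=
  ((Scheme.Modules.pullbackPushforwardAdjunction g).homEquiv _ _).symm f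

lemma pullDesc_app (g : T ⟶ X) {M : X.Modules} {N : T.Modules}
    (f : M ⟶ (Scheme.Modules.pushforward g).obj N) (W : X.Opens) (x : Γ(M, W)) :
    (pullDesc g f).app (g ⁻¹ᵁ W) (pullSection g M W x) = f.app W x := by
  have := ((Scheme.Modules.pullbackPushforwardAdjunction g).homEquiv _ _).apply_symm_apply f
  rw [Adjunction.homEquiv_unit] at this
  exact congr(($this).app W x)

/-! ### The pullback of a frame is a frame. -/

section PullFrame
variable (g : T ⟶ X) {M : X.Modules} {U : X.Opens} {κ : Type} [Fintype κ] {e : κ → Γ(M, U)}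

lemma cut_preimage_le (W : X.Opens) : cut (g ⁻¹ᵁ U) (g ⁻¹ᵁ W) ≤ g ⁻¹ᵁ (W ⊓ U) :=
  le_inf (cut_le _ _) (cut_le' _ _)

lemma appLE_resO {W W' : X.Opens} {V : T.Opens} (h : V ≤ g ⁻¹ᵁ W') (hW : W' ≤ W) (a : Γ(X, W)) :
    g.appLE W' V h (resO hW a) = g.appLE W V (h.trans (g.preimage_mono hW)) a :=
  congr(($(g.map_appLE h (homOfLE hW).op)).hom a)

lemma resO_app {W : X.Opens} {V : T.Opens} (h : V ≤ g ⁻¹ᵁ W) (a : Γ(X, W)) :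
    resO h (g.app W a) = g.appLE W V h a := rfl

lemma resO_appLE {W : X.Opens} {V V' : T.Opens} (h : V ≤ g ⁻¹ᵁ W) (hV : V' ≤ V) (a : Γ(X, W)) :
    resO hV (g.appLE W V h a) = g.appLE W V' (hV.trans h) a :=
  congr(($(g.appLE_map h (homOfLE hV).op)).hom a)

/-- A section of the localized structure sheaf as a function. -/
def toFunction {V : T.Opens} {W : T.Opens} (x : Γ(localize V (unitModule T), W)) :
    Γ(T, cut V W) := x

lemma toFunction_smul {V W : T.Opens} (a : Γ(T, W)) (x : Γ(localize V (unitModule T), W)) :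
    toFunction (a • x) = resO (cut_le V W) a * toFunction x :=
  toCut_smul a x

lemma toFunction_add {V W : T.Opens} (x y : Γ(localize V (unitModule T), W)) :
    toFunction (x + y) = toFunction x + toFunction y := rfl

lemma toFunction_res {V : T.Opens} {W W' : T.Opens} (h : W' ≤ W)
    (x : Γ(localize V (unitModule T), W)) :
    toFunction (res _ h x) = resO (cut_mono h) (toFunction x) := rfl

lemma toCut_add {V : T.Opens} {N : T.Modules} {W : T.Opens} (x y : Γ(localize V N, W)) :
    toCut (x + y) = toCut x + toCut y := rfl

lemma toCut_ofCut {V : T.Opens} {N : T.Modules} {W : T.Opens} (x : Γ(N, cut V W)) :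
    toCut (ofCut (N := N) x) = x := rfl

lemma toCut_injective {V : T.Opens} {N : T.Modules} {W : T.Opens} {x y : Γ(localize V N, W)}
    (h : toCut x = toCut y) : x = y := h

lemma resO_resO {U V W : T.Opens} (h : V ≤ U) (h' : W ≤ V) (a : Γ(T, U)) :
    resO h' (resO h a) = resO (h'.trans h) a := res_res (M := unitModule T) h h' a

lemma resO_self {U : T.Opens} (h : U ≤ U) (a : Γ(T, U)) : resO h a = a :=
  res_self (M := unitModule T) h a

lemma resO_mul {U V : T.Opens} (h : V ≤ U) (a b : Γ(T, U)) : resO h (a * b) = resO h a * resO h b :=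
  map_mul (T.presheaf.map (homOfLE h).op).hom _ _

lemma resO_add {U V : T.Opens} (h : V ≤ U) (a b : Γ(T, U)) : resO h (a + b) = resO h a + resO h b :=
  map_add (T.presheaf.map (homOfLE h).op).hom _ _

/-- The coordinate functions of a pulled back frame. -/
def pullCoordHom (he : IsFrame M U e) (k : κ) :
    pull g M ⟶ localize (g ⁻¹ᵁ U) (unitModule T) :=
  -- A coordinate is defined only over `U`, so the target is the structure sheaf restricted to `g
  -- ⁻¹ᵁ U` and pushed forward again to `T`. By adjunction it is enough to treat sections over opens
  -- `W` of `X`, using their restriction to `W ⊓ U`.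
  pullDesc g <| homMk
    (fun W => AddMonoidHom.mk' (fun x => ofCut (V := g ⁻¹ᵁ U) (N := unitModule T) (W := g ⁻¹ᵁ W)
      (g.appLE (W ⊓ U) (cut (g ⁻¹ᵁ U) (g ⁻¹ᵁ W)) (cut_preimage_le g W)
        (he.coord (inf_le_right : W ⊓ U ≤ U) (res M inf_le_left x) k))) (by
          intro x y
          rw [res_add, map_add, Pi.add_apply, map_add]; rfl))
    (by
      intro W a x
      change g.appLE (W ⊓ U) (cut (g ⁻¹ᵁ U) (g ⁻¹ᵁ W)) (cut_preimage_le g W)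
        (he.coord (inf_le_right : W ⊓ U ≤ U) (res M inf_le_left (a • x)) k) = toFunction (V := g ⁻¹ᵁ U) _
      refine Eq.trans ?_ (toFunction_smul (V := g ⁻¹ᵁ U) (g.app W a) _).symm
      rw [res_smul, map_smul, Pi.smul_apply, smul_eq_mul, map_mul, appLE_resO, resO_app]
      rfl)
    (by
      intro W W' h x
      change g.appLE (W' ⊓ U) (cut (g ⁻¹ᵁ U) (g ⁻¹ᵁ W')) (cut_preimage_le g W')
        (he.coord (inf_le_right : W' ⊓ U ≤ U) (res M inf_le_left (res M h x)) k) =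
        resO (cut_mono (V := g ⁻¹ᵁ U) (g.preimage_mono h))
        (g.appLE (W ⊓ U) (cut (g ⁻¹ᵁ U) (g ⁻¹ᵁ W)) (cut_preimage_le g W)
        (he.coord (inf_le_right : W ⊓ U ≤ U) (res M inf_le_left x) k))
      rw [resO_appLE]
      have h' : W' ⊓ U ≤ W ⊓ U := inf_le_inf_right _ h
      rw [← appLE_resO g (cut_preimage_le g W') h', ← IsFrame.coord_res_apply, res_res, res_res])

lemma pullCoordHom_app (he : IsFrame M U e) (k : κ) (W : X.Opens) (x : Γ(M, W)) :
    toFunction ((pullCoordHom g he k).app (g ⁻¹ᵁ W) (pullSection g M W x)) =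
      g.appLE (W ⊓ U) (cut (g ⁻¹ᵁ U) (g ⁻¹ᵁ W)) (cut_preimage_le g W)
        (he.coord (inf_le_right : W ⊓ U ≤ U) (res M inf_le_left x) k) :=
  pullDesc_app g _ W x

/-- The coordinate functions of a pulled back frame. -/
def pullCoord (he : IsFrame M U e) {V : T.Opens} (h : V ≤ g ⁻¹ᵁ U) (x : Γ(pull g M, V)) (k : κ) :
    Γ(T, V) :=
  resO (le_cut h) (toFunction ((pullCoordHom g he k).app V x))

lemma pullCoord_smul (he : IsFrame M U e) {V : T.Opens} (h : V ≤ g ⁻¹ᵁ U) (a : Γ(T, V))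
    (x : Γ(pull g M, V)) : pullCoord g he h (a • x) = a • pullCoord g he h x := by
  ext k
  rw [Pi.smul_apply, smul_eq_mul, pullCoord, pullCoord, Scheme.Modules.Hom.app_smul,
    toFunction_smul, resO_mul, resO_resO, resO_self]

lemma pullCoord_add (he : IsFrame M U e) {V : T.Opens} (h : V ≤ g ⁻¹ᵁ U)
    (x y : Γ(pull g M, V)) : pullCoord g he h (x + y) = pullCoord g he h x + pullCoord g he h y := by
  ext k
  rw [Pi.add_apply, pullCoord, pullCoord, pullCoord, map_add, toFunction_add, resO_add]

lemma pullCoord_res (he : IsFrame M U e) {V V' : T.Opens} (h : V ≤ g ⁻¹ᵁ U) (h' : V' ≤ V)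
    (x : Γ(pull g M, V)) (k : κ) :
    pullCoord g he (h'.trans h) (res _ h' x) k = resO h' (pullCoord g he h x k) := by
  rw [pullCoord, pullCoord, hom_app_res, toFunction_res, resO_resO, resO_resO]

lemma pullCoord_pullSection (he : IsFrame M U e) {W : X.Opens} (hW : W ≤ U) (x : Γ(M, W)) (k : κ) :
    pullCoord g he (g.preimage_mono hW) (pullSection g M W x) k = g.app W (he.coord hW x k) := by
  rw [pullCoord, pullCoordHom_app, resO_appLE]
  have h : W ⊓ U ≤ W := inf_le_left
  have := he.coord_res_apply hW h x k
  erw [this]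
  rw [appLE_resO, ← resO_app, resO_self]

/-- The linear combination of the frame given by the coordinate functions, as a morphism. -/
def pullSumHom (he : IsFrame M U e) : pull g M ⟶ localize (g ⁻¹ᵁ U) (pull g M) :=
  homMk (fun V => AddMonoidHom.mk' (fun x => ofCut (N := pull g M) (∑ k,
      toFunction ((pullCoordHom g he k).app V x) •
        res (pull g M) (cut_le' _ _) (pullSection g M U (e k)))) (by
      intro x y
      apply toCut_injective
      rw [toCut_add, toCut_ofCut, toCut_ofCut, toCut_ofCut, ← Finset.sum_add_distrib]
      refine Finset.sum_congr rfl fun k _ => ?_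
      rw [map_add, toFunction_add, add_smul]))
    (by
      intro V a x
      apply toCut_injective
      rw [toCut_smul, AddMonoidHom.mk'_apply, toCut_ofCut, toCut_ofCut,
        Finset.smul_sum]
      refine Finset.sum_congr rfl fun k _ => ?_
      rw [Scheme.Modules.Hom.app_smul, toFunction_smul, mul_smul])
    (by
      intro V V' h x
      apply toCut_injective
      rw [toCut_res, AddMonoidHom.mk'_apply, toCut_ofCut, AddMonoidHom.mk'_apply, toCut_ofCut,
        res_sum]
      refine Finset.sum_congr rfl fun k _ => ?_
      rw [res_smul, res_res, hom_app_res, toFunction_res])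

lemma toCut_pullSumHom (he : IsFrame M U e) {V : T.Opens} (x : Γ(pull g M, V)) :
    toCut ((pullSumHom g he).app V x) = ∑ k, toFunction ((pullCoordHom g he k).app V x) •
        res (pull g M) (cut_le' _ _) (pullSection g M U (e k)) := rfl

lemma pullSection_sum {ι : Type*} (s : Finset ι) (W : X.Opens) (x : ι → Γ(M, W)) :
    pullSection g M W (∑ k ∈ s, x k) = ∑ k ∈ s, pullSection g M W (x k) :=
  map_sum (((Scheme.Modules.pullbackPushforwardAdjunction g).unit.app M).app W).hom _ _

/-- Both sides are values of morphisms from `g^* M` to its localization at `g ⁻¹ᵁ U`, namely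
`pullSumHom` and the restriction map. By `pullHom_ext` they need only be compared on pulled back
sections, where the identity is the expansion in the frame `e`. -/
lemma pull_sum (he : IsFrame M U e) {V : T.Opens} (h : V ≤ g ⁻¹ᵁ U) (x : Γ(pull g M, V)) :
    ∑ k, pullCoord g he h x k • res (pull g M) h (pullSection g M U (e k)) = x := by
  have key : pullSumHom g he =
      (Scheme.Modules.restrictAdjunction (g ⁻¹ᵁ U).ι).unit.app (pull g M) := by
    apply pullHom_ext g
    intro W y
    apply toCut_injective
    refine Eq.trans (b := res (pull g M) (cut_le _ _) (pullSection g M W y)) ?_ rfl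
    have h1 : res (pull g M) (cut_le (g ⁻¹ᵁ U) (g ⁻¹ᵁ W)) (pullSection g M W y) =
      res (pull g M) (cut_preimage_le g W) (pullSection g M (W ⊓ U) (res M inf_le_left y)) := by
      rw [pullSection_res, res_res]
    rw [h1, ← he.sum_coord (inf_le_right : W ⊓ U ≤ U) (res M inf_le_left y), toCut_pullSumHom,
      pullSection_sum, res_sum]
    refine Finset.sum_congr rfl fun k _ => ?_
    rw [pullCoordHom_app, pullSection_smul, res_smul, pullSection_res, res_res]
    rfl
  have h2 := congr(res (pull g M) (le_cut h) (toCut (Scheme.Modules.Hom.app $key V x)))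
  rw [toCut_pullSumHom, res_sum] at h2
  refine Eq.trans ?_ (h2.trans ?_)
  · refine Finset.sum_congr rfl fun k _ => ?_
    rw [res_smul, res_res]
    rfl
  · exact (res_res (M := pull g M) (cut_le _ _) (le_cut h) x).trans (res_self le_rfl x)

/-- This reduces pullbacks to coordinate vectors: from here on, base change of sections, morphisms
and pairings is base change of the entries of matrices. -/
theorem IsFrame.pull (he : IsFrame M U e) :
    IsFrame (pull g M) (g ⁻¹ᵁ U) (fun k => pullSection g M U (e k)) := by
  classical
  refine IsFrame.mk' (fun h x => pullCoord g he h x) (fun h => pullCoord_smul g he h)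
    (fun h => pullCoord_add g he h) ?_ (fun h x => pull_sum g he h x)
  intro V h k
  ext l
  rw [pullCoord_res g he le_rfl h, pullCoord_pullSection g he le_rfl]
  have := he.coord_res le_rfl k
  rw [res_self] at this
  rw [this, Pi.single_apply, Pi.single_apply]
  split_ifs
  · simp [resO]
  · simp [resO]

end PullFrame

/-- Restriction of functions as a ring homomorphism. -/
def resHom {X : Scheme.{u}} {U V : X.Opens} (h : V ≤ U) : Γ(X, U) →+* Γ(X, V) :=
  (X.presheaf.map (homOfLE h).op).hom

lemma resHom_apply {U V : X.Opens} (h : V ≤ U) (a : Γ(X, U)) : resHom h a = resO h a := rfl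

lemma resHom_resHom {U V W : X.Opens} (h : V ≤ U) (h' : W ≤ V) (a : Γ(X, U)) :
    resHom h' (resHom h a) = resHom (h'.trans h) a := resO_resO h h' a

lemma resHom_self {U : X.Opens} (h : U ≤ U) (a : Γ(X, U)) : resHom h a = a := resO_self h a

/-- Pullback of functions. -/
def fnHom (g : T ⟶ X) {W : X.Opens} {V : T.Opens} (h : V ≤ g ⁻¹ᵁ W) : Γ(X, W) →+* Γ(T, V) :=
  (g.appLE W V h).hom

lemma fnHom_resHom (g : T ⟶ X) {W W' : X.Opens} {V : T.Opens} (h : V ≤ g ⁻¹ᵁ W') (hW : W' ≤ W)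
    (a : Γ(X, W)) : fnHom g h (resHom hW a) = fnHom g (h.trans (g.preimage_mono hW)) a :=
  appLE_resO g h hW a

lemma resHom_fnHom (g : T ⟶ X) {W : X.Opens} {V V' : T.Opens} (h : V ≤ g ⁻¹ᵁ W) (hV : V' ≤ V)
    (a : Γ(X, W)) : resHom hV (fnHom g h a) = fnHom g (hV.trans h) a :=
  resO_appLE g h hV a

lemma fnHom_fnHom (φ : T ⟶ G) (p : G ⟶ X) (g : T ⟶ X) (e : φ ≫ p = g) {W : X.Opens} {V : G.Opens}
    {V' : T.Opens} (h : V ≤ p ⁻¹ᵁ W) (h' : V' ≤ φ ⁻¹ᵁ V) (h'' : V' ≤ g ⁻¹ᵁ W) (a : Γ(X, W)) :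
    fnHom φ h' (fnHom p h a) = fnHom g h'' a := by
  subst e
  exact congr(($(Scheme.Hom.appLE_comp_appLE φ p W V V' h h')).hom a)

lemma fnHom_app (g : T ⟶ X) {W : X.Opens} (a : Γ(X, W)) :
    fnHom g (le_refl (g ⁻¹ᵁ W)) a = g.app W a := by
  rw [fnHom, Scheme.Hom.appLE_eq_app]

/-! ### Coordinates of pulled back sections and matrices of morphisms. -/

namespace IsFrame
variable {M : X.Modules} {U : X.Opens} {κ : Type} [Fintype κ] {e : κ → Γ(M, U)}

/-- The coordinates of a section of `g^* M` with respect to the pullback of a frame. -/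
def pcoord (he : IsFrame M U e) (g : T ⟶ X) {V : T.Opens} (hV : V ≤ g ⁻¹ᵁ U) :
    Γ(LinkedSymplectic.pull g M, V) ≃ₗ[Γ(T, V)] (κ → Γ(T, V)) :=
  (he.pull g).coord hV

lemma pcoord_res (he : IsFrame M U e) (g : T ⟶ X) {V V' : T.Opens} (hV : V ≤ g ⁻¹ᵁ U) (h : V' ≤ V)
    (x : Γ(LinkedSymplectic.pull g M, V)) :
    he.pcoord g (h.trans hV) (res _ h x) = resHom h ∘ he.pcoord g hV x := by
  ext k
  exact (he.pull g).coord_res_apply hV h x k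

lemma pcoord_pullSection (he : IsFrame M U e) (g : T ⟶ X) {W : X.Opens} (hW : W ≤ U)
    (x : Γ(M, W)) :
    he.pcoord g (g.preimage_mono hW) (pullSection g M W x) = fnHom g le_rfl ∘ he.coord hW x := by
  apply coord_eq
  conv_lhs => rw [← he.sum_coord hW x, pullSection_sum]
  refine Finset.sum_congr rfl fun k _ => ?_
  rw [pullSection_smul, pullSection_res, Function.comp_apply, fnHom_app]

omit [Fintype κ] in
lemma _root_.LinkedSymplectic.pullSectionOver_frame (φ : T ⟶ G) (p : G ⟶ X) (g : T ⟶ X)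
    (h : φ ≫ p = g) (k : κ) :
    pullSectionOver φ p g h M (p ⁻¹ᵁ U) (pullSection p M U (e k)) =
      res (LinkedSymplectic.pull g M) (by subst h; exact le_rfl) (pullSection g M U (e k)) := by
  subst h
  rw [pullSectionOver_pullSection]
  exact (res_self (M := LinkedSymplectic.pull (φ ≫ p) M) le_rfl _).symm

lemma pullSectionOver_sum (φ : T ⟶ G) (p : G ⟶ X) (g : T ⟶ X) (h : φ ≫ p = g) {ι : Type*}
    (s : Finset ι) (W : G.Opens) (x : ι → Γ(LinkedSymplectic.pull p M, W)) :
    pullSectionOver φ p g h M W (∑ k ∈ s, x k) = ∑ k ∈ s, pullSectionOver φ p g h M W (x k) := by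
  classical
  let f : Γ(LinkedSymplectic.pull p M, W) →+ Γ(LinkedSymplectic.pull g M, φ ⁻¹ᵁ W) :=
    AddMonoidHom.mk' (pullSectionOver φ p g h M W) (pullSectionOver_add φ p g h M W)
  exact map_sum f x s

lemma preimage_le_of_comp {φ : T ⟶ G} {p : G ⟶ X} {g : T ⟶ X} (h : φ ≫ p = g) {W : G.Opens}
    (hW : W ≤ p ⁻¹ᵁ U) : φ ⁻¹ᵁ W ≤ g ⁻¹ᵁ U := by
  subst h
  exact φ.preimage_mono hW

lemma pcoord_pullSectionOver (he : IsFrame M U e) (φ : T ⟶ G) (p : G ⟶ X) (g : T ⟶ X)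
    (h : φ ≫ p = g) {W : G.Opens} (hW : W ≤ p ⁻¹ᵁ U) (x : Γ(LinkedSymplectic.pull p M, W)) :
    he.pcoord g (preimage_le_of_comp h hW) (pullSectionOver φ p g h M W x) =
      fnHom φ le_rfl ∘ he.pcoord p hW x := by
  apply coord_eq
  conv_lhs => rw [← (he.pull p).sum_coord hW x, pullSectionOver_sum]
  refine Finset.sum_congr rfl fun k _ => ?_
  rw [pullSectionOver_smul, pullSectionOver_res, pullSectionOver_frame, res_res,
    Function.comp_apply, fnHom_app]
  rfl

/-- The matrix of a morphism with respect to frames. -/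
def matrix (_he : IsFrame M U e) {N : X.Modules} {κ' : Type} [Fintype κ'] {e' : κ' → Γ(N, U)}
    (he' : IsFrame N U e') (f : M ⟶ N) : Matrix κ' κ Γ(X, U) :=
  Matrix.of fun l k => he'.coord le_rfl (f.app U (e k)) l

lemma pcoord_pullMap (he : IsFrame M U e) {N : X.Modules} {κ' : Type} [Fintype κ']
    {e' : κ' → Γ(N, U)} (he' : IsFrame N U e') (f : M ⟶ N) (g : T ⟶ X) {V : T.Opens}
    (hV : V ≤ g ⁻¹ᵁ U) (x : Γ(LinkedSymplectic.pull g M, V)) :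
    he'.pcoord g hV ((pullMap g f).app V x) =
      ((he.matrix he' f).map (fnHom g hV)).mulVec (he.pcoord g hV x) := by
  conv_lhs => rw [← (he.pull g).sum_coord hV x]
  have h1 : (pullMap g f).app V (∑ k, (he.pull g).coord hV x k •
      res (LinkedSymplectic.pull g M) hV (pullSection g M U (e k))) =
      ∑ k, (he.pull g).coord hV x k • res _ hV (pullSection g N U (f.app U (e k))) := by
    rw [map_sum]
    refine Finset.sum_congr rfl fun k _ => ?_
    rw [Scheme.Modules.Hom.app_smul, hom_app_res, pullMap_pullSection]
  rw [h1, map_sum]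
  ext l
  rw [Finset.sum_apply, Matrix.mulVec, dotProduct]
  refine Finset.sum_congr rfl fun k _ => ?_
  rw [map_smul, Pi.smul_apply, smul_eq_mul, mul_comm]
  congr 1
  have h2 := he'.pcoord_res g le_rfl hV (pullSection g N U (f.app U (e k)))
  rw [he'.pcoord_pullSection g le_rfl] at h2
  have h3 := congrFun h2 l
  refine h3.trans ?_
  rw [Function.comp_apply, Function.comp_apply, resHom_fnHom]
  rfl

/-- Change of frames. -/
lemma change (he : IsFrame M U e) {κ' : Type} [Fintype κ'] [DecidableEq κ] [DecidableEq κ']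
    (P : Matrix κ κ' Γ(X, U)) (Q : Matrix κ' κ Γ(X, U)) (hPQ : P * Q = 1) (hQP : Q * P = 1) :
    IsFrame M U (fun k' => ∑ k, P k k' • e k) := by
  have hcol : ∀ {V : X.Opens} (h : V ≤ U) (k' : κ'), he.coord h (res M h (∑ k, P k k' • e k)) =
      fun k => resHom h (P k k') := by
    intro V h k'
    apply coord_eq
    rw [res_sum]
    exact Finset.sum_congr rfl fun k _ => res_smul _ _ _
  refine IsFrame.mk' (fun {V} h x => (Q.map (resHom h)).mulVec (he.coord h x)) ?_ ?_ ?_ ?_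
  · intro V h a x
    rw [map_smul, Matrix.mulVec_smul]
  · intro V h x y
    rw [map_add, Matrix.mulVec_add]
  · intro V h k'
    rw [hcol]
    have : (fun k => resHom h (P k k')) = (P.map (resHom h)).mulVec (Pi.single k' 1) := by
      ext k; simp
    rw [this, Matrix.mulVec_mulVec, ← Matrix.map_mul, hQP,
      Matrix.map_one _ (map_zero _) (map_one _), Matrix.one_mulVec]
  · intro V h x
    apply (he.coord h).injective
    rw [map_sum]
    simp only [map_smul, hcol]
    have : he.coord h x = (P.map (resHom h) * Q.map (resHom h)).mulVec (he.coord h x) := by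
      rw [← Matrix.map_mul, hPQ, Matrix.map_one _ (map_zero _) (map_one _), Matrix.one_mulVec]
    conv_rhs => rw [this, ← Matrix.mulVec_mulVec]
    generalize (Q.map (resHom h)).mulVec (he.coord h x) = c
    ext k
    rw [Finset.sum_apply, Matrix.mulVec, dotProduct]
    exact Finset.sum_congr rfl fun k' _ => mul_comm _ _

end IsFrame

lemma map_resHom_resHom {ι ι' : Type*} {U V W : X.Opens} (h : V ≤ U) (h' : W ≤ V)
    (P : Matrix ι ι' Γ(X, U)) : (P.map (resHom h)).map (resHom h') = P.map (resHom (h'.trans h)) := by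
  ext; simp [resHom_resHom]

lemma comp_mulVec {A B : Type*} [CommRing A] [CommRing B] {ι ι' : Type*} [Fintype ι']
    (f : A →+* B) (P : Matrix ι ι' A) (c : ι' → A) :
    f ∘ (P.mulVec c) = (P.map f).mulVec (f ∘ c) := by
  ext i
  exact RingHom.map_mulVec f P c i

lemma eq_of_locally {V : T.Opens} {a b : Γ(T, V)}
    (H : ∀ t ∈ V, ∃ (V' : T.Opens) (h : V' ≤ V), t ∈ V' ∧ resHom h a = resHom h b) : a = b :=
  res_ext (M := unitModule T) a b H

/-- A left inverse `Y` of `P` makes the coefficients unique: locally they are `Y v`, so `Y v` serves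
globally. -/
lemma exists_mulVec_of_locally {κ ι : Type*} [Fintype κ] [Fintype ι] [DecidableEq ι]
    {W V : T.Opens} (hV : V ≤ W) (P : Matrix κ ι Γ(T, W)) (Y : Matrix ι κ Γ(T, W)) (hY : Y * P = 1)
    (v : κ → Γ(T, V))
    (H : ∀ t ∈ V, ∃ (V' : T.Opens) (h : V' ≤ V), t ∈ V' ∧
      ∃ c, resHom h ∘ v = (P.map (resHom (h.trans hV))).mulVec c) :
    ∃ c, v = (P.map (resHom hV)).mulVec c := by
  refine ⟨(Y.map (resHom hV)).mulVec v, funext fun k => eq_of_locally fun t ht => ?_⟩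
  obtain ⟨V', h, ht', c, hc⟩ := H t ht
  refine ⟨V', h, ht', ?_⟩
  have h1 : resHom h ∘ ((P.map (resHom hV)).mulVec ((Y.map (resHom hV)).mulVec v)) =
      resHom h ∘ v := by
    rw [comp_mulVec, comp_mulVec, map_resHom_resHom, map_resHom_resHom, hc, Matrix.mulVec_mulVec,
      Matrix.mulVec_mulVec, Matrix.mul_assoc, ← Matrix.map_mul, hY,
      Matrix.map_one _ (map_zero _) (map_one _), Matrix.mul_one]
  exact (congrFun h1 k).symm

/-! ### Subbundles as column spans of matrices. -/

section
variable {M : X.Modules} {U : X.Opens} {κ : Type} [Fintype κ] {e : κ → Γ(M, U)} {r : ℕ}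

/-- Over `W`, the subbundle `F` of `g^* M` is spanned by the sections whose coordinates are the
columns of `P`. -/
def Subbundle.SpannedBy {g : T ⟶ X} (F : Subbundle (pull g M) r) (he : IsFrame M U e) {W : T.Opens}
    (hW : W ≤ g ⁻¹ᵁ U) (P : Matrix κ (Fin r) Γ(T, W)) : Prop :=
  ∀ (V : T.Opens) (h : V ≤ W) (x : Γ(pull g M, V)), x ∈ F.sections V ↔
    ∃ c, he.pcoord g (h.trans hW) x = (P.map (resHom h)).mulVec c

lemma submatrix_mul_eq_one {A : Type*} [CommRing A] {c : ℕ} {P : Matrix κ (Fin r ⊕ Fin c) A}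
    {Q : Matrix (Fin r ⊕ Fin c) κ A} (hQP : Q * P = 1) :
    Q.submatrix Sum.inl id * P.submatrix id Sum.inl = 1 := by
  rw [← Matrix.submatrix_mul _ _ _ _ _ Function.bijective_id, hQP]
  exact Matrix.submatrix_one _ Sum.inl_injective

lemma IsFrame.pcoord_sum_res (he : IsFrame M U e) {g : T ⟶ X} {W : T.Opens} (hW : W ≤ g ⁻¹ᵁ U)
    {ι : Type*} [Fintype ι] (b : ι → Γ(LinkedSymplectic.pull g M, W)) {V : T.Opens} (h : V ≤ W) (a : ι → Γ(T, V)) :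
    he.pcoord g (h.trans hW) (∑ j, a j • res _ h (b j)) =
      ((Matrix.of fun k j => he.pcoord g hW (b j) k).map (resHom h)).mulVec a := by
  rw [map_sum]
  ext k
  rw [Finset.sum_apply, Matrix.mulVec, dotProduct]
  refine Finset.sum_congr rfl fun j _ => ?_
  rw [map_smul, Pi.smul_apply, smul_eq_mul, mul_comm, he.pcoord_res g hW h]
  rfl

variable {g : T ⟶ X} {F : Subbundle (pull g M) r} {he : IsFrame M U e}

lemma Subbundle.SpannedBy.mono {W : T.Opens} {hW : W ≤ g ⁻¹ᵁ U} {P : Matrix κ (Fin r) Γ(T, W)}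
    (H : F.SpannedBy he hW P) {V : T.Opens} (h : V ≤ W) :
    F.SpannedBy he (h.trans hW) (P.map (resHom h)) := by
  intro V' h' x
  rw [H V' (h'.trans h), map_resHom_resHom]

/-- `P` and `Q` are the two change of basis matrices between the pulled back frame and a frame
adapted to the subbundle. Keeping the complementary columns provides the inverse, hence a left
inverse of the first `r` columns. -/
lemma Subbundle.exists_spannedBy [DecidableEq κ] (F : Subbundle (pull g M) r) (he : IsFrame M U e)
    (t : T) (ht : t ∈ g ⁻¹ᵁ U) :
    ∃ (W : T.Opens) (hW : W ≤ g ⁻¹ᵁ U) (c : ℕ) (P : Matrix κ (Fin r ⊕ Fin c) Γ(T, W))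
      (Q : Matrix (Fin r ⊕ Fin c) κ Γ(T, W)), t ∈ W ∧ P * Q = 1 ∧ Q * P = 1 ∧
      F.SpannedBy he hW (P.submatrix id Sum.inl) := by
  obtain ⟨W₀, ht₀, c, b, hb, hF⟩ := F.exists_frame t
  have hW : W₀ ⊓ g ⁻¹ᵁ U ≤ g ⁻¹ᵁ U := inf_le_right
  have hW' : W₀ ⊓ g ⁻¹ᵁ U ≤ W₀ := inf_le_left
  set W := W₀ ⊓ g ⁻¹ᵁ U
  have hb' := hb.restrict hW'
  have hp : ∀ {V : T.Opens} (h : V ≤ W) (j),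
      he.pcoord g (h.trans hW) (res _ h (res _ hW' (b j))) =
        resHom h ∘ he.pcoord g hW (res _ hW' (b j)) := fun h j =>
    he.pcoord_res g hW h _
  let P : Matrix κ (Fin r ⊕ Fin c) Γ(T, W) :=
    Matrix.of fun k j => he.pcoord g hW (res _ hW' (b j)) k
  let Q : Matrix (Fin r ⊕ Fin c) κ Γ(T, W) :=
    Matrix.of fun j k => hb'.coord le_rfl (res _ hW (pullSection g M U (e k))) j
  have hP : ∀ v : Γ(pull g M, W), he.pcoord g hW v = P.mulVec (hb'.coord le_rfl v) := by
    intro v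
    conv_lhs => rw [← hb'.sum_coord le_rfl v]
    rw [map_sum]
    ext k
    rw [Finset.sum_apply, Matrix.mulVec, dotProduct]
    refine Finset.sum_congr rfl fun j _ => ?_
    rw [map_smul, res_self, Pi.smul_apply, smul_eq_mul, mul_comm]
    rfl
  have hQ : ∀ v : Γ(pull g M, W), hb'.coord le_rfl v = Q.mulVec (he.pcoord g hW v) := by
    intro v
    conv_lhs => rw [← (he.pull g).sum_coord hW v]
    rw [map_sum]
    ext j
    rw [Finset.sum_apply, Matrix.mulVec, dotProduct]
    refine Finset.sum_congr rfl fun k _ => ?_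
    rw [map_smul, Pi.smul_apply, smul_eq_mul, mul_comm]
    rfl
  refine ⟨W, hW, c, P, Q, ⟨ht₀, ht⟩, ?_, ?_, ?_⟩
  · apply Matrix.toLin'.injective
    ext1 k
    ext1
    simp only [Matrix.toLin'_mul, Matrix.toLin'_one]
    obtain ⟨v, hv⟩ := (he.pcoord g hW).surjective (Pi.single k 1)
    simp [← hv, ← hP, ← hQ]
  · apply Matrix.toLin'.injective
    ext1 k
    ext1
    simp only [Matrix.toLin'_mul, Matrix.toLin'_one]
    obtain ⟨v, hv⟩ := (hb'.coord le_rfl).surjective (Pi.single k 1)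
    simp [← hv, ← hP, ← hQ]
  · intro V h x
    rw [hF V (h.trans hW'), Submodule.mem_span_range_iff_exists_fun]
    refine exists_congr fun a => ?_
    rw [← (he.pcoord g (h.trans hW)).injective.eq_iff, eq_comm, map_sum]
    have := he.pcoord_sum_res hW (fun j => res _ hW' (b (Sum.inl j))) h a
    simp only [res_res] at this
    rw [← map_sum, this]
    rfl

/-- The subbundle spanned by the first columns of an invertible matrix. -/
def Subbundle.ofMatrix [DecidableEq κ] {c : ℕ} (g : T ⟶ X) (he : IsFrame M U e) (hU : ⊤ ≤ g ⁻¹ᵁ U)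
    (P : Matrix κ (Fin r ⊕ Fin c) Γ(T, ⊤)) (Q : Matrix (Fin r ⊕ Fin c) κ Γ(T, ⊤)) (hPQ : P * Q = 1)
    (hQP : Q * P = 1) : Subbundle (pull g M) r where
  sections V :=
    { carrier := {x | ∃ c, he.pcoord g (le_top.trans hU) x =
        ((P.submatrix id Sum.inl).map (resHom le_top)).mulVec c}
      add_mem' := by
        rintro x y ⟨a, ha⟩ ⟨b, hb⟩
        exact ⟨a + b, by rw [map_add, ha, hb, Matrix.mulVec_add]⟩
      zero_mem' := ⟨0, by rw [map_zero, Matrix.mulVec_zero]⟩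
      smul_mem' := by
        rintro s x ⟨a, ha⟩
        exact ⟨s • a, by rw [map_smul, ha, Matrix.mulVec_smul]⟩ }
  res_mem := by
    rintro V V' h x ⟨a, ha⟩
    refine ⟨resHom h ∘ a, ?_⟩
    rw [he.pcoord_res g (le_top.trans hU) h, ha, comp_mulVec, map_resHom_resHom]
  mem_of_locally := by
    intro V x hx
    refine exists_mulVec_of_locally le_top _ _ (submatrix_mul_eq_one hQP) _ fun t ht => ?_
    obtain ⟨V', h, ht', c, hc⟩ := hx t ht
    exact ⟨V', h, ht', c, by rw [← he.pcoord_res g (le_top.trans hU) h, hc]⟩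
  exists_frame t := by
    refine ⟨⊤, trivial, c, fun j => ∑ k, P k j • res _ hU (pullSection g M U (e k)),
      ((he.pull g).restrict hU).change P Q hPQ hQP, fun V h => ?_⟩
    ext x
    rw [Submodule.mem_span_range_iff_exists_fun]
    refine exists_congr fun a => ?_
    rw [← (he.pcoord g (h.trans hU)).injective.eq_iff, eq_comm,
      he.pcoord_sum_res hU (fun j => ∑ k, P k (Sum.inl j) • res _ hU (pullSection g M U (e k))) h]
    have : (Matrix.of fun k j => he.pcoord g hU (∑ k, P k (Sum.inl j) •
        res _ hU (pullSection g M U (e k))) k) = P.submatrix id Sum.inl := by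
      ext k j
      exact congrFun ((he.pull g).coord_eq hU (fun k => P k (Sum.inl j)) _ rfl) k
    rw [this]

lemma Subbundle.ofMatrix_spannedBy [DecidableEq κ] {c : ℕ} (g : T ⟶ X) (he : IsFrame M U e)
    (hU : ⊤ ≤ g ⁻¹ᵁ U)
    (P : Matrix κ (Fin r ⊕ Fin c) Γ(T, ⊤)) (Q : Matrix (Fin r ⊕ Fin c) κ Γ(T, ⊤)) (hPQ : P * Q = 1)
    (hQP : Q * P = 1) :
    (Subbundle.ofMatrix g he hU P Q hPQ hQP).SpannedBy he hU (P.submatrix id Sum.inl) :=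
  fun _ _ _ => Iff.rfl

lemma map_fnHom_map_resHom {ι ι' : Type*} (φ : T ⟶ G) {W W' : G.Opens} {V V' : T.Opens}
    (h : V ≤ φ ⁻¹ᵁ W) (h' : V' ≤ V) (h₁ : W' ≤ W) (h₂ : V' ≤ φ ⁻¹ᵁ W') (P : Matrix ι ι' Γ(G, W)) :
    (P.map (resHom h₁)).map (fnHom φ h₂) = (P.map (fnHom φ h)).map (resHom h') := by
  ext
  simp [resHom_fnHom, fnHom_resHom]

lemma resHom_comp_fnHom {ι : Type*} (φ : T ⟶ G) {W : G.Opens} {V V' : T.Opens}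
    (h : V ≤ φ ⁻¹ᵁ W) (h' : V' ≤ V) (a : ι → Γ(G, W)) :
    resHom h' ∘ fnHom φ h ∘ a = fnHom φ (h'.trans h) ∘ a := by
  ext
  simp [resHom_fnHom]

/-- Sections of the pullback are locally combinations of pulled back sections, whose coordinates are
combinations of the columns of `P` mapped to `T`; the left inverse `Y` glues the local coefficients.
-/
lemma Subbundle.IsPullback.spannedBy {φ : T ⟶ G} {p : G ⟶ X} {g : T ⟶ X} {h : φ ≫ p = g}
    {F : Subbundle (pull p M) r} {F' : Subbundle (pull g M) r}
    (H : Subbundle.IsPullback φ p g h F F') {he : IsFrame M U e} {W : G.Opens} {hW : W ≤ p ⁻¹ᵁ U}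
    {P : Matrix κ (Fin r) Γ(G, W)} (hF : F.SpannedBy he hW P) {Y : Matrix (Fin r) κ Γ(G, W)}
    (hY : Y * P = 1) :
    F'.SpannedBy he (IsFrame.preimage_le_of_comp h hW) (P.map (fnHom φ le_rfl)) := by
  intro V hV x
  constructor
  · intro hx
    rw [H] at hx
    have hYP : Y.map (fnHom φ (le_refl (φ ⁻¹ᵁ W))) * P.map (fnHom φ (le_refl (φ ⁻¹ᵁ W))) = 1 := by
      rw [← Matrix.map_mul, hY, Matrix.map_one _ (map_zero _) (map_one _)]
    refine exists_mulVec_of_locally hV _ _ hYP _ fun t ht => ?_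
    obtain ⟨W₁, V₁, hV₁, hW₁, ht₁, hx₁⟩ := hx t ht
    have hle : V₁ ≤ φ ⁻¹ᵁ (W₁ ⊓ W) := le_inf hW₁ (hV₁.trans hV)
    refine ⟨V₁, hV₁, ht₁, ?_⟩
    rw [← he.pcoord_res g (hV.trans (IsFrame.preimage_le_of_comp h hW))]
    generalize res (pull g M) hV₁ x = y at hx₁ ⊢
    induction hx₁ using Submodule.span_induction with
    | mem y hy =>
      obtain ⟨w, hw, rfl⟩ := hy
      have hw' := F.res_mem (inf_le_left : W₁ ⊓ W ≤ W₁) w hw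
      rw [hF _ inf_le_right] at hw'
      obtain ⟨c, hc⟩ := hw'
      refine ⟨fnHom φ hle ∘ c, ?_⟩
      have h2 : res (pull g M) hW₁ (pullSectionOver φ p g h M W₁ w) = res (pull g M) hle
          (pullSectionOver φ p g h M (W₁ ⊓ W) (res _ inf_le_left w)) := by
        rw [pullSectionOver_res, res_res]
      rw [h2, he.pcoord_res g (IsFrame.preimage_le_of_comp h (inf_le_right.trans hW)) hle,
        he.pcoord_pullSectionOver φ p g h (inf_le_right.trans hW), hc,
        resHom_comp_fnHom, comp_mulVec]
      rw [map_fnHom_map_resHom φ le_rfl (hV₁.trans hV) inf_le_right hle]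
    | zero => exact ⟨0, by rw [map_zero, Matrix.mulVec_zero]⟩
    | add y z _ _ hy hz =>
      obtain ⟨a, ha⟩ := hy
      obtain ⟨b, hb⟩ := hz
      exact ⟨a + b, by rw [map_add, ha, hb, Matrix.mulVec_add]⟩
    | smul s y _ hy =>
      obtain ⟨a, ha⟩ := hy
      exact ⟨s • a, by rw [map_smul, ha, Matrix.mulVec_smul]⟩
  · rintro ⟨c, hc⟩
    rw [H]
    intro t ht
    refine ⟨W, V, le_rfl, hV, ht, ?_⟩
    choose w hw using fun j : Fin r => (he.pcoord p hW).surjective (fun k => P k j)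
    have hx : x = ∑ j, c j • res (pull g M) hV (pullSectionOver φ p g h M W (w j)) := by
      apply (he.pcoord g (hV.trans (IsFrame.preimage_le_of_comp h hW))).injective
      rw [hc, he.pcoord_sum_res (IsFrame.preimage_le_of_comp h hW) _ hV]
      congr 2
      ext k j
      simp only [Matrix.map_apply, Matrix.of_apply]
      rw [he.pcoord_pullSectionOver φ p g h hW, hw]
      rfl
    rw [res_self, hx]
    refine sum_mem fun j _ => Submodule.smul_mem _ _ (Submodule.subset_span ⟨w j, ?_, rfl⟩)
    rw [hF W le_rfl]
    refine ⟨Pi.single j 1, ?_⟩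
    rw [hw]
    ext k
    simp [resHom_self]

/-- A local converse to `Subbundle.IsPullback.spannedBy`; this is how a morphism is shown to
classify a given linked subbundle. -/
lemma Subbundle.isPullback_of_locally {φ : T ⟶ G} {p : G ⟶ X} {g : T ⟶ X} (h : φ ≫ p = g)
    {F : Subbundle (pull p M) r} {F' : Subbundle (pull g M) r} (he : IsFrame M U e)
    (H : ∀ t : T, ∃ (W : G.Opens) (hW : W ≤ p ⁻¹ᵁ U) (P : Matrix κ (Fin r) Γ(G, W))
      (V : T.Opens) (hV : V ≤ φ ⁻¹ᵁ W), t ∈ V ∧ F.SpannedBy he hW P ∧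
        F'.SpannedBy he (hV.trans (IsFrame.preimage_le_of_comp h hW)) (P.map (fnHom φ hV))) :
    Subbundle.IsPullback φ p g h F F' := by
  intro V x
  constructor
  · intro hx t ht
    obtain ⟨W, hW, P, V₀, hV₀, ht₀, hF, hF'⟩ := H t
    have hV₁ : V ⊓ V₀ ≤ V₀ := inf_le_right
    refine ⟨W, V ⊓ V₀, inf_le_left, hV₁.trans hV₀, ⟨ht, ht₀⟩, ?_⟩
    have hx' := F'.res_mem (inf_le_left : V ⊓ V₀ ≤ V) x hx
    rw [hF' _ hV₁] at hx'
    obtain ⟨c, hc⟩ := hx'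
    choose w hw using fun j : Fin r => (he.pcoord p hW).surjective (fun k => P k j)
    have hx : res _ inf_le_left x =
        ∑ j, c j • res (pull g M) (hV₁.trans hV₀) (pullSectionOver φ p g h M W (w j)) := by
      apply (he.pcoord g (hV₁.trans (hV₀.trans (IsFrame.preimage_le_of_comp h hW)))).injective
      rw [hc, he.pcoord_sum_res (IsFrame.preimage_le_of_comp h hW) _ (hV₁.trans hV₀)]
      congr 1
      ext k j
      simp only [Matrix.map_apply, Matrix.of_apply]
      rw [he.pcoord_pullSectionOver φ p g h hW, hw]
      simp [resHom_fnHom]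
    rw [hx]
    refine sum_mem fun j _ => Submodule.smul_mem _ _ (Submodule.subset_span ⟨w j, ?_, rfl⟩)
    rw [hF W le_rfl]
    refine ⟨Pi.single j 1, ?_⟩
    rw [hw]
    ext k
    simp [resHom_self]
  · intro hx
    apply F'.mem_of_locally
    intro t ht
    obtain ⟨W₁, V₁, hV₁, hW₁, ht₁, hx₁⟩ := hx t ht
    refine ⟨V₁, hV₁, ht₁, ?_⟩
    refine Submodule.span_le.mpr ?_ hx₁
    rintro _ ⟨w, hw, rfl⟩
    apply F'.mem_of_locally
    intro t' ht'
    obtain ⟨W, hW, P, V₀, hV₀, ht₀, hF, hF'⟩ := H t'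
    have hV₂ : V₁ ⊓ V₀ ≤ V₀ := inf_le_right
    have hV₃ : V₁ ⊓ V₀ ≤ V₁ := inf_le_left
    have hle : V₁ ⊓ V₀ ≤ φ ⁻¹ᵁ (W₁ ⊓ W) := le_inf (hV₃.trans hW₁) (hV₂.trans hV₀)
    refine ⟨V₁ ⊓ V₀, hV₃, ⟨ht', ht₀⟩, ?_⟩
    have hw' := F.res_mem (inf_le_left : W₁ ⊓ W ≤ W₁) w hw
    rw [hF _ inf_le_right] at hw'
    obtain ⟨c, hc⟩ := hw'
    rw [hF' _ hV₂]
    refine ⟨fnHom φ hle ∘ c, ?_⟩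
    have h2 : res (pull g M) hV₃ (res (pull g M) hW₁ (pullSectionOver φ p g h M W₁ w)) =
        res (pull g M) hle (pullSectionOver φ p g h M (W₁ ⊓ W) (res _ inf_le_left w)) := by
      rw [pullSectionOver_res, res_res, res_res]
    rw [h2, he.pcoord_res g (IsFrame.preimage_le_of_comp h (inf_le_right.trans hW)) hle,
      he.pcoord_pullSectionOver φ p g h (inf_le_right.trans hW), hc,
      resHom_comp_fnHom, comp_mulVec]
    rw [map_fnHom_map_resHom φ hV₀ hV₂ inf_le_right hle]

end

/-! ### Pairings and Gram matrices. -/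

lemma map_bilin {A B : Type*} [CommRing A] [CommRing B] {ι ι' : Type*} [Fintype ι] [Fintype ι']
    (f : A →+* B) (a : ι → A) (P : Matrix ι ι' A) (c : ι' → A) :
    f (dotProduct a (P.mulVec c)) = dotProduct (f ∘ a) ((P.map f).mulVec (f ∘ c)) := by
  rw [RingHom.map_dotProduct, comp_mulVec]

lemma map_map_resHom_fnHom {ι ι' : Type*} (g : T ⟶ X) {W W' : X.Opens} {V : T.Opens}
    (h : V ≤ g ⁻¹ᵁ W') (hW : W' ≤ W) (P : Matrix ι ι' Γ(X, W)) :
    (P.map (resHom hW)).map (fnHom g h) = P.map (fnHom g (h.trans (g.preimage_mono hW))) := by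
  ext; simp [fnHom_resHom]

lemma map_map_fnHom_resHom {ι ι' : Type*} (g : T ⟶ X) {W : X.Opens} {V V' : T.Opens}
    (h : V ≤ g ⁻¹ᵁ W) (hV : V' ≤ V) (P : Matrix ι ι' Γ(X, W)) :
    (P.map (fnHom g h)).map (resHom hV) = P.map (fnHom g (hV.trans h)) := by
  ext; simp [resHom_fnHom]

section
variable {M N : X.Modules} {U : X.Opens} {κ κ' : Type} [Fintype κ] [Fintype κ'] {e : κ → Γ(M, U)}
  {e' : κ' → Γ(N, U)}

/-- The Gram matrix of a pairing with respect to frames. -/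
def Pairing.gram (B : Pairing M N) (e : κ → Γ(M, U)) (e' : κ' → Γ(N, U)) :
    Matrix κ κ' Γ(X, U) :=
  Matrix.of fun k l => B.app U (e k) (e' l)

lemma Pairing.app_eq (B : Pairing M N) {V : X.Opens} {ι ι' : Type*} [Fintype ι] [Fintype ι']
    (a : ι → Γ(X, V)) (x : ι → Γ(M, V)) (b : ι' → Γ(X, V)) (y : ι' → Γ(N, V)) :
    B.app V (∑ k, a k • x k) (∑ l, b l • y l) =
      dotProduct a ((Matrix.of fun k l => B.app V (x k) (y l)).mulVec b) := by
  rw [map_sum (B.app V), LinearMap.sum_apply, dotProduct]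
  refine Finset.sum_congr rfl fun k _ => ?_
  rw [map_smul, LinearMap.smul_apply, map_sum, smul_eq_mul, Matrix.mulVec, dotProduct]
  congr 1
  refine Finset.sum_congr rfl fun l _ => ?_
  rw [map_smul, smul_eq_mul, mul_comm]
  rfl

lemma Pairing.IsPullback.app_eq {g : T ⟶ X} {B : Pairing M N}
    {B' : Pairing (pull g M) (pull g N)} (H : B.IsPullback g B') (he : IsFrame M U e)
    (he' : IsFrame N U e') {V : T.Opens} (hV : V ≤ g ⁻¹ᵁ U) (x : Γ(pull g M, V))
    (y : Γ(pull g N, V)) :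
    B'.app V x y = dotProduct (he.pcoord g hV x)
      (((B.gram e e').map (fnHom g hV)).mulVec (he'.pcoord g hV y)) := by
  conv_lhs => rw [← (he.pull g).sum_coord hV x, ← (he'.pull g).sum_coord hV y]
  rw [Pairing.app_eq]
  congr 2
  ext k l
  rw [Matrix.of_apply, B'.app_res hV, H U, ← fnHom_app]
  exact resHom_fnHom g _ hV _

/-- The pairing with a given Gram matrix with respect to the pullbacks of frames over the base. -/
def Pairing.ofGram (he : IsFrame M U e) (he' : IsFrame N U e') (g : T ⟶ X) (hU : ⊤ ≤ g ⁻¹ᵁ U)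
    (A : Matrix κ κ' Γ(T, ⊤)) : Pairing (pull g M) (pull g N) where
  app V := LinearMap.mk₂ Γ(T, V) (fun x y => dotProduct (he.pcoord g (le_top.trans hU) x)
    ((A.map (resHom le_top)).mulVec (he'.pcoord g (le_top.trans hU) y)))
    (by intro x x' y; rw [map_add, add_dotProduct])
    (by intro a x y; rw [map_smul, smul_dotProduct])
    (by intro x y y'; rw [map_add, Matrix.mulVec_add, dotProduct_add])
    (by intro a x y; rw [map_smul, Matrix.mulVec_smul, dotProduct_smul])
  app_res := by
    intro V V' h x y
    rw [LinearMap.mk₂_apply, LinearMap.mk₂_apply, he.pcoord_res g (le_top.trans hU) h,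
      he'.pcoord_res g (le_top.trans hU) h, ← map_resHom_resHom le_top h, ← comp_mulVec]
    exact (RingHom.map_dotProduct (resHom h) _ _).symm

lemma Pairing.ofGram_isPullback (he : IsFrame M U e) (he' : IsFrame N U e') (g : T ⟶ X)
    (hU : ⊤ ≤ g ⁻¹ᵁ U) (B : Pairing M N) :
    B.IsPullback g (Pairing.ofGram he he' g hU ((B.gram e e').map (fnHom g hU))) := by
  intro W x y
  -- All of `T` lies over `U`, so `W` may be replaced by `W ⊓ U`, where the frames are available.
  have hle : g ⁻¹ᵁ W ≤ g ⁻¹ᵁ (W ⊓ U) := le_inf le_rfl (le_top.trans hU)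
  have hWU : W ⊓ U ≤ U := inf_le_right
  have hWW : W ⊓ U ≤ W := inf_le_left
  have hx : ∀ {K : X.Modules} (z : Γ(K, W)), pullSection g K W z = res _ hle
      (pullSection g K (W ⊓ U) (res _ hWW z)) := by
    intro K z
    rw [pullSection_res, res_res, res_self]
  rw [hx x, hx y, Pairing.app_res]
  change resO hle (dotProduct (he.pcoord g _ _) (Matrix.mulVec _ (he'.pcoord g _ _))) = _
  rw [he.pcoord_pullSection g hWU, he'.pcoord_pullSection g hWU]
  have h1 : B.app (W ⊓ U) (res _ hWW x) (res _ hWW y) = resO hWW (B.app W x y) := B.app_res _ _ _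
  have h2 : B.app (W ⊓ U) (res _ hWW x) (res _ hWW y) =
      dotProduct (he.coord hWU (res _ hWW x)) (((B.gram e e').map (resHom hWU)).mulVec
        (he'.coord hWU (res _ hWW y))) := by
    conv_lhs => rw [← he.sum_coord hWU (res _ hWW x), ← he'.sum_coord hWU (res _ hWW y)]
    rw [Pairing.app_eq]
    congr 2
    ext k l
    rw [Matrix.of_apply, B.app_res hWU]
    rfl
  rw [← fnHom_app, ← resHom_apply, map_bilin, resHom_comp_fnHom, resHom_comp_fnHom,
    map_resHom_resHom, map_map_fnHom_resHom,
    ← fnHom_resHom g hle hWW, resHom_apply hWW, ← h1, h2, map_bilin,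
    map_map_resHom_fnHom]

end

/-! ### Linkage and isotropy as matrix equations. -/

section
variable {M N : X.Modules} {U : X.Opens} {κ κ' : Type} [Fintype κ] [Fintype κ'] {e : κ → Γ(M, U)}
  {e' : κ' → Γ(N, U)} {r : ℕ} {g : T ⟶ X} {F : Subbundle (pull g M) r} {he : IsFrame M U e}
  {F' : Subbundle (pull g N) r} {he' : IsFrame N U e'}

lemma Subbundle.SpannedBy.exists_mem {W : T.Opens} {hW : W ≤ g ⁻¹ᵁ U} {P : Matrix κ (Fin r) Γ(T, W)}
    (H : F.SpannedBy he hW P) {V : T.Opens} (h : V ≤ W) (c : Fin r → Γ(T, V)) :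
    ∃ x ∈ F.sections V, he.pcoord g (h.trans hW) x = (P.map (resHom h)).mulVec c := by
  obtain ⟨x, hx⟩ := (he.pcoord g (h.trans hW)).surjective ((P.map (resHom h)).mulVec c)
  exact ⟨x, (H V h x).mpr ⟨c, hx⟩, hx⟩

lemma map_resHom_self {ι ι' : Type*} {V : T.Opens} (P : Matrix ι ι' Γ(T, V)) :
    P.map (resHom (le_refl V)) = P := by
  ext; simp [resHom_self]

lemma Subbundle.SpannedBy.mem_iff {W : T.Opens} {hW : W ≤ g ⁻¹ᵁ U} {P : Matrix κ (Fin r) Γ(T, W)}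
    (H : F.SpannedBy he hW P) (x : Γ(pull g M, W)) :
    x ∈ F.sections W ↔ ∃ c, he.pcoord g hW x = P.mulVec c := by
  rw [H W le_rfl, map_resHom_self]

/-- A matrix all of whose columns are combinations of those of `P` factors through `P`. -/
lemma exists_eq_mul {A : Type*} [CommRing A] {ι ι' ι'' : Type*} [Fintype ι'] {R : Matrix ι ι'' A}
    {P : Matrix ι ι' A} (H : ∀ l, ∃ c, (fun k => R k l) = P.mulVec c) : ∃ t : Matrix ι' ι'' A, R = P * t := by
  choose c hc using H
  refine ⟨Matrix.of fun k l => c l k, ?_⟩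
  ext k l
  exact congrFun (hc l) k

lemma Subbundle.SpannedBy.exists_eq_mul {W : T.Opens} {hW : W ≤ g ⁻¹ᵁ U}
    {P P' : Matrix κ (Fin r) Γ(T, W)} (H : F.SpannedBy he hW P) (H' : F.SpannedBy he hW P') :
    ∃ t : Matrix (Fin r) (Fin r) Γ(T, W), P' = P * t := by
  refine LinkedSymplectic.exists_eq_mul fun l => ?_
  obtain ⟨x, hx, hx'⟩ := H'.exists_mem le_rfl (Pi.single l 1)
  obtain ⟨c, hc⟩ := (H.mem_iff x).mp hx
  refine ⟨c, ?_⟩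
  rw [← hc, hx', map_resHom_self]
  ext k
  simp

lemma Subbundle.SpannedBy.of_eq_mul {W : T.Opens} {hW : W ≤ g ⁻¹ᵁ U}
    {P P' : Matrix κ (Fin r) Γ(T, W)} (H : F.SpannedBy he hW P) {t t' : Matrix (Fin r) (Fin r) Γ(T, W)}
    (ht : P' = P * t) (ht' : P = P' * t') : F.SpannedBy he hW P' := by
  intro V h x
  rw [H V h]
  constructor
  · rintro ⟨c, hc⟩
    exact ⟨(t'.map (resHom h)).mulVec c, by
      rw [hc, Matrix.mulVec_mulVec, ← Matrix.map_mul, ← ht']⟩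
  · rintro ⟨c, hc⟩
    exact ⟨(t.map (resHom h)).mulVec c, by
      rw [hc, Matrix.mulVec_mulVec, ← Matrix.map_mul, ← ht]⟩

lemma pullMap_mem_iff {W : T.Opens} {hW : W ≤ g ⁻¹ᵁ U} {P : Matrix κ (Fin r) Γ(T, W)}
    {P' : Matrix κ' (Fin r) Γ(T, W)} (H : F.SpannedBy he hW P) (H' : F'.SpannedBy he' hW P')
    (f : M ⟶ N) :
    (∀ (V : T.Opens), V ≤ W → ∀ x ∈ F.sections V, (pullMap g f).app V x ∈ F'.sections V) ↔
      ∃ t : Matrix (Fin r) (Fin r) Γ(T, W), (he.matrix he' f).map (fnHom g hW) * P = P' * t := by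
  constructor
  · intro hf
    refine exists_eq_mul fun l => ?_
    obtain ⟨x, hx, hx'⟩ := H.exists_mem le_rfl (Pi.single l 1)
    obtain ⟨c, hc⟩ := (H'.mem_iff _).mp (hf W le_rfl x hx)
    refine ⟨c, ?_⟩
    rw [← hc, he.pcoord_pullMap he', hx', map_resHom_self]
    ext k
    rw [Matrix.mulVec_mulVec]
    simp
  · rintro ⟨t, ht⟩ V h x hx
    obtain ⟨c, hc⟩ := (H V h x).mp hx
    rw [H' V h]
    refine ⟨(t.map (resHom h)).mulVec c, ?_⟩
    rw [he.pcoord_pullMap he', hc, Matrix.mulVec_mulVec, Matrix.mulVec_mulVec, ← Matrix.map_mul,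
      ← ht, Matrix.map_mul, map_map_fnHom_resHom]

lemma pairing_eq_zero_iff {B : Pairing M N} {B' : Pairing (pull g M) (pull g N)}
    (hB : B.IsPullback g B') {W : T.Opens} {hW : W ≤ g ⁻¹ᵁ U} {P : Matrix κ (Fin r) Γ(T, W)}
    {P' : Matrix κ' (Fin r) Γ(T, W)} (H : F.SpannedBy he hW P) (H' : F'.SpannedBy he' hW P') :
    (∀ (V : T.Opens), V ≤ W → ∀ x ∈ F.sections V, ∀ y ∈ F'.sections V, B'.app V x y = 0) ↔
      P.transpose * ((B.gram e e').map (fnHom g hW)) * P' =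
        (0 : Matrix (Fin r) (Fin r) Γ(T, W)) := by
  constructor
  · intro h0
    ext k l
    obtain ⟨x, hx, hx'⟩ := H.exists_mem le_rfl (Pi.single k 1)
    obtain ⟨y, hy, hy'⟩ := H'.exists_mem le_rfl (Pi.single l 1)
    have := h0 W le_rfl x hx y hy
    rw [hB.app_eq he he' hW, hx', hy', map_resHom_self, map_resHom_self] at this
    rw [Matrix.zero_apply]
    refine Eq.trans ?_ this
    rw [Matrix.mulVec_mulVec, Matrix.mul_assoc, Matrix.mul_apply]
    simp [dotProduct, Matrix.mul_apply]
  · intro h0 V h x hx y hy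
    obtain ⟨a, ha⟩ := (H V h x).mp hx
    obtain ⟨b, hb⟩ := (H' V h y).mp hy
    rw [hB.app_eq he he' (h.trans hW), ha, hb, Matrix.mulVec_mulVec, ← Matrix.vecMul_transpose,
      ← Matrix.dotProduct_mulVec, Matrix.mulVec_mulVec, ← map_map_fnHom_resHom g hW h,
      ← Matrix.map_mul, ← Matrix.transpose_map, ← Matrix.map_mul, ← Matrix.mul_assoc, h0]
    simp

end

section
variable {S : Scheme.{u}} {n d r : ℕ} {C : Chain S n} {U : S.Opens}
  {e : ∀ i, Fin d → Γ(C.E i, U)} (he : ∀ i, IsFrame (C.E i) U (e i))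

/-- The matrix of a map up. -/
abbrev Chain.upMatrix (i j : Fin n) (h : i.val + 1 = j.val) : Matrix (Fin d) (Fin d) Γ(S, U) :=
  (he i).matrix (he j) (C.up i j h)

/-- The matrix of a map down. -/
abbrev Chain.downMatrix (i j : Fin n) (h : i.val + 1 = j.val) : Matrix (Fin d) (Fin d) Γ(S, U) :=
  (he j).matrix (he i) (C.down i j h)

/-- The linked subbundle spanned by the first columns of invertible matrices. -/
def LinkedSubbundle.ofMatrices (g : T ⟶ S) (hU : ⊤ ≤ g ⁻¹ᵁ U) (c : Fin n → ℕ)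
    (P : ∀ i, Matrix (Fin d) (Fin r ⊕ Fin (c i)) Γ(T, ⊤))
    (Q : ∀ i, Matrix (Fin r ⊕ Fin (c i)) (Fin d) Γ(T, ⊤))
    (hPQ : ∀ i, P i * Q i = 1) (hQP : ∀ i, Q i * P i = 1)
    (hup : ∀ i j h, ∃ t : Matrix (Fin r) (Fin r) Γ(T, ⊤), (Chain.upMatrix he i j h).map (fnHom g hU) * (P i).submatrix id Sum.inl =
      (P j).submatrix id Sum.inl * t)
    (hdown : ∀ i j h, ∃ t : Matrix (Fin r) (Fin r) Γ(T, ⊤), (Chain.downMatrix he i j h).map (fnHom g hU) *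
      (P j).submatrix id Sum.inl = (P i).submatrix id Sum.inl * t) :
    LinkedSubbundle C r g where
  F i := Subbundle.ofMatrix g (he i) hU (P i) (Q i) (hPQ i) (hQP i)
  up_mem i j h V x hx := (pullMap_mem_iff
    (Subbundle.ofMatrix_spannedBy g (he i) hU (P i) (Q i) (hPQ i) (hQP i))
    (Subbundle.ofMatrix_spannedBy g (he j) hU (P j) (Q j) (hPQ j) (hQP j)) (C.up i j h)).mpr
      (hup i j h) V le_top x hx
  down_mem i j h V x hx := (pullMap_mem_iff
    (Subbundle.ofMatrix_spannedBy g (he j) hU (P j) (Q j) (hPQ j) (hQP j))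
    (Subbundle.ofMatrix_spannedBy g (he i) hU (P i) (Q i) (hPQ i) (hQP i)) (C.down i j h)).mpr
      (hdown i j h) V le_top x hx

variable {he}

/-- Over `U` the pulled back pairing exists, being given by the pulled back Gram matrix, and every
pulled back pairing is computed by that matrix; so isotropy does not depend on the choice of `B'`.
-/
lemma LinkedSubbundle.isIsotropic_iff {g : T ⟶ S} (F : LinkedSubbundle C r g) (B : Form C)
    (hU : ⊤ ≤ g ⁻¹ᵁ U) {P : ∀ _ : Fin n, Matrix (Fin d) (Fin r) Γ(T, ⊤)}
    (HF : ∀ i, (F.F i).SpannedBy (he i) hU (P i)) :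
    F.IsIsotropic B ↔ ∀ i j, (P i).transpose *
      (((B i j).gram (e i) (e j)).map (fnHom g hU)) * P j =
        (0 : Matrix (Fin r) (Fin r) Γ(T, ⊤)) := by
  refine forall₂_congr fun i j => ⟨?_, ?_⟩
  · rintro ⟨B', hB', h0⟩
    exact (pairing_eq_zero_iff hB' (HF i) (HF j)).mp fun V _ => h0 V
  · intro h0
    have hB' := Pairing.ofGram_isPullback (he i) (he j) g hU (B i j)
    exact ⟨_, hB', fun V => (pairing_eq_zero_iff hB' (HF i) (HF j)).mpr h0 V le_top⟩

end

/-! ### Affine points of the linked Grassmannian. -/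

/-- The morphism from an affine scheme to an affine open given by a map of rings. -/
def toAffine [IsAffine T] {V : X.Opens} (hV : IsAffineOpen V) (ψ : Γ(X, V) →+* Γ(T, ⊤)) : T ⟶ X :=
  T.isoSpec.hom ≫ Spec.map (CommRingCat.ofHom ψ) ≫ hV.fromSpec

lemma toAffine_le [IsAffine T] {V : X.Opens} (hV : IsAffineOpen V) (ψ : Γ(X, V) →+* Γ(T, ⊤)) :
    ⊤ ≤ toAffine hV ψ ⁻¹ᵁ V := by
  rw [toAffine, Scheme.Hom.comp_preimage, Scheme.Hom.comp_preimage, hV.fromSpec_preimage_self]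
  exact le_rfl

lemma eq_toAffine [IsAffine T] {V : X.Opens} (hV : IsAffineOpen V) (φ : T ⟶ X)
    (h : ⊤ ≤ φ ⁻¹ᵁ V) : φ = toAffine hV (fnHom φ h) := by
  have := IsAffineOpen.SpecMap_appLE_fromSpec φ hV (isAffineOpen_top T) h
  rw [toAffine]
  erw [this]
  rw [IsAffineOpen.fromSpec_top, Iso.hom_inv_id_assoc]

lemma fnHom_toAffine [IsAffine T] {V : X.Opens} (hV : IsAffineOpen V)
    (ψ : Γ(X, V) →+* Γ(T, ⊤)) : fnHom (toAffine hV ψ) (toAffine_le hV ψ) = ψ := by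
  have h := eq_toAffine hV (toAffine hV ψ) (toAffine_le hV ψ)
  unfold toAffine at h
  rw [Iso.cancel_iso_hom_left, cancel_mono] at h
  exact (congrArg CommRingCat.Hom.hom (Spec.map_injective h)).symm

lemma eq_of_fnHom_eq [IsAffine T] {V : X.Opens} (hV : IsAffineOpen V) {φ φ' : T ⟶ X}
    (h : ⊤ ≤ φ ⁻¹ᵁ V) (h' : ⊤ ≤ φ' ⁻¹ᵁ V) (H : fnHom φ h = fnHom φ' h') : φ = φ' := by
  rw [eq_toAffine hV φ h, eq_toAffine hV φ' h', H]

lemma map_map_fnHom (φ : T ⟶ G) (p : G ⟶ X) (g : T ⟶ X) (e : φ ≫ p = g) {W : X.Opens}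
    {V : G.Opens} {V' : T.Opens} (h : V ≤ p ⁻¹ᵁ W) (h' : V' ≤ φ ⁻¹ᵁ V) (h'' : V' ≤ g ⁻¹ᵁ W)
    {ι ι' : Type*} (P : Matrix ι ι' Γ(X, W)) :
    (P.map (fnHom p h)).map (fnHom φ h') = P.map (fnHom g h'') := by
  ext
  exact fnHom_fnHom φ p g e h h' h'' _

section
variable {S : Scheme.{u}} {n d r : ℕ} {C : Chain S n} {U : S.Opens}
  {e : ∀ i, Fin d → Γ(C.E i, U)} (he : ∀ i, IsFrame (C.E i) U (e i))

lemma LinkedSubbundle.ofMatrices_spannedBy (g : T ⟶ S) (hU : ⊤ ≤ g ⁻¹ᵁ U) (c : Fin n → ℕ)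
    (P : ∀ i, Matrix (Fin d) (Fin r ⊕ Fin (c i)) Γ(T, ⊤))
    (Q : ∀ i, Matrix (Fin r ⊕ Fin (c i)) (Fin d) Γ(T, ⊤))
    (hPQ : ∀ i, P i * Q i = 1) (hQP : ∀ i, Q i * P i = 1) (hup) (hdown) (i : Fin n) :
    ((LinkedSubbundle.ofMatrices he g hU c P Q hPQ hQP hup hdown).F i).SpannedBy (he i) hU
      ((P i).submatrix id Sum.inl) :=
  Subbundle.ofMatrix_spannedBy g (he i) hU (P i) (Q i) (hPQ i) (hQP i)

/-- Lifting of a point of the linked Grassmannian along a universal homeomorphism. -/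
lemma LinkedGrassmannian.exists_lift (LG : LinkedGrassmannian C r) (hU : IsAffineOpen U)
    {V : LG.scheme.Opens} (hV : IsAffineOpen V) (hVU : V ≤ LG.hom ⁻¹ᵁ U)
    {P : ∀ _ : Fin n, Matrix (Fin d) (Fin r) Γ(LG.scheme, V)}
    {Y : ∀ _ : Fin n, Matrix (Fin r) (Fin d) Γ(LG.scheme, V)} (hY : ∀ i, Y i * P i = 1)
    (HP : ∀ i, (LG.univ.F i).SpannedBy (he i) hVU (P i))
    {T T₀ : Scheme.{u}} [IsAffine T] [IsAffine T₀] (j : T₀ ⟶ T) (hj : Function.Surjective j)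
    (hT : (⊤ : T₀.Opens) ≤ j ⁻¹ᵁ ⊤)
    (π : Γ(LG.scheme, V) →+* Γ(T₀, ⊤)) (θ : Γ(S, U) →+* Γ(T, ⊤))
    (hθ : ∀ a, fnHom j hT (θ a) = π (fnHom LG.hom hVU a)) (c : Fin n → ℕ)
    (Q : ∀ i, Matrix (Fin d) (Fin r ⊕ Fin (c i)) Γ(T, ⊤))
    (Q' : ∀ i, Matrix (Fin r ⊕ Fin (c i)) (Fin d) Γ(T, ⊤))
    (hQQ' : ∀ i, Q i * Q' i = 1) (hQ'Q : ∀ i, Q' i * Q i = 1)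
    (hup : ∀ i j h, ∃ t : Matrix (Fin r) (Fin r) Γ(T, ⊤),
      (Chain.upMatrix he i j h).map θ * (Q i).submatrix id Sum.inl =
        (Q j).submatrix id Sum.inl * t)
    (hdown : ∀ i j h, ∃ t : Matrix (Fin r) (Fin r) Γ(T, ⊤),
      (Chain.downMatrix he i j h).map θ * (Q j).submatrix id Sum.inl =
        (Q i).submatrix id Sum.inl * t)
    (hQ : ∀ i, ∃ t t' : Matrix (Fin r) (Fin r) Γ(T₀, ⊤),
      (P i).map π = ((Q i).submatrix id Sum.inl).map (fnHom j hT) * t ∧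
        ((Q i).submatrix id Sum.inl).map (fnHom j hT) = (P i).map π * t') :
    ∃ ψ : Γ(LG.scheme, V) →+* Γ(T, ⊤), (∀ a, fnHom j hT (ψ a) = π a) ∧
      (∀ a, ψ (fnHom LG.hom hVU a) = θ a) ∧
      ∀ i, ∃ t : Matrix (Fin r) (Fin r) Γ(T, ⊤),
        (P i).map ψ = (Q i).submatrix id Sum.inl * t := by
  set g := toAffine hU θ with hg
  have hgU : ⊤ ≤ g ⁻¹ᵁ U := toAffine_le hU θ
  have hgθ : fnHom g hgU = θ := fnHom_toAffine hU θ
  have hjg : ⊤ ≤ (j ≫ g) ⁻¹ᵁ U := by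
    rw [Scheme.Hom.comp_preimage]
    exact j.preimage_mono hgU
  have hjgθ : ∀ a, fnHom (j ≫ g) hjg a = fnHom j hT (θ a) := fun a => by
    rw [← hgθ, fnHom_fnHom j g _ rfl]
  have hmapθ : ∀ N : Matrix (Fin d) (Fin d) Γ(S, U), N.map (fnHom (j ≫ g) hjg) =
      (N.map θ).map (fnHom j hT) := fun N => by
    ext
    exact hjgθ _
  let F' := LinkedSubbundle.ofMatrices he g hgU c Q Q' hQQ' hQ'Q (by rwa [hgθ]) (by rwa [hgθ])
  have hF' : ∀ i, (F'.F i).SpannedBy (he i) hgU ((Q i).submatrix id Sum.inl) :=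
    LinkedSubbundle.ofMatrices_spannedBy he g hgU c Q Q' hQQ' hQ'Q _ _
  let F₀ : LinkedSubbundle C r (j ≫ g) := LinkedSubbundle.ofMatrices he (j ≫ g) hjg c
    (fun i => (Q i).map (fnHom j hT))
    (fun i => (Q' i).map (fnHom j hT))
    (fun i => by rw [← Matrix.map_mul, hQQ', Matrix.map_one _ (map_zero _) (map_one _)])
    (fun i => by rw [← Matrix.map_mul, hQ'Q, Matrix.map_one _ (map_zero _) (map_one _)])
    (fun i k h => by
      obtain ⟨t, ht⟩ := hup i k h
      refine ⟨t.map (fnHom j hT), ?_⟩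
      rw [hmapθ, Matrix.submatrix_map, Matrix.submatrix_map, ← Matrix.map_mul, ht,
        Matrix.map_mul])
    (fun i k h => by
      obtain ⟨t, ht⟩ := hdown i k h
      refine ⟨t.map (fnHom j hT), ?_⟩
      rw [hmapθ, Matrix.submatrix_map, Matrix.submatrix_map, ← Matrix.map_mul, ht,
        Matrix.map_mul])
  have hF₀ : ∀ i, (F₀.F i).SpannedBy (he i) hjg
      (((Q i).submatrix id Sum.inl).map (fnHom j hT)) := fun i => by
    rw [← Matrix.submatrix_map]
    exact LinkedSubbundle.ofMatrices_spannedBy he _ hjg c _ _ _ _ _ _ i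
  obtain ⟨φ, ⟨hφ, hφF⟩, -⟩ := LG.existsUnique T g F'
  have hVle := toAffine_le hV π
  have hVπ := fnHom_toAffine hV π
  have hπU : ⊤ ≤ (toAffine hV π ≫ LG.hom) ⁻¹ᵁ U := by
    rw [Scheme.Hom.comp_preimage]
    exact hVle.trans (Scheme.Hom.preimage_mono _ hVU)
  have hover : toAffine hV π ≫ LG.hom = j ≫ g := by
    refine eq_of_fnHom_eq hU hπU hjg (RingHom.ext fun a => ?_)
    rw [hjgθ, hθ, ← fnHom_fnHom (toAffine hV π) LG.hom _ rfl hVU hVle hπU, hVπ]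
  -- Both morphisms classify `F₀`, so they agree by uniqueness in the universal property.
  have hmain : j ≫ φ = toAffine hV π := by
    refine (LG.existsUnique T₀ (j ≫ g) F₀).unique
      ⟨by rw [Category.assoc, hφ], fun i => ?_⟩ ⟨hover, fun i => ?_⟩
    -- The image of `φ` is not yet known to lie in `V`, so the matrices `P` cannot be used; the
    -- comparison is made with matrices spanning the universal subbundle near `φ (j t)`.
    · refine Subbundle.isPullback_of_locally _ (he i) fun t => ?_
      have hyU : φ (j t) ∈ LG.hom ⁻¹ᵁ U := by
        change LG.hom (φ (j t)) ∈ U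
        rw [← Scheme.Hom.comp_apply, hφ]
        exact hgU (Set.mem_univ _)
      obtain ⟨W, hW, c', P', Y', hyW, -, hYP, hsp⟩ :=
        (LG.univ.F i).exists_spannedBy (he i) (φ (j t)) hyU
      have h1 := (hφF i).spannedBy hsp (submatrix_mul_eq_one hYP)
      have h2 := (hF' i).mono (le_top : φ ⁻¹ᵁ W ≤ ⊤)
      obtain ⟨t₁, ht₁⟩ := h2.exists_eq_mul h1
      obtain ⟨t₂, ht₂⟩ := h1.exists_eq_mul h2
      have hWW : (j ≫ φ) ⁻¹ᵁ W ≤ j ⁻¹ᵁ (φ ⁻¹ᵁ W) := le_rfl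
      refine ⟨W, hW, _, (j ≫ φ) ⁻¹ᵁ W, le_rfl, hyW, hsp, ?_⟩
      refine ((hF₀ i).mono (le_top : (j ≫ φ) ⁻¹ᵁ W ≤ ⊤)).of_eq_mul
        (t := t₁.map (fnHom j hWW)) (t' := t₂.map (fnHom j hWW)) ?_ ?_
      · rw [← map_map_fnHom j φ _ rfl le_rfl hWW le_rfl, ht₁, Matrix.map_mul,
          map_fnHom_map_resHom j hT le_top le_top hWW]
      · rw [← map_map_fnHom j φ _ rfl le_rfl hWW le_rfl, ← Matrix.map_mul, ← ht₂,
          map_fnHom_map_resHom j hT le_top le_top hWW]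
    · obtain ⟨t, t', ht, ht'⟩ := hQ i
      refine Subbundle.isPullback_of_locally _ (he i) fun x =>
        ⟨V, hVU, P i, ⊤, hVle, trivial, HP i, ?_⟩
      rw [hVπ]
      exact (hF₀ i).of_eq_mul ht ht'
  -- Every point of `T` comes from `T₀`, and `j ≫ φ` factors through `V`.
  have hφV : ⊤ ≤ φ ⁻¹ᵁ V := by
    intro t _
    obtain ⟨t₀, rfl⟩ := hj t
    change φ (j t₀) ∈ V
    rw [← Scheme.Hom.comp_apply, hmain]
    exact hVle (Set.mem_univ _)
  refine ⟨fnHom φ hφV, fun a => ?_, fun a => ?_, fun i => ?_⟩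
  · rw [fnHom_fnHom j φ _ hmain hφV hT hVle, hVπ]
  · rw [fnHom_fnHom φ LG.hom g hφ hVU hφV hgU, hgθ]
  · have h1 := ((hφF i).spannedBy (HP i) (hY i)).mono hφV
    obtain ⟨t, ht⟩ := (hF' i).exists_eq_mul h1
    refine ⟨t, ?_⟩
    rw [← ht]
    ext
    simp [resHom_fnHom]

/-- Global functions on the spectrum of a ring. -/
def specGlobal (B : Type u) [CommRing B] : Γ(Spec (.of B), ⊤) ≃+* B :=
  (Scheme.ΓSpecIso (.of B)).commRingCatIsoToRingEquiv

lemma fnHom_specMap {B K : Type u} [CommRing B] [CommRing K] (ρ : B →+* K)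
    (hT : ⊤ ≤ Spec.map (CommRingCat.ofHom ρ) ⁻¹ᵁ ⊤) (b : Γ(Spec (.of B), ⊤)) :
    specGlobal K (fnHom (Spec.map (CommRingCat.ofHom ρ)) hT b) = ρ (specGlobal B b) := by
  have := congr(($(Scheme.ΓSpecIso_naturality (CommRingCat.ofHom ρ))).hom b)
  exact this

/-- Ring theoretic form of the lifting property of the linked Grassmannian: if `ρ : B → K` induces
a surjection on spectra, then a linked subbundle over `B` whose base change to `K` is given by a
point of `V` is given by a point of `V`. -/
lemma LinkedGrassmannian.exists_ringHom (LG : LinkedGrassmannian C r) (hU : IsAffineOpen U)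
    {V : LG.scheme.Opens} (hV : IsAffineOpen V) (hVU : V ≤ LG.hom ⁻¹ᵁ U)
    {P : ∀ _ : Fin n, Matrix (Fin d) (Fin r) Γ(LG.scheme, V)}
    {Y : ∀ _ : Fin n, Matrix (Fin r) (Fin d) Γ(LG.scheme, V)} (hY : ∀ i, Y i * P i = 1)
    (HP : ∀ i, (LG.univ.F i).SpannedBy (he i) hVU (P i))
    {B K : Type u} [CommRing B] [CommRing K] (ρ : B →+* K)
    (hρ : Function.Surjective (PrimeSpectrum.comap ρ))
    (π : Γ(LG.scheme, V) →+* K) (θ : Γ(S, U) →+* B)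
    (hθ : ∀ a, ρ (θ a) = π (fnHom LG.hom hVU a)) (c : Fin n → ℕ)
    (Q : ∀ i, Matrix (Fin d) (Fin r ⊕ Fin (c i)) B)
    (Q' : ∀ i, Matrix (Fin r ⊕ Fin (c i)) (Fin d) B)
    (hQQ' : ∀ i, Q i * Q' i = 1) (hQ'Q : ∀ i, Q' i * Q i = 1)
    (hup : ∀ i j h, ∃ t : Matrix (Fin r) (Fin r) B,
      (Chain.upMatrix he i j h).map θ * (Q i).submatrix id Sum.inl =
        (Q j).submatrix id Sum.inl * t)
    (hdown : ∀ i j h, ∃ t : Matrix (Fin r) (Fin r) B,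
      (Chain.downMatrix he i j h).map θ * (Q j).submatrix id Sum.inl =
        (Q i).submatrix id Sum.inl * t)
    (hQ : ∀ i, ∃ t t' : Matrix (Fin r) (Fin r) K,
      (P i).map π = ((Q i).submatrix id Sum.inl).map ρ * t ∧
        ((Q i).submatrix id Sum.inl).map ρ = (P i).map π * t') :
    ∃ ψ : Γ(LG.scheme, V) →+* B, (∀ a, ρ (ψ a) = π a) ∧
      (∀ a, ψ (fnHom LG.hom hVU a) = θ a) ∧
      ∀ i, ∃ t : Matrix (Fin r) (Fin r) B, (P i).map ψ = (Q i).submatrix id Sum.inl * t := by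
  set j := Spec.map (CommRingCat.ofHom ρ)
  have hT : ⊤ ≤ j ⁻¹ᵁ ⊤ := le_rfl
  have hj : ∀ b, fnHom j hT ((specGlobal B).symm b) = (specGlobal K).symm (ρ b) := fun b => by
    rw [RingEquiv.eq_symm_apply, fnHom_specMap, RingEquiv.apply_symm_apply]
  let γ : B →+* Γ(Spec (.of B), ⊤) := (specGlobal B).symm
  let γ' : Γ(Spec (.of B), ⊤) →+* B := specGlobal B
  let γK : K →+* Γ(Spec (.of K), ⊤) := (specGlobal K).symm
  have hγγ' : ∀ b, γ' (γ b) = b := (specGlobal B).apply_symm_apply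
  have hmapj : ∀ {ι ι' : Type} (N : Matrix ι ι' B), (N.map γ).map (fnHom j hT) =
      (N.map ρ).map γK := fun N => by
    ext
    exact hj _
  obtain ⟨ψ, h1, h2, h3⟩ := LG.exists_lift he hU hV hVU hY HP j hρ hT (γK.comp π) (γ.comp θ)
    (fun a => by
      change fnHom j hT ((specGlobal B).symm (θ a)) = (specGlobal K).symm (π _)
      rw [hj, hθ]) c (fun i => (Q i).map γ) (fun i => (Q' i).map γ)
    (fun i => by rw [← Matrix.map_mul, hQQ', Matrix.map_one _ (map_zero _) (map_one _)])
    (fun i => by rw [← Matrix.map_mul, hQ'Q, Matrix.map_one _ (map_zero _) (map_one _)])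
    (fun i k h => by
      obtain ⟨t, ht⟩ := hup i k h
      refine ⟨t.map γ, ?_⟩
      rw [RingHom.coe_comp, ← Matrix.map_map, Matrix.submatrix_map, Matrix.submatrix_map,
        ← Matrix.map_mul, ht, Matrix.map_mul])
    (fun i k h => by
      obtain ⟨t, ht⟩ := hdown i k h
      refine ⟨t.map γ, ?_⟩
      rw [RingHom.coe_comp, ← Matrix.map_map, Matrix.submatrix_map, Matrix.submatrix_map,
        ← Matrix.map_mul, ht, Matrix.map_mul])
    (fun i => by
      obtain ⟨t, t', ht, ht'⟩ := hQ i
      refine ⟨t.map γK, t'.map γK, ?_, ?_⟩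
      · rw [RingHom.coe_comp, ← Matrix.map_map, ht, Matrix.submatrix_map, hmapj, Matrix.map_mul]
      · rw [RingHom.coe_comp, ← Matrix.map_map, Matrix.submatrix_map, hmapj, ht', Matrix.map_mul])
  refine ⟨γ'.comp ψ, fun a => ?_, fun a => ?_, fun i => ?_⟩
  · have := h1 a
    change ρ (specGlobal B (ψ a)) = π a
    rw [← fnHom_specMap ρ hT, h1]
    exact (specGlobal K).apply_symm_apply _
  · change γ' (ψ _) = θ a
    rw [h2]
    exact hγγ' _
  · obtain ⟨t, ht⟩ := h3 i
    refine ⟨t.map γ', ?_⟩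
    rw [RingHom.coe_comp, ← Matrix.map_map, ht, Matrix.map_mul]
    congr 1
    ext
    exact hγγ' _

end

/-! ### The ideal of the isotropic Grassmannian in an affine chart. -/

section
variable {S : Scheme.{u}} {n d r : ℕ} {C : Chain S n} {U : S.Opens}
  {e : ∀ i, Fin d → Γ(C.E i, U)} (he : ∀ i, IsFrame (C.E i) U (e i))
  (LG : LinkedGrassmannian C r) {V : LG.scheme.Opens} (hVU : V ≤ LG.hom ⁻¹ᵁ U) {c : Fin n → ℕ}
  {P : ∀ i, Matrix (Fin d) (Fin r ⊕ Fin (c i)) Γ(LG.scheme, V)}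
  {Q : ∀ i, Matrix (Fin r ⊕ Fin (c i)) (Fin d) Γ(LG.scheme, V)}
  (hPQ : ∀ i, P i * Q i = 1) (hQP : ∀ i, Q i * P i = 1)
  (HP : ∀ i, (LG.univ.F i).SpannedBy (he i) hVU ((P i).submatrix id Sum.inl))

include HP in
lemma LinkedGrassmannian.exists_up_eq (i j : Fin n) (h : i.val + 1 = j.val) :
    ∃ t : Matrix (Fin r) (Fin r) Γ(LG.scheme, V),
      (Chain.upMatrix he i j h).map (fnHom LG.hom hVU) * (P i).submatrix id Sum.inl =
        (P j).submatrix id Sum.inl * t :=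
  (pullMap_mem_iff (HP i) (HP j) (C.up i j h)).mp fun V' _ => LG.univ.up_mem i j h V'

include HP in
lemma LinkedGrassmannian.exists_down_eq (i j : Fin n) (h : i.val + 1 = j.val) :
    ∃ t : Matrix (Fin r) (Fin r) Γ(LG.scheme, V),
      (Chain.downMatrix he i j h).map (fnHom LG.hom hVU) * (P j).submatrix id Sum.inl =
        (P i).submatrix id Sum.inl * t :=
  (pullMap_mem_iff (HP j) (HP i) (C.down i j h)).mp fun V' _ => LG.univ.down_mem i j h V'

include hPQ hQP HP in
/-- A point of `V` lies on the isotropic Grassmannian if and only if the matrices of the pairings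
restricted to the universal subbundles vanish. -/
lemma IsotropicGrassmannian.factors_iff_matrix {B : Form C} (LSG : IsotropicGrassmannian LG B)
    {T : Scheme.{u}} (φ : T ⟶ LG.scheme) (hφ : ⊤ ≤ φ ⁻¹ᵁ V) :
    (∃ ψ : T ⟶ LSG.scheme, ψ ≫ LSG.ι = φ) ↔ ∀ i j,
      (((P i).submatrix id Sum.inl).transpose *
        (((B i j).gram (e i) (e j)).map (fnHom LG.hom hVU)) *
          (P j).submatrix id Sum.inl).map (fnHom φ hφ) = (0 : Matrix (Fin r) (Fin r) Γ(T, ⊤)) := by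
  have hU : ⊤ ≤ (φ ≫ LG.hom) ⁻¹ᵁ U := by
    rw [Scheme.Hom.comp_preimage]
    exact hφ.trans (Scheme.Hom.preimage_mono _ hVU)
  have hmap : ∀ N : Matrix (Fin d) (Fin d) Γ(S, U), N.map (fnHom (φ ≫ LG.hom) hU) =
      (N.map (fnHom LG.hom hVU)).map (fnHom φ hφ) := fun N =>
    (map_map_fnHom φ LG.hom _ rfl hVU hφ hU N).symm
  let F : LinkedSubbundle C r (φ ≫ LG.hom) := LinkedSubbundle.ofMatrices he (φ ≫ LG.hom) hU c
    (fun i => (P i).map (fnHom φ hφ)) (fun i => (Q i).map (fnHom φ hφ))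
    (fun i => by rw [← Matrix.map_mul, hPQ, Matrix.map_one _ (map_zero _) (map_one _)])
    (fun i => by rw [← Matrix.map_mul, hQP, Matrix.map_one _ (map_zero _) (map_one _)])
    (fun i k h => by
      obtain ⟨t, ht⟩ := LG.exists_up_eq he hVU HP i k h
      refine ⟨t.map (fnHom φ hφ), ?_⟩
      rw [hmap, Matrix.submatrix_map, Matrix.submatrix_map, ← Matrix.map_mul, ht,
        Matrix.map_mul])
    (fun i k h => by
      obtain ⟨t, ht⟩ := LG.exists_down_eq he hVU HP i k h
      refine ⟨t.map (fnHom φ hφ), ?_⟩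
      rw [hmap, Matrix.submatrix_map, Matrix.submatrix_map, ← Matrix.map_mul, ht,
        Matrix.map_mul])
  have hF : ∀ i, (F.F i).SpannedBy (he i) hU
      (((P i).submatrix id Sum.inl).map (fnHom φ hφ)) := fun i => by
    rw [← Matrix.submatrix_map]
    exact LinkedSubbundle.ofMatrices_spannedBy he _ hU c _ _ _ _ _ _ i
  have hpull : LG.univ.IsPullback φ LG.hom (φ ≫ LG.hom) rfl F := fun i =>
    Subbundle.isPullback_of_locally _ (he i) fun x => ⟨V, hVU, _, ⊤, hφ, trivial, HP i, hF i⟩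
  rw [LSG.factors_iff T φ F hpull, F.isIsotropic_iff B hU hF]
  refine forall₂_congr fun i j => ?_
  rw [hmap, Matrix.map_mul, Matrix.map_mul, Matrix.transpose_map]

/-- The ideal generated by the entries of the matrices of the pairings restricted to the universal
subbundles. -/
def isotropyIdeal (P : ∀ i, Matrix (Fin d) (Fin r ⊕ Fin (c i)) Γ(LG.scheme, V)) (B : Form C) :
    Ideal Γ(LG.scheme, V) :=
  Ideal.span {a | ∃ (i j : Fin n) (k l : Fin r), a = (((P i).submatrix id Sum.inl).transpose *
        (((B i j).gram (e i) (e j)).map (fnHom LG.hom hVU)) *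
          (P j).submatrix id Sum.inl) k l}

lemma fnHom_ι_injective (W : X.Opens) (h : ⊤ ≤ W.ι ⁻¹ᵁ W) : Function.Injective (fnHom W.ι h) := by
  have : Function.Bijective (fnHom W.ι h) := by
    have : IsIso (W.ι.appLE W ⊤ h) := inferInstance
    exact ConcreteCategory.bijective_of_isIso (W.ι.appLE W ⊤ h)
  exact this.1

include hPQ hQP HP in
-- Each inclusion tests the defining property on one morphism. The point `Spec (Γ(V) / J) ⟶ V` kills
-- the matrices, so it factors through the isotropic Grassmannian and the kernel lies in `J`. The
-- open `LSG.ι ⁻¹ᵁ V` itself factors tautologically, so the entries generating `J` vanish on it.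
lemma IsotropicGrassmannian.ker_eq {B : Form C} (LSG : IsotropicGrassmannian LG B)
    (hV : IsAffineOpen V) :
    RingHom.ker (fnHom LSG.ι (le_refl (LSG.ι ⁻¹ᵁ V))) = isotropyIdeal LG hVU (e := e) P B := by
  apply le_antisymm
  · intro a ha
    set J := isotropyIdeal LG hVU (e := e) P B
    let γ : Γ(LG.scheme, V) ⧸ J →+* Γ(Spec (.of (Γ(LG.scheme, V) ⧸ J)), ⊤) :=
      (specGlobal (Γ(LG.scheme, V) ⧸ J)).symm
    set φ := toAffine hV (γ.comp (Ideal.Quotient.mk J))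
    have hφ : ⊤ ≤ φ ⁻¹ᵁ V := toAffine_le _ _
    have hφ' : fnHom φ hφ = γ.comp (Ideal.Quotient.mk J) := fnHom_toAffine _ _
    obtain ⟨ψ, hψ⟩ := (IsotropicGrassmannian.factors_iff_matrix he LG hVU hPQ hQP HP LSG φ
      hφ).mpr fun i j => by
        ext k l
        rw [Matrix.map_apply, hφ', RingHom.comp_apply, Matrix.zero_apply,
          Ideal.Quotient.eq_zero_iff_mem.mpr, map_zero]
        exact Ideal.subset_span ⟨i, j, k, l, rfl⟩
    have hψV : ⊤ ≤ ψ ⁻¹ᵁ (LSG.ι ⁻¹ᵁ V) := by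
      rw [← Scheme.Hom.comp_preimage, hψ]
      exact hφ
    have h1 := fnHom_fnHom ψ LSG.ι φ hψ (le_refl (LSG.ι ⁻¹ᵁ V)) hψV hφ a
    rw [RingHom.mem_ker.mp ha, map_zero, hφ'] at h1
    refine Ideal.Quotient.eq_zero_iff_mem.mp ((specGlobal _).symm.injective ?_)
    rw [map_zero]
    exact h1.symm
  · refine Ideal.span_le.mpr ?_
    rintro _ ⟨i, j, k, l, rfl⟩
    have hW : ⊤ ≤ (LSG.ι ⁻¹ᵁ V).ι ⁻¹ᵁ (LSG.ι ⁻¹ᵁ V) := by simp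
    have hφ : ⊤ ≤ ((LSG.ι ⁻¹ᵁ V).ι ≫ LSG.ι) ⁻¹ᵁ V := by
      rwa [Scheme.Hom.comp_preimage]
    have h0 := (IsotropicGrassmannian.factors_iff_matrix he LG hVU hPQ hQP HP LSG
      ((LSG.ι ⁻¹ᵁ V).ι ≫ LSG.ι) hφ).mp ⟨_, rfl⟩ i j
    rw [SetLike.mem_coe, RingHom.mem_ker]
    refine fnHom_ι_injective (LSG.ι ⁻¹ᵁ V) hW ?_
    rw [fnHom_fnHom _ LSG.ι _ rfl le_rfl hW hφ, map_zero]
    exact congrFun (congrFun h0 k) l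

end

end

/-! ### Transport along a chain of endomorphisms. -/

section Transport
variable {R V : Type*} [CommRing R] [AddCommGroup V] [Module R V]

/-- The composite of the maps up from the index `i` to the index `j` (the identity if `j ≤ i`). -/
def transUp (u : ℕ → Module.End R V) (i : ℕ) : ℕ → Module.End R V
  | 0 => 1
  | j + 1 => if i ≤ j then u j * transUp u i j else 1

/-- The composite of the maps down from the index `i` to the index `j` (the identity if `i ≤ j`). -/
def transDown (v : ℕ → Module.End R V) (j : ℕ) : ℕ → Module.End R V
  | 0 => 1
  | i + 1 => if j ≤ i then transDown v j i * v i else 1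

/-- The transport from the index `i` to the index `j` along the maps of a chain. -/
def trans (u v : ℕ → Module.End R V) (i j : ℕ) : Module.End R V :=
  transUp u i j * transDown v j i

variable (u v : ℕ → Module.End R V)

lemma transUp_of_le {i j : ℕ} (h : j ≤ i) : transUp u i j = 1 := by
  cases j with
  | zero => rfl
  | succ j => rw [transUp, if_neg (by omega)]

lemma transDown_of_le {i j : ℕ} (h : i ≤ j) : transDown v j i = 1 := by
  cases i with
  | zero => rfl
  | succ i => rw [transDown, if_neg (by omega)]

lemma trans_self (i : ℕ) (x : V) : trans u v i i x = x := by
  rw [trans, transUp_of_le u le_rfl, transDown_of_le v le_rfl]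
  rfl

lemma trans_succ {i j : ℕ} (h : i ≤ j) (x : V) : trans u v i (j + 1) x = u j (trans u v i j x) := by
  rw [trans, trans, transUp, if_pos h, transDown_of_le v (by omega), transDown_of_le v h]
  rfl

lemma trans_eq_succ {i j : ℕ} (h : j < i) (x : V) :
    trans u v i j x = v j (trans u v i (j + 1) x) := by
  rw [trans, trans, transUp_of_le u h.le, transUp_of_le u (by omega)]
  induction i generalizing x with
  | zero => omega
  | succ i ih =>
    rcases Nat.lt_succ_iff_lt_or_eq.mp h with h' | rfl
    · have := ih h' (v i x)
      simp only [one_mul] at this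
      simpa [transDown, if_pos h'.le, show j < i by omega] using this
    · simp [transDown, transDown_of_le]

lemma trans_pred {i j : ℕ} (h : j ≤ i) (x : V) :
    trans u v (i + 1) j x = trans u v i j (v i x) := by
  rw [trans, trans, transUp_of_le u h, transUp_of_le u (by omega), transDown, if_pos h]
  rfl

lemma trans_up {i j : ℕ} (h : i < j) (x : V) :
    trans u v i j x = trans u v (i + 1) j (u i x) := by
  obtain ⟨k, rfl⟩ := Nat.exists_eq_add_of_le (Nat.succ_le_of_lt h)
  induction k with
  | zero => simp only [add_zero, Nat.succ_eq_add_one]; rw [trans_succ _ _ le_rfl, trans_self, trans_self]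
  | succ k ih =>
    have e : i.succ + (k + 1) = (i.succ + k) + 1 := by omega
    rw [e, trans_succ _ _ (by omega), trans_succ _ _ (by omega), ih (by omega)]

/-- Induction on the target of a transport. -/
lemma trans_induction {n : ℕ} {i : ℕ} (hi : i < n) {p : ℕ → V → Prop} {x : V} (h0 : p i x)
    (hu : ∀ j, j + 1 < n → i ≤ j → p j (trans u v i j x) → p (j + 1) (u j (trans u v i j x)))
    (hv : ∀ j, j + 1 < n → j + 1 ≤ i → p (j + 1) (trans u v i (j + 1) x) →
      p j (v j (trans u v i (j + 1) x)))
    {j : ℕ} (hj : j < n) : p j (trans u v i j x) := by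
  rcases le_total i j with h | h
  · obtain ⟨k, rfl⟩ := Nat.exists_eq_add_of_le h
    clear h
    induction k with
    | zero => rwa [add_zero, trans_self]
    | succ k ih =>
      rw [← add_assoc, trans_succ _ _ (by omega)]
      exact hu _ (by omega) (by omega) (ih (by omega))
  · obtain ⟨k, rfl⟩ := Nat.exists_eq_add_of_le h
    clear h
    induction k generalizing j with
    | zero => rwa [add_zero, trans_self]
    | succ k ih =>
      rw [trans_eq_succ _ _ (by omega)]
      refine hv _ (by omega) (by omega) ?_
      have e : j + (k + 1) = j + 1 + k := by omega
      rw [e] at h0 hu hv hi ⊢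
      exact ih (by omega) hi h0 hu hv

lemma map_trans {R' V' : Type*} [CommRing R'] [AddCommGroup V'] [Module R' V']
    (u' v' : ℕ → Module.End R' V') {n : ℕ} (f : V → V')
    (hu : ∀ j, j + 1 < n → ∀ x, f (u j x) = u' j (f x))
    (hv : ∀ j, j + 1 < n → ∀ x, f (v j x) = v' j (f x)) {i j : ℕ} (hi : i < n) (hj : j < n)
    (x : V) : f (trans u v i j x) = trans u' v' i j (f x) := by
  refine trans_induction u v hi (p := fun j y => f y = trans u' v' i j (f x)) ?_ ?_ ?_ hj
  · rw [trans_self]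
  · intro j h h' ih
    rw [hu j h, ih, trans_succ _ _ h']
  · intro j h h' ih
    rw [hv j h, ih, ← trans_eq_succ _ _ (by omega)]

end Transport

/-! ### Linked chains of vector spaces. -/

section Linear
variable {κ V : Type*} [Field κ] [AddCommGroup V] [Module κ V]

/-- A linked chain of vector spaces: the fiber of a linked chain. -/
structure IsLinkedSpace (n : ℕ) (s : κ) (u v : ℕ → Module.End κ V) : Prop where
  vu : ∀ j, j + 1 < n → ∀ x, v j (u j x) = s • x
  uv : ∀ j, j + 1 < n → ∀ x, u j (v j x) = s • x
  ker_v : s = 0 → ∀ j, j + 1 < n → ∀ x, v j x = 0 → ∃ y, u j y = x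
  ker_u : s = 0 → ∀ j, j + 1 < n → ∀ x, u j x = 0 → ∃ y, v j y = x
  uu : s = 0 → ∀ j, j + 2 < n → ∀ x, u (j + 1) (u j x) = 0 → u j x = 0
  vv : s = 0 → ∀ j, j + 2 < n → ∀ x, v j (v (j + 1) x) = 0 → v (j + 1) x = 0

/-- A linked family of subspaces of rank `r`. -/
structure IsLinkedSubspace (n r : ℕ) (u v : ℕ → Module.End κ V) (F : ℕ → Submodule κ V) :
    Prop where
  up : ∀ j, j + 1 < n → ∀ x ∈ F j, u j x ∈ F (j + 1)
  down : ∀ j, j + 1 < n → ∀ x ∈ F (j + 1), v j x ∈ F j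
  finrank : ∀ j, j < n → Module.finrank κ (F j) = r

variable {n r : ℕ} {s : κ} {u v : ℕ → Module.End κ V} {F : ℕ → Submodule κ V}

lemma IsLinkedSubspace.trans_mem (hF : IsLinkedSubspace n r u v F) {i j : ℕ} (hi : i < n)
    (hj : j < n) {x : V} (hx : x ∈ F i) : trans u v i j x ∈ F j :=
  trans_induction u v hi (p := fun j y => y ∈ F j) hx (fun j h _ ih => hF.up j h _ ih)
    (fun j h _ ih => hF.down j h _ ih) hj

lemma IsLinkedSpace.up_trans (h : IsLinkedSpace n s u v) {i j : ℕ} (hj : j + 1 < n) (hij : j < i)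
    (x : V) : u j (trans u v i j x) = s • trans u v i (j + 1) x := by
  rw [trans_eq_succ _ _ hij, h.uv j hj]

lemma IsLinkedSpace.down_trans (h : IsLinkedSpace n s u v) {i j : ℕ} (hj : j + 1 < n) (hij : i ≤ j)
    (x : V) : v j (trans u v i (j + 1) x) = s • trans u v i j x := by
  rw [trans_succ _ _ hij, h.vu j hj]

/-- At `s = 0` each map down is injective on the image of the preceding one, hence so are all
further composites down on the image of `v i`. The next lemma is the mirror statement for maps up.
-/
lemma IsLinkedSpace.trans_down_injective (h : IsLinkedSpace n s u v) (hs : s = 0) {i : ℕ}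
    (hi : i + 1 < n) {x : V} (hx : trans u v i 0 (v i x) = 0) : v i x = 0 := by
  induction i generalizing x with
  | zero => rwa [trans_self] at hx
  | succ i ih =>
    rw [trans_pred _ _ (Nat.zero_le _)] at hx
    exact h.vv hs i hi x (ih (by omega) hx)

lemma IsLinkedSpace.trans_up_injective (h : IsLinkedSpace n s u v) (hs : s = 0) {i k : ℕ}
    (hk : i + 1 + k < n) {x : V} (hx : trans u v (i + 1) (i + 1 + k) (u i x) = 0) : u i x = 0 := by
  induction k generalizing i x with
  | zero => rwa [add_zero, trans_self] at hx
  | succ k ih =>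
    rw [trans_up _ _ (by omega)] at hx
    rw [show i + 1 + (k + 1) = i + 1 + 1 + k by omega] at hx hk
    exact h.uu hs i (by omega) x (ih hk hx)

end Linear

/-! ### First order deformations and an obstructed one. -/

section Linear
variable {κ V : Type*} [Field κ] [AddCommGroup V] [Module κ V]

lemma exists_dual_eq_one {p : Submodule κ V} {x : V} (hx : x ∉ p) :
    ∃ f : V →ₗ[κ] κ, f x = 1 ∧ ∀ y ∈ p, f y = 0 := by
  obtain ⟨f, hf, hp⟩ := p.exists_le_ker_of_notMem hx
  refine ⟨(f x)⁻¹ • f, by simp [hf], fun y hy => ?_⟩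
  simp [LinearMap.mem_ker.mp (hp hy)]

/-- For maps between spaces of equal dimension, `ker g ≤ im f` gives `dim ker f ≤ dim im g` by rank
and nullity, and `im g ≤ ker f` is given. So a failure of exactness at one of the two spaces entails
one at the other. -/
lemma exact_of_exact [FiniteDimensional κ V] {F F' : Submodule κ V}
    (hr : Module.finrank κ F = Module.finrank κ F') {f g : Module.End κ V}
    (hf : ∀ x ∈ F, f x ∈ F') (hg : ∀ x ∈ F', g x ∈ F) (hfg : ∀ x ∈ F', f (g x) = 0)
    (H : ∀ y ∈ F', g y = 0 → ∃ w ∈ F, f w = y) :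
    ∀ x ∈ F, f x = 0 → ∃ z ∈ F', g z = x := by
  let f' : F →ₗ[κ] F' := f.restrict hf
  let g' : F' →ₗ[κ] F := g.restrict hg
  have h1 : LinearMap.range g' ≤ LinearMap.ker f' := by
    rintro _ ⟨z, rfl⟩
    exact Subtype.ext (hfg z z.2)
  have h2 : LinearMap.ker g' ≤ LinearMap.range f' := by
    intro y hy
    obtain ⟨w, hw, hwy⟩ := H y y.2 (congrArg Subtype.val (LinearMap.mem_ker.mp hy))
    exact ⟨⟨w, hw⟩, Subtype.ext hwy⟩
  have h3 : LinearMap.range g' = LinearMap.ker f' := by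
    refine Submodule.eq_of_le_of_finrank_le h1 ?_
    have e1 := f'.finrank_range_add_finrank_ker
    have e2 := g'.finrank_range_add_finrank_ker
    have e3 := Submodule.finrank_mono h2
    omega
  intro x hx hfx
  have : (⟨x, hx⟩ : F) ∈ LinearMap.ker f' := LinearMap.mem_ker.mpr (Subtype.ext hfx)
  rw [← h3] at this
  obtain ⟨z, hz⟩ := this
  exact ⟨z, z.2, congrArg Subtype.val hz⟩

/-- A first order deformation of a linked subspace inside the constant chain. -/
structure IsDeformation (n : ℕ) (u v : ℕ → Module.End κ V) (F : ℕ → Submodule κ V)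
    (Φ : ℕ → Module.End κ V) : Prop where
  up : ∀ j, j + 1 < n → ∀ a ∈ F j, u j (Φ j a) - Φ (j + 1) (u j a) ∈ F (j + 1)
  down : ∀ j, j + 1 < n → ∀ b ∈ F (j + 1), v j (Φ (j + 1) b) - Φ j (v j b) ∈ F j

variable {n r : ℕ} {s : κ} {u v : ℕ → Module.End κ V} {F : ℕ → Submodule κ V}

/-- Write `x = v i t` and `y = u i w`. The deformation moves `x` in the direction `w`, hence creates
`y` in `F (i + 1)` at first order, and it moves `y` in the direction `t`. At second order `t` would
have to lie in `F (i + 1) + im (u i)`, so that `x = v i t ∈ v i (F (i + 1))`, which is excluded. -/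
lemma exists_obstructed_deformation (h : IsLinkedSpace n s u v)
    (hs : s = 0) {i : ℕ} (hi : i + 1 < n) {x y : V}
    (hx : x ∈ F i) (hux : u i x = 0) (hxF : ∀ z ∈ F (i + 1), v i z ≠ x) (hy : y ∈ F (i + 1))
    (hvy : v i y = 0) (hyF : ∀ w ∈ F i, u i w ≠ y) :
    ∃ (Φ : ℕ → Module.End κ V) (t : V), IsDeformation n u v F Φ ∧ v i t = x ∧
      u i (Φ i x) = y ∧ Φ (i + 1) y = t ∧ ∀ f ∈ F i, Φ (i + 1) (u i f) = 0 := by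
  obtain ⟨t, rfl⟩ := h.ker_u hs i hi x hux
  obtain ⟨w, rfl⟩ := h.ker_v hs i hi y hvy
  have hvu : ∀ j, j + 1 < n → ∀ x, v j (u j x) = 0 := fun j hj x => by
    rw [h.vu j hj, hs, zero_smul]
  have huv : ∀ j, j + 1 < n → ∀ x, u j (v j x) = 0 := fun j hj x => by
    rw [h.uv j hj, hs, zero_smul]
  -- Transport down to the index `0` is injective on the image of `v i`, so `x` stays separated from
  -- `v i (F (i + 1))`. Symmetrically, `y` stays separated from `u i (F i)` at the last index `n -
  -- 1`.
  have h1 : trans u v i 0 (v i t) ∉ (F (i + 1)).map (trans u v (i + 1) 0) := by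
    rintro ⟨z, hz, hzt⟩
    rw [trans_pred _ _ (Nat.zero_le _)] at hzt
    refine hxF z hz (sub_eq_zero.mp ?_)
    rw [← map_sub]
    refine h.trans_down_injective hs hi ?_
    rw [map_sub, map_sub, hzt, sub_self]
  obtain ⟨k, hk⟩ := Nat.exists_eq_add_of_le (Nat.succ_le_of_lt hi)
  have hk' : n - 1 = i + 1 + k := by omega
  have h2 : trans u v (i + 1) (n - 1) (u i w) ∉ (F i).map (trans u v i (n - 1)) := by
    rintro ⟨z, hz, hzt⟩
    rw [hk', trans_up _ _ (by omega)] at hzt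
    refine hyF z hz (sub_eq_zero.mp ?_)
    rw [← map_sub]
    refine h.trans_up_injective hs (k := k) (by omega) ?_
    rw [map_sub, map_sub, hzt, sub_self]
  obtain ⟨l, hl, hl0⟩ := exists_dual_eq_one h1
  obtain ⟨m, hm, hm0⟩ := exists_dual_eq_one h2
  have hm0' : ∀ f ∈ F i, m (trans u v (i + 1) (n - 1) (u i f)) = 0 := fun f hf => by
    rw [← trans_up _ _ (by omega)]
    exact hm0 _ ⟨f, hf, rfl⟩
  -- The functionals live at the two ends of the chain so that they can be pulled back to every
  -- index. On either side of the edge `i`, the family commutes with the maps towards the end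
  -- carrying the functional, and both terms vanish for the maps in the other direction since `u v =
  -- v u = 0`. Only the edge `i` itself contributes, with multiples of `y ∈ F (i + 1)` and of `x ∈ F
  -- i`.
  refine ⟨fun j => if j ≤ i then (l ∘ₗ trans u v j 0).smulRight (trans u v i j w) else
    (m ∘ₗ trans u v j (n - 1)).smulRight (trans u v (i + 1) j t), t, ⟨?_, ?_⟩, rfl, ?_, ?_, ?_⟩
  · intro j hj a ha
    rcases lt_trichotomy j i with hji | rfl | hji
    · have e : l (trans u v (j + 1) 0 (u j a)) = 0 := by
        rw [trans_pred _ _ (Nat.zero_le _), hvu j hj, map_zero, map_zero]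
      simp only [if_pos hji.le, if_pos (show j + 1 ≤ i by omega), LinearMap.smulRight_apply,
        LinearMap.comp_apply, map_smul, e, zero_smul, sub_zero]
      rw [h.up_trans hj hji, hs, zero_smul, smul_zero]
      exact zero_mem _
    · simp only [le_refl, if_true, if_neg (show ¬ j + 1 ≤ j by omega), LinearMap.smulRight_apply,
        LinearMap.comp_apply, map_smul, trans_self, hm0' a ha, zero_smul, sub_zero]
      exact Submodule.smul_mem _ _ hy
    · simp only [if_neg (show ¬ j ≤ i by omega), if_neg (show ¬ j + 1 ≤ i by omega),
        LinearMap.smulRight_apply, LinearMap.comp_apply, map_smul]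
      rw [trans_up (i := j) (j := n - 1) _ _ (by omega), trans_succ _ _ (by omega), sub_self]
      exact zero_mem _
  · intro j hj b hb
    rcases lt_trichotomy j i with hji | rfl | hji
    · simp only [if_pos hji.le, if_pos (show j + 1 ≤ i by omega), LinearMap.smulRight_apply,
        LinearMap.comp_apply, map_smul]
      rw [trans_pred _ _ (Nat.zero_le _), ← trans_eq_succ _ _ hji, sub_self]
      exact zero_mem _
    · have e : l (trans u v j 0 (v j b)) = 0 := by
        rw [← trans_pred _ _ (Nat.zero_le _)]
        exact hl0 _ ⟨b, hb, rfl⟩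
      simp only [le_refl, if_true, if_neg (show ¬ j + 1 ≤ j by omega), LinearMap.smulRight_apply,
        LinearMap.comp_apply, map_smul, trans_self, e, zero_smul, sub_zero]
      exact Submodule.smul_mem _ _ hx
    · have e : m (trans u v j (n - 1) (v j b)) = 0 := by
        rw [trans_up _ _ (by omega), huv j hj, map_zero, map_zero]
      simp only [if_neg (show ¬ j ≤ i by omega), if_neg (show ¬ j + 1 ≤ i by omega),
        LinearMap.smulRight_apply, LinearMap.comp_apply, map_smul, e, zero_smul, sub_zero]
      rw [h.down_trans hj (by omega), hs, zero_smul, smul_zero]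
      exact zero_mem _
  · simp [hl, trans_self]
  · simp [hm, trans_self]
  · intro f hf
    simp [hm0' f hf]

end Linear

/-! ### Adapted frames of an exact linked subspace. -/

section Linear
variable {κ V : Type*} [Field κ] [AddCommGroup V] [Module κ V]
variable {n r : ℕ} {s : κ} {u v : ℕ → Module.End κ V} {F : ℕ → Submodule κ V}

/-- The image of the preceding member of a linked subspace. -/
def imageUp (u : ℕ → Module.End κ V) (F : ℕ → Submodule κ V) : ℕ → Submodule κ V
  | 0 => ⊥
  | i + 1 => (F i).map (u i)

/-- The image of the following member of a linked subspace. -/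
def imageDown (n : ℕ) (v : ℕ → Module.End κ V) (F : ℕ → Submodule κ V) (i : ℕ) : Submodule κ V :=
  if i + 1 < n then (F (i + 1)).map (v i) else ⊥

lemma exists_relative_complement {p q : Submodule κ V} (h : p ≤ q) :
    ∃ c, c ⊓ p = ⊥ ∧ c ⊔ p = q := by
  obtain ⟨w, hw⟩ := Submodule.exists_isCompl p
  refine ⟨w ⊓ q, ?_, ?_⟩
  · rw [inf_right_comm, inf_comm w, hw.inf_eq_bot, bot_inf_eq]
  · rw [sup_comm, ← sup_inf_assoc_of_le w h, hw.sup_eq_top, top_inf_eq]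

lemma finrank_map_add_finrank [FiniteDimensional κ V] (f : Module.End κ V) {p q : Submodule κ V}
    (hq : q ≤ p) (h : ∀ x ∈ p, f x = 0 ↔ x ∈ q) :
    Module.finrank κ q + Module.finrank κ (p.map f) = Module.finrank κ p := by
  have h1 := (f.domRestrict p).finrank_range_add_finrank_ker
  have h2 : (LinearMap.ker (f.domRestrict p)).map p.subtype = q := by
    ext x
    simp only [Submodule.mem_map, LinearMap.mem_ker, LinearMap.domRestrict_apply,
      Submodule.subtype_apply]
    constructor
    · rintro ⟨y, hy, rfl⟩
      exact (h _ y.2).mp hy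
    · exact fun hx => ⟨⟨x, hq hx⟩, (h _ (hq hx)).mpr hx, rfl⟩
  rw [LinearMap.range_domRestrict] at h1
  rw [← h2, Submodule.finrank_map_subtype_eq, ← h1, add_comm]

lemma IsLinkedSubspace.imageUp_le (hF : IsLinkedSubspace n r u v F) {i : ℕ} (hi : i < n) :
    imageUp u F i ≤ F i := by
  cases i with
  | zero => exact bot_le
  | succ i =>
    rintro _ ⟨x, hx, rfl⟩
    exact hF.up i hi x hx

lemma IsLinkedSubspace.imageDown_le (hF : IsLinkedSubspace n r u v F) (i : ℕ) :
    imageDown n v F i ≤ F i := by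
  rw [imageDown]
  split_ifs with h
  · rintro _ ⟨x, hx, rfl⟩
    exact hF.down i h x hx
  · exact bot_le

/-- An element `u a = v b` is killed by the next `u` because `u v = s = 0`, and the image of one map
up meets the kernel of the next trivially. -/
lemma IsLinkedSpace.inf_eq_bot (h : IsLinkedSpace n s u v) (hs : s = 0) (i : ℕ) :
    imageUp u F i ⊓ imageDown n v F i = ⊥ := by
  rw [eq_bot_iff]
  rintro x ⟨h1, h2⟩
  rw [SetLike.mem_coe, imageDown] at h2
  split_ifs at h2 with hi
  · cases i with
    | zero => exact h1
    | succ i =>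
      obtain ⟨a, -, rfl⟩ := h1
      obtain ⟨b, -, hb⟩ := h2
      refine h.uu hs i hi a ?_
      rw [← hb, h.uv _ hi, hs, zero_smul]
  · exact h2

/-- The space `c i` holds the part of `F i` not coming from its neighbours. Exactness makes the
dimensions of these spaces add up to `r`, so vectors generating every `F j` by transport will be
just numerous enough to be bases. -/
lemma IsLinkedSpace.exists_complements [FiniteDimensional κ V] (h : IsLinkedSpace n s u v)
    (hF : IsLinkedSubspace n r u v F) (hs : s = 0) (hn : 0 < n)
    (hex : ∀ i, i + 1 < n → ∀ x ∈ F i, u i x = 0 → ∃ z ∈ F (i + 1), v i z = x) :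
    ∃ c : ℕ → Submodule κ V, (∀ i, i < n → c i ⊔ (imageUp u F i ⊔ imageDown n v F i) = F i) ∧
      ∑ i : Fin n, Module.finrank κ (c i) = r := by
  have hc : ∀ i, ∃ c, i < n → c ⊓ (imageUp u F i ⊔ imageDown n v F i) = ⊥ ∧
      c ⊔ (imageUp u F i ⊔ imageDown n v F i) = F i := fun i => by
    by_cases hi : i < n
    · obtain ⟨c, hc⟩ := exists_relative_complement
        (sup_le (hF.imageUp_le hi) (hF.imageDown_le i))
      exact ⟨c, fun _ => hc⟩
    · exact ⟨⊥, fun h => absurd h hi⟩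
  choose c hc using hc
  refine ⟨c, fun i hi => (hc i hi).2, ?_⟩
  have h1 : ∀ i, i < n → Module.finrank κ (c i) + (Module.finrank κ (imageUp u F i) +
      Module.finrank κ (imageDown n v F i)) = r := fun i hi => by
    have e1 := Submodule.finrank_sup_add_finrank_inf_eq (imageUp u F i) (imageDown n v F i)
    have e2 := Submodule.finrank_sup_add_finrank_inf_eq (c i)
      (imageUp u F i ⊔ imageDown n v F i)
    rw [h.inf_eq_bot hs, finrank_bot] at e1
    rw [(hc i hi).1, (hc i hi).2, finrank_bot, hF.finrank i hi] at e2
    omega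
  have h2 : ∀ i, i + 1 < n → Module.finrank κ (imageDown n v F i) +
      Module.finrank κ (imageUp u F (i + 1)) = r := fun i hi => by
    rw [← hF.finrank i (by omega)]
    refine finrank_map_add_finrank (u i) (hF.imageDown_le i) fun x hx => ?_
    rw [imageDown, if_pos hi]
    constructor
    · intro hux
      obtain ⟨z, hz, hzx⟩ := hex i hi x hx hux
      exact ⟨z, hz, hzx⟩
    · rintro ⟨z, -, rfl⟩
      rw [h.uv i hi, hs, zero_smul]
  -- The sum telescopes: `h1` and `h2` together say that `dim (c i)` is the difference of the
  -- dimensions of `imageUp` at `i + 1` and at `i`.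
  have h3 : ∀ m, m < n → ∑ i ∈ Finset.range m, Module.finrank κ (c i) =
      Module.finrank κ (imageUp u F m) := fun m => by
    induction m with
    | zero =>
      intro _
      rw [Finset.sum_range_zero]
      exact (finrank_bot κ V).symm
    | succ m ih =>
      intro hm
      rw [Finset.sum_range_succ, ih (by omega)]
      have := h1 m (by omega)
      have := h2 m hm
      omega
  rw [Fin.sum_univ_eq_sum_range fun i => Module.finrank κ (c i)]
  obtain ⟨m, rfl⟩ := Nat.exists_eq_succ_of_ne_zero hn.ne'
  rw [Nat.succ_eq_add_one, Finset.sum_range_succ, h3 m (by omega)]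
  have := h1 m (by omega)
  rw [imageDown, if_neg (by omega), finrank_bot] at this
  omega

lemma IsLinkedSpace.exists_adapted_frame [FiniteDimensional κ V] (h : IsLinkedSpace n s u v)
    (hF : IsLinkedSubspace n r u v F) (hs : s = 0) (hn : 0 < n)
    (hex : ∀ i, i + 1 < n → ∀ x ∈ F i, u i x = 0 → ∃ z ∈ F (i + 1), v i z = x) :
    ∃ (idx : Fin r → ℕ) (e : Fin r → V), (∀ k, idx k < n) ∧ (∀ k, e k ∈ F (idx k)) ∧
      ∀ j, j < n → F j ≤ Submodule.span κ (Set.range fun k => trans u v (idx k) j (e k)) := by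
  obtain ⟨c, hc, hr⟩ := h.exists_complements hF hs hn hex
  have hcard : Fintype.card (Σ i : Fin n, Fin (Module.finrank κ (c i))) = r := by
    simpa using hr
  let eqv := Fintype.equivFinOfCardEq hcard
  let b : ∀ i, Module.Basis (Fin (Module.finrank κ (c i))) κ (c i) := fun i => Module.finBasis κ (c i)
  have hcF : ∀ i, i < n → c i ≤ F i := fun i hi => by
    rw [← hc i hi]
    exact le_sup_left
  refine ⟨fun k => (eqv.symm k).1, fun k => b (eqv.symm k).1 (eqv.symm k).2, fun k => Fin.is_lt _,
    fun k => hcF _ (Fin.is_lt _) (Subtype.mem _), ?_⟩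
  set G : ℕ → Submodule κ V := fun j => Submodule.span κ (Set.range fun k =>
    trans u v (eqv.symm k).1 j (b (eqv.symm k).1 (eqv.symm k).2 : V)) with hG
  have hcG : ∀ i, i < n → ∀ x ∈ c i, ∀ j, trans u v i j x ∈ G j := fun i hi x hx j => by
    have : x = ((∑ l, (b i).repr ⟨x, hx⟩ l • b i l : c i) : V) := by
      rw [(b i).sum_repr]
    rw [this, Submodule.coe_sum, map_sum]
    refine Submodule.sum_mem _ fun l _ => ?_
    rw [Submodule.coe_smul, map_smul]
    refine Submodule.smul_mem _ _ (Submodule.subset_span ⟨eqv ⟨⟨i, hi⟩, l⟩, ?_⟩)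
    exact congrArg (fun σ : Σ i : Fin n, Fin (Module.finrank κ (c i)) =>
      trans u v σ.1 j (b σ.1 σ.2 : V)) (eqv.symm_apply_apply ⟨⟨i, hi⟩, l⟩)
  have hdec : ∀ i, i < n → ∀ x ∈ F i, ∃ a ∈ c i, ∃ y ∈ imageUp u F i, ∃ z ∈ imageDown n v F i,
      x = a + (y + z) := fun i hi x hx => by
    rw [← hc i hi] at hx
    obtain ⟨a, ha, w, hw, rfl⟩ := Submodule.mem_sup.mp hx
    obtain ⟨y, hy, z, hz, rfl⟩ := Submodule.mem_sup.mp hw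
    exact ⟨a, ha, y, hy, z, hz, rfl⟩
  -- An element coming from below is split at the preceding index; its component in `imageDown` is
  -- killed by `u`, so only the complement and elements coming from further below remain. `hB` is
  -- the same argument downwards.
  have hA : ∀ i, ∀ x ∈ imageUp u F i, ∀ j, i ≤ j → j < n → trans u v i j x ∈ G j := fun i => by
    induction i with
    | zero =>
      intro x hx j _ _
      rw [(Submodule.mem_bot κ).mp hx, map_zero]
      exact zero_mem _
    | succ i ih =>
      rintro _ ⟨x, hx, rfl⟩ j hij hj
      obtain ⟨a, ha, y, hy, z, hz, rfl⟩ := hdec i (by omega) x hx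
      have hz0 : u i z = 0 := by
        rw [imageDown, if_pos (by omega)] at hz
        obtain ⟨z, -, rfl⟩ := hz
        rw [h.uv i (by omega), hs, zero_smul]
      have e : u i (a + (y + z)) = u i a + u i y := by rw [map_add, map_add, hz0, add_zero]
      rw [e, map_add, ← trans_up _ _ (by omega), ← trans_up _ _ (by omega)]
      exact add_mem (hcG i (by omega) a ha j) (ih y hy j (by omega) hj)
  have hB : ∀ m i, i + 1 + m = n → ∀ x ∈ imageDown n v F i, ∀ j, j ≤ i → trans u v i j x ∈ G j := by
    intro m
    induction m with
    | zero =>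
      intro i hi x hx j _
      rw [imageDown, if_neg (by omega)] at hx
      rw [(Submodule.mem_bot κ).mp hx, map_zero]
      exact zero_mem _
    | succ m ih =>
      intro i hi x hx j hj
      rw [imageDown, if_pos (by omega)] at hx
      obtain ⟨x, hx, rfl⟩ := hx
      obtain ⟨a, ha, y, hy, z, hz, rfl⟩ := hdec (i + 1) (by omega) x hx
      have hy0 : v i y = 0 := by
        obtain ⟨y, -, rfl⟩ := hy
        rw [h.vu i (by omega), hs, zero_smul]
      have e : v i (a + (y + z)) = v i a + v i z := by rw [map_add, map_add, hy0, zero_add]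
      rw [e, map_add, ← trans_pred _ _ hj, ← trans_pred _ _ hj]
      exact add_mem (hcG _ (by omega) a ha j) (ih _ (by omega) z hz j (by omega))
  intro j hj x hx
  obtain ⟨a, ha, y, hy, z, hz, rfl⟩ := hdec j hj x hx
  rw [← trans_self u v j (a + (y + z)), map_add, map_add]
  exact add_mem (hcG j hj a ha j) (add_mem (hA j y hy j le_rfl hj)
    (hB (n - 1 - j) j (by omega) z hz j le_rfl))

end Linear

/-! ### Linked alternating forms and transport. -/

section Pairing
variable {R V : Type*} [CommRing R] [AddCommGroup V] [Module R V]

/-- A linked alternating form on a chain of modules, all of which are identified with `V`; the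
index `i` stands for the member `i + 1` of the chain. -/
structure IsLinkedPairing (n M : ℕ) (s : R) (u v : ℕ → Module.End R V)
    (b : ℕ → ℕ → V →ₗ[R] V →ₗ[R] R) : Prop where
  up_left : ∀ i j, i + 1 < n → j < n → ∀ x y, b (i + 1) j (u i x) y =
    s ^ (if M < (i + 1 + 1) + (j + 1) then 1 else 0) * b i j x y
  up_right : ∀ i j, i < n → j + 1 < n → ∀ x y, b i (j + 1) x (u j y) =
    s ^ (if M < (i + 1) + (j + 1 + 1) then 1 else 0) * b i j x y
  down_left : ∀ i j, i + 1 < n → j < n → ∀ x y, b i j (v i x) y =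
    s ^ (if (i + 1) + (j + 1) < M then 1 else 0) * b (i + 1) j x y
  down_right : ∀ i j, i < n → j + 1 < n → ∀ x y, b i j x (v j y) =
    s ^ (if (i + 1) + (j + 1) < M then 1 else 0) * b i (j + 1) x y
  self_eq_zero : ∀ i, i < n → ∀ x, b i i x x = 0
  antisymm : ∀ i j, i < n → j < n → i ≠ j → ∀ x y, b i j x y = - b j i y x

variable {n M : ℕ} {s : R} {u v : ℕ → Module.End R V} {b : ℕ → ℕ → V →ₗ[R] V →ₗ[R] R}

lemma IsLinkedPairing.eq_neg (h : IsLinkedPairing n M s u v b) {i j : ℕ} (hi : i < n) (hj : j < n)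
    (x y : V) : b i j x y = - b j i y x := by
  by_cases hij : i = j
  · subst hij
    have := h.self_eq_zero i hi (x + y)
    simp only [map_add, LinearMap.add_apply, h.self_eq_zero i hi, zero_add, add_zero] at this
    exact eq_neg_of_add_eq_zero_right this
  · exact h.antisymm i j hi hj hij x y

/-- As long as the sum of the indices is at most `M`, the exponent attached to a map up is `0`.
Dually, in `trans_right_of_ge`, maps down are free as long as the sum is at least `M`. -/
lemma IsLinkedPairing.trans_right_of_le (h : IsLinkedPairing n M s u v b) {i j j' : ℕ} (hi : i < n)
    (hj' : j' < n) (hjj' : j ≤ j') (hM : (i + 1) + (j' + 1) ≤ M) (x y : V) :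
    b i j' x (trans u v j j' y) = b i j x y := by
  induction j' with
  | zero =>
    obtain rfl : j = 0 := by omega
    rw [trans_self]
  | succ j' ih =>
    rcases Nat.lt_succ_iff_lt_or_eq.mp (Nat.lt_succ_of_le hjj') with hlt | rfl
    · rw [trans_succ _ _ (by omega), h.up_right i j' hi hj', if_neg (by omega), pow_zero, one_mul]
      exact ih (by omega) (by omega) (by omega)
    · rw [trans_self]

lemma IsLinkedPairing.trans_right_of_ge (h : IsLinkedPairing n M s u v b) {i j j' : ℕ} (hi : i < n)
    (hj : j < n) (hjj' : j' ≤ j) (hM : M ≤ (i + 1) + (j' + 1)) (x y : V) :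
    b i j' x (trans u v j j' y) = b i j x y := by
  induction j generalizing y with
  | zero =>
    obtain rfl : j' = 0 := by omega
    rw [trans_self]
  | succ j ih =>
    rcases Nat.lt_succ_iff_lt_or_eq.mp (Nat.lt_succ_of_le hjj') with hlt | rfl
    · rw [trans_pred _ _ (by omega), ih (by omega) (by omega), h.down_right i j hi hj,
        if_neg (by omega), pow_zero, one_mul]
    · rw [trans_self]

lemma IsLinkedPairing.exists_trans_trans (h : IsLinkedPairing n M s u v b) {i i' j j' : ℕ}
    (hi : i < n) (hi' : i' < n) (hj : j < n) (hj' : j' < n) (x y : V) :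
    ∃ N : ℕ, b i' j' (trans u v i i' x) (trans u v j j' y) = s ^ N * b i j x y := by
  have h1 : ∃ N : ℕ, b i j' x (trans u v j j' y) = s ^ N * b i j x y := by
    refine trans_induction u v hj (p := fun k z => ∃ N : ℕ, b i k x z = s ^ N * b i j x y)
      ⟨0, by simp⟩ ?_ ?_ hj'
    · rintro k hk - ⟨N, hN⟩
      exact ⟨_ + N, by rw [h.up_right i k hi hk, hN, ← mul_assoc, ← pow_add]⟩
    · rintro k hk - ⟨N, hN⟩
      exact ⟨_ + N, by rw [h.down_right i k hi hk, hN, ← mul_assoc, ← pow_add]⟩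
  refine trans_induction u v hi
    (p := fun k z => ∃ N : ℕ, b k j' z (trans u v j j' y) = s ^ N * b i j x y) h1 ?_ ?_ hi'
  · rintro k hk - ⟨N, hN⟩
    exact ⟨_ + N, by rw [h.up_left k j' hk hj', hN, ← mul_assoc, ← pow_add]⟩
  · rintro k hk - ⟨N, hN⟩
    exact ⟨_ + N, by rw [h.down_left k j' hk hj', hN, ← mul_assoc, ← pow_add]⟩

end Pairing

/-! ### Linked symplectic forms over a field. -/

section Symplectic
variable {κ V : Type*} [Field κ] [AddCommGroup V] [Module κ V]

/-- A linked symplectic form on a linked chain of vector spaces. -/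
structure IsSymplecticPairing (n M : ℕ) (s : κ) (u v : ℕ → Module.End κ V)
    (b : ℕ → ℕ → V →ₗ[κ] V →ₗ[κ] κ) : Prop extends IsLinkedPairing n M s u v b where
  two_le : 2 ≤ M
  le_two_mul : M ≤ 2 * n
  nondegenerate : ∀ i j, i < n → j < n → (i + 1) + (j + 1) = M →
    ∀ y, (∀ x, b i j x y = 0) → y = 0
  degeneracy_down : s = 0 → M < n + 1 → ∀ i, i + 1 < n → M < (i + 1 + 1) + 1 →
    ∀ y, (∀ x, b (i + 1) (i + 1) x y = 0) → v i y = 0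
  degeneracy_up : s = 0 → n + 1 < M → ∀ i, i + 1 < n → (i + 1) + n < M →
    ∀ y, (∀ x, b i i x y = 0) → u i y = 0

variable {n r M : ℕ} {s : κ} {u v : ℕ → Module.End κ V} {b : ℕ → ℕ → V →ₗ[κ] V →ₗ[κ] κ}

/-- If `idx k` has a partner `j`, the relation says that the combination of the frame transported to
`j` is orthogonal to everything, and nondegeneracy applies. If not, `s = 0` and the degeneracy of
the diagonal pairing at `idx k` is used. This needs the frame vectors on the wrong side of `idx k`
to drop out, which antisymmetry of `c` and induction on the index provide. -/
lemma IsSymplecticPairing.eq_zero_of_sum_eq_zero (h : IsSymplecticPairing n M s u v b)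
    {idx : Fin r → ℕ} {e : Fin r → V} (hidx : ∀ k, idx k < n)
    (hli : ∀ j, j < n → LinearIndependent κ fun k => trans u v (idx k) j (e k))
    (hs : ∀ k, s = 0 ∨ ∃ j, j < n ∧ (idx k + 1) + (j + 1) = M) {c : Fin r → Fin r → κ}
    (hc : ∀ k l, c k l = - c l k)
    (h0 : ∀ k x, ∑ l, c k l * b (idx k) (idx l) x (e l) = 0) (k l : Fin r) : c k l = 0 := by
  have hfin : ∀ k j, j < n → ∑ l, c k l • trans u v (idx l) j (e l) = 0 → ∀ l, c k l = 0 :=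
    fun k j hj hsum => Fintype.linearIndependent_iff.mp (hli j hj) _ hsum
  have hmid : ∀ k j, j < n → (idx k + 1) + (j + 1) = M → ∀ l, c k l = 0 := by
    intro k j hj hM
    refine hfin k j hj (h.nondegenerate (idx k) j (hidx k) hj hM _ fun x => ?_)
    rw [map_sum, ← h0 k x]
    refine Finset.sum_congr rfl fun l _ => ?_
    rw [map_smul, smul_eq_mul]
    rcases le_total (idx l) j with hl | hl
    · rw [h.trans_right_of_le (hidx k) hj hl hM.le]
    · rw [h.trans_right_of_ge (hidx k) (hidx l) hl hM.ge]
  by_cases hMn : M ≤ n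
  · induction hm : idx k using Nat.strong_induction_on generalizing k l with
    | _ m ih =>
    by_cases hin : ∃ j, j < n ∧ (idx k + 1) + (j + 1) = M
    · obtain ⟨j, hj, hM⟩ := hin
      exact hmid k j hj hM l
    have hs0 : s = 0 := (hs k).resolve_right hin
    -- A partner has one-based index `M - (idx k + 1)`, which is at most `n` as `M ≤ n`; it can be
    -- missing only by not being positive.
    have hMk : M ≤ idx k + 1 := by
      by_contra hlt
      exact hin ⟨M - 2 - idx k, by omega, by omega⟩
    have h2 := h.two_le
    have hkn := hidx k
    obtain ⟨i, hi⟩ : ∃ i, idx k = i + 1 := Nat.exists_eq_succ_of_ne_zero (by omega)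
    have hsmall : ∀ l, idx l < idx k → c k l = 0 := fun l hl => by
      rw [hc, ih (idx l) (by omega) l k rfl, neg_zero]
    -- All remaining vectors sit at indices at least `idx k`, where transport down to `idx k`
    -- preserves the pairing. The combination is thus in the degeneracy at `idx k`, so one more step
    -- down kills it, and the frame transported to `i = idx k - 1` is still independent.
    have hdeg := h.degeneracy_down hs0 (by omega) i (by omega) (by omega)
      (∑ l, c k l • trans u v (idx l) (i + 1) (e l)) fun x => by
        rw [map_sum, ← h0 k x]
        refine Finset.sum_congr rfl fun l _ => ?_
        rw [map_smul, smul_eq_mul]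
        by_cases hl : idx l < idx k
        · rw [hsmall l hl, zero_mul, zero_mul]
        · rw [hi, h.trans_right_of_ge (by omega) (hidx l) (by omega) (by omega)]
    refine hfin k i (by omega) ?_ l
    rw [← hdeg, map_sum]
    refine Finset.sum_congr rfl fun l _ => ?_
    rw [map_smul]
    by_cases hl : idx l < idx k
    · rw [hsmall l hl, zero_smul, zero_smul]
    · rw [trans_eq_succ _ _ (by omega)]
  -- Mirror image for `M > n`: indices without a partner are now too small, and the induction
  -- descends from the top of the chain.
  · induction hm : n - idx k using Nat.strong_induction_on generalizing k l with
    | _ m ih =>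
    by_cases hin : ∃ j, j < n ∧ (idx k + 1) + (j + 1) = M
    · obtain ⟨j, hj, hM⟩ := hin
      exact hmid k j hj hM l
    have hs0 : s = 0 := (hs k).resolve_right hin
    have hkn := hidx k
    have hMk : idx k + 1 + n < M := by
      by_contra hlt
      exact hin ⟨M - 2 - idx k, by omega, by omega⟩
    have h2 := h.le_two_mul
    have hlarge : ∀ l, idx k < idx l → c k l = 0 := fun l hl => by
      rw [hc, ih (n - idx l) (by omega) l k rfl, neg_zero]
    have hdeg := h.degeneracy_up hs0 (by omega) (idx k) (by omega) (by omega)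
      (∑ l, c k l • trans u v (idx l) (idx k) (e l)) fun x => by
        rw [map_sum, ← h0 k x]
        refine Finset.sum_congr rfl fun l _ => ?_
        rw [map_smul, smul_eq_mul]
        by_cases hl : idx k < idx l
        · rw [hlarge l hl, zero_mul, zero_mul]
        · rw [h.trans_right_of_le hkn hkn (by omega) (by omega)]
    refine hfin k (idx k + 1) (by omega) ?_ l
    rw [← hdeg, map_sum]
    refine Finset.sum_congr rfl fun l _ => ?_
    rw [map_smul]
    by_cases hl : idx k < idx l
    · rw [hlarge l hl, zero_smul, zero_smul]
    · rw [trans_succ _ _ (by omega)]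

end Symplectic

/-! ### Second order extension of derivations. -/

section SecondOrder
open Polynomial
variable {R A κ : Type*} [CommRing R] [CommRing A] [Algebra R A] [Field κ] [Algebra R κ]
  [Algebra A κ] [IsScalarTower R A κ]

/-- The first order infinitesimal point given by a derivation. -/
noncomputable def firstOrder (δ : Derivation R A κ) :
    A →ₐ[R] κ[X] ⧸ (Ideal.span {X ^ 2} : Ideal κ[X]) where
  toFun a := Ideal.Quotient.mk _ (C (algebraMap A κ a) + C (δ a) * X)
  map_one' := by simp
  map_zero' := by simp
  map_add' a b := by
    rw [← map_add]
    congr 1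
    simp only [map_add]
    ring
  map_mul' a b := by
    rw [← map_mul, Ideal.Quotient.eq, Ideal.mem_span_singleton]
    refine ⟨-(C (δ a) * C (δ b)), ?_⟩
    simp only [Derivation.leibniz, map_mul, map_add, Algebra.smul_def]
    ring
  commutes' r := by
    rw [Derivation.map_algebraMap, ← IsScalarTower.algebraMap_apply R A κ]
    simp only [map_zero, zero_mul, add_zero]
    rfl

/-- A derivation of a formally smooth algebra with values in a field extends to second order. -/
lemma exists_second_order [Algebra.FormallySmooth R A] (δ : Derivation R A κ) :
    ∃ D : A →+ κ, (∀ a b, D (a * b) = algebraMap A κ a * D b + δ a * δ b + D a * algebraMap A κ b) ∧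
      ∀ r, D (algebraMap R A r) = 0 := by
  have hle : (Ideal.span {X ^ 3} : Ideal κ[X]) ≤ Ideal.span {X ^ 2} := by
    rw [Ideal.span_singleton_le_span_singleton]
    exact pow_dvd_pow X (by norm_num)
  let q : (κ[X] ⧸ (Ideal.span {X ^ 3} : Ideal κ[X])) →ₐ[R] κ[X] ⧸ (Ideal.span {X ^ 2} : Ideal κ[X]) :=
    Ideal.Quotient.factorₐ R hle
  have hq : Function.Surjective q := Ideal.Quotient.factor_surjective hle
  -- The kernel is `(X ^ 2) / (X ^ 3)`, of square zero, so formal smoothness lifts the first order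
  -- point.
  have hker : IsNilpotent (RingHom.ker q) := by
    refine ⟨2, le_bot_iff.mp ?_⟩
    refine (pow_two (RingHom.ker q)).le.trans (Ideal.mul_le.mpr ?_)
    intro a ha b hb
    obtain ⟨a, rfl⟩ := Ideal.Quotient.mk_surjective a
    obtain ⟨b, rfl⟩ := Ideal.Quotient.mk_surjective b
    have ha' : X ^ 2 ∣ a := Ideal.mem_span_singleton.mp (Ideal.Quotient.eq_zero_iff_mem.mp ha)
    have hb' : X ^ 2 ∣ b := Ideal.mem_span_singleton.mp (Ideal.Quotient.eq_zero_iff_mem.mp hb)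
    change Ideal.Quotient.mk _ a * Ideal.Quotient.mk _ b = 0
    rw [← map_mul, Ideal.Quotient.eq_zero_iff_mem, Ideal.mem_span_singleton]
    exact (pow_dvd_pow X (by norm_num : 3 ≤ 2 + 2)).trans
      (by rw [pow_add]; exact mul_dvd_mul ha' hb')
  let ψ := Algebra.FormallySmooth.liftOfSurjective (firstOrder δ) q hq hker
  have hψ : ∀ a, q (ψ a) = firstOrder δ a :=
    fun a => Algebra.FormallySmooth.liftOfSurjective_apply (firstOrder δ) q hq hker a
  have hrep : ∀ a, ∃ p : κ[X], Ideal.Quotient.mk _ p = ψ a ∧ p.coeff 0 = algebraMap A κ a ∧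
      p.coeff 1 = δ a := fun a => by
    obtain ⟨p, hp⟩ := Ideal.Quotient.mk_surjective (ψ a)
    have h1 : Ideal.Quotient.mk (Ideal.span {X ^ 2} : Ideal κ[X]) p =
        Ideal.Quotient.mk _ (C (algebraMap A κ a) + C (δ a) * X) := by
      have := hψ a
      rw [← hp] at this
      exact this
    rw [Ideal.Quotient.eq, Ideal.mem_span_singleton, X_pow_dvd_iff] at h1
    refine ⟨p, hp, ?_, ?_⟩
    · simpa [sub_eq_zero] using h1 0 (by norm_num)
    · simpa [sub_eq_zero, coeff_C] using h1 1 (by norm_num)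
  choose p hp hp0 hp1 using hrep
  have hcoeff : ∀ f g : κ[X], Ideal.Quotient.mk (Ideal.span {X ^ 3} : Ideal κ[X]) f =
      Ideal.Quotient.mk _ g → f.coeff 2 = g.coeff 2 := fun f g h => by
    rw [Ideal.Quotient.eq, Ideal.mem_span_singleton, X_pow_dvd_iff] at h
    simpa [sub_eq_zero] using h 2 (by norm_num)
  -- `D` is the coefficient of `X ^ 2` in the lift; it is well defined modulo `X ^ 3`, and the
  -- product rule is the second coefficient of a product.
  refine ⟨AddMonoidHom.mk' (fun a => (p a).coeff 2) fun a b => ?_, fun a b => ?_, fun r => ?_⟩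
  · rw [← coeff_add]
    apply hcoeff
    rw [map_add, hp, hp, hp, map_add]
  · change (p (a * b)).coeff 2 = _ * (p b).coeff 2 + _ + (p a).coeff 2 * _
    have : (p (a * b)).coeff 2 = (p a * p b).coeff 2 := by
      apply hcoeff
      rw [map_mul, hp, hp, hp, map_mul]
    rw [this, coeff_mul, Finset.Nat.sum_antidiagonal_eq_sum_range_succ_mk]
    simp [Finset.sum_range_succ, hp0, hp1]
  · change (p (algebraMap R A r)).coeff 2 = 0
    have : (p (algebraMap R A r)).coeff 2 = (C (algebraMap R κ r)).coeff 2 := by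
      apply hcoeff
      rw [hp, AlgHom.commutes]
      rfl
    rw [this, coeff_C, if_neg (by norm_num)]

end SecondOrder

/-! ### Local model: smoothness forces exactness of the fiber. -/

section LocalModel
variable {R A κ : Type*} [CommRing R] [CommRing A] [Algebra R A] [Field κ] [Algebra R κ]
  [Algebra A κ] [IsScalarTower R A κ] {n d r : ℕ}

/-- The endomorphisms of free modules given by matrices, after extension of scalars. -/
def linEnd (X : Type*) [CommRing X] [Algebra R X] (N : ℕ → Matrix (Fin d) (Fin d) R) (j : ℕ) :
    Module.End X (Fin d → X) :=
  ((N j).map (algebraMap R X)).mulVecLin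

lemma linEnd_apply (X : Type*) [CommRing X] [Algebra R X] (N : ℕ → Matrix (Fin d) (Fin d) R)
    (j : ℕ) (x : Fin d → X) : linEnd X N j x = ((N j).map (algebraMap R X)).mulVec x := rfl

variable (κ) in
/-- The subspace spanned by the columns of a matrix, after extension of scalars. -/
def columnSpan (P : ℕ → Matrix (Fin d) (Fin r) A) (j : ℕ) : Submodule κ (Fin d → κ) :=
  LinearMap.range ((P j).map (algebraMap A κ)).mulVecLin

/-- The matrices `P` define a linked subbundle. -/
structure IsLinkedMatrix (n : ℕ) (U D : ℕ → Matrix (Fin d) (Fin d) R)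
    (P : ℕ → Matrix (Fin d) (Fin r) A) : Prop where
  up : ∀ j, j + 1 < n → ∃ t : Matrix (Fin r) (Fin r) A,
    (U j).map (algebraMap R A) * P j = P (j + 1) * t
  down : ∀ j, j + 1 < n → ∃ t : Matrix (Fin r) (Fin r) A,
    (D j).map (algebraMap R A) * P (j + 1) = P j * t
  leftInverse : ∀ j, j < n → ∃ Y : Matrix (Fin r) (Fin d) A, Y * P j = 1

variable (κ) in
/-- Every first order deformation of the fiber is realized by a derivation. -/
def HasTangents (n : ℕ) (U D : ℕ → Matrix (Fin d) (Fin d) R)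
    (P : ℕ → Matrix (Fin d) (Fin r) A) : Prop :=
  ∀ Φ : ℕ → Module.End κ (Fin d → κ),
    IsDeformation n (linEnd κ U) (linEnd κ D) (columnSpan κ P) Φ →
      ∃ δ : Derivation R A κ, ∀ j, j < n → ∀ c : Fin r → κ,
        ((P j).map δ).mulVec c - Φ j (((P j).map (algebraMap A κ)).mulVec c) ∈ columnSpan κ P j

variable {U D : ℕ → Matrix (Fin d) (Fin d) R} {P : ℕ → Matrix (Fin d) (Fin r) A}

lemma map_map_algebraMap {l m : Type*} (N : Matrix l m R) :
    (N.map (algebraMap R A)).map (algebraMap A κ) = N.map (algebraMap R κ) := by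
  ext
  simp [← IsScalarTower.algebraMap_apply]

lemma mulVec_mem_columnSpan (j : ℕ) (c : Fin r → κ) :
    ((P j).map (algebraMap A κ)).mulVec c ∈ columnSpan κ P j := ⟨c, rfl⟩

omit [Algebra R κ] [IsScalarTower R A κ] in
lemma IsLinkedMatrix.mulVec_injective (h : IsLinkedMatrix n U D P) {j : ℕ} (hj : j < n) :
    Function.Injective ((P j).map (algebraMap A κ)).mulVec := by
  obtain ⟨Y, hY⟩ := h.leftInverse j hj
  refine Function.LeftInverse.injective (g := (Y.map (algebraMap A κ)).mulVec) fun c => ?_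
  rw [Matrix.mulVec_mulVec, ← Matrix.map_mul, hY, Matrix.map_one _ (map_zero _) (map_one _),
    Matrix.one_mulVec]

lemma IsLinkedMatrix.isLinkedSubspace (h : IsLinkedMatrix n U D P) :
    IsLinkedSubspace n r (linEnd κ U) (linEnd κ D) (columnSpan κ P) where
  up j hj := by
    rintro _ ⟨c, rfl⟩
    obtain ⟨t, ht⟩ := h.up j hj
    refine ⟨(t.map (algebraMap A κ)).mulVec c, ?_⟩
    rw [Matrix.mulVecLin_apply, Matrix.mulVecLin_apply, linEnd_apply, Matrix.mulVec_mulVec,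
      Matrix.mulVec_mulVec, ← Matrix.map_mul, ← ht, Matrix.map_mul, map_map_algebraMap]
  down j hj := by
    rintro _ ⟨c, rfl⟩
    obtain ⟨t, ht⟩ := h.down j hj
    refine ⟨(t.map (algebraMap A κ)).mulVec c, ?_⟩
    rw [Matrix.mulVecLin_apply, Matrix.mulVecLin_apply, linEnd_apply, Matrix.mulVec_mulVec,
      Matrix.mulVec_mulVec, ← Matrix.map_mul, ← ht, Matrix.map_mul, map_map_algebraMap]
  finrank j hj := by
    rw [columnSpan, LinearMap.finrank_range_of_inj (h.mulVec_injective hj),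
      Module.finrank_fin_fun]

omit [IsScalarTower R A κ] in
lemma derivation_map_mul (δ : Derivation R A κ) {l m o : Type*} [Fintype m] (X : Matrix l m A)
    (Y : Matrix m o A) : (X * Y).map δ =
      X.map (algebraMap A κ) * Y.map δ + X.map δ * Y.map (algebraMap A κ) := by
  ext i j
  simp only [Matrix.map_apply, Matrix.mul_apply, Matrix.add_apply, map_sum, Derivation.leibniz,
    Finset.sum_add_distrib, Algebra.smul_def]
  congr 1
  exact Finset.sum_congr rfl fun _ _ => mul_comm _ _

omit [IsScalarTower R A κ] in
lemma derivation_map_algebraMap (δ : Derivation R A κ) {l m : Type*} (X : Matrix l m R) :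
    (X.map (algebraMap R A)).map δ = 0 := by
  ext
  simp

/-- If all first order deformations are realized, then by smoothness there is no obstruction to
deforming them further, and this forces the fiber to be exact. -/
lemma IsLinkedMatrix.exact [Algebra.FormallySmooth R A] (h : IsLinkedMatrix n U D P)
    (hT : HasTangents κ n U D P) {s : κ} (hs : s = 0)
    (hL : IsLinkedSpace n s (linEnd κ U) (linEnd κ D)) (i : ℕ) (hi : i + 1 < n) :
    ∀ x ∈ columnSpan κ P i, linEnd κ U i x = 0 →
      ∃ z ∈ columnSpan κ P (i + 1), linEnd κ D i z = x := by
  have hF := h.isLinkedSubspace (κ := κ)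
  by_contra hcon
  -- By equality of ranks, the failure of exactness at `i` produces a failure at `i + 1`; the
  -- obstructed deformation needs both.
  have hex : ∃ y ∈ columnSpan κ P (i + 1), linEnd κ D i y = 0 ∧
      ∀ w ∈ columnSpan κ P i, linEnd κ U i w ≠ y := by
    by_contra hno
    push Not at hno
    exact hcon (exact_of_exact (by rw [hF.finrank i (by omega), hF.finrank _ hi]) (hF.up i hi)
      (hF.down i hi) (fun x _ => by rw [hL.uv i hi, hs, zero_smul]) hno)
  push Not at hcon
  obtain ⟨x, hx, hux, hxF⟩ := hcon
  obtain ⟨y, hy, hvy, hyF⟩ := hex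
  obtain ⟨Φ, t, hΦ, hvt, huΦ, hΦy, hΦu⟩ :=
    exists_obstructed_deformation hL hs hi hx hux hxF hy hvy hyF
  obtain ⟨δ, hδ⟩ := hT Φ hΦ
  obtain ⟨E, hE, hER⟩ := exists_second_order δ
  obtain ⟨c, rfl⟩ := hx
  rw [Matrix.mulVecLin_apply] at hux hvt huΦ
  obtain ⟨τ, hτ⟩ := h.up i hi
  have hEmul : ∀ (X : Matrix (Fin d) (Fin r) A) (Y : Matrix (Fin r) (Fin r) A), (X * Y).map E =
      X.map (algebraMap A κ) * Y.map E + X.map δ * Y.map δ +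
        X.map E * Y.map (algebraMap A κ) := fun X Y => by
    ext k l
    simp only [Matrix.map_apply, Matrix.mul_apply, Matrix.add_apply, map_sum, hE,
      Finset.sum_add_distrib]
  have hEmul' : ∀ (X : Matrix (Fin d) (Fin d) R) (Y : Matrix (Fin d) (Fin r) A),
      (X.map (algebraMap R A) * Y).map E = X.map (algebraMap R κ) * Y.map E := fun X Y => by
    ext k l
    simp only [Matrix.map_apply, Matrix.mul_apply, map_sum, hE, hER, Derivation.map_algebraMap,
      zero_mul, add_zero, ← IsScalarTower.algebraMap_apply]
  have e0 := congrArg (fun X => X.map (algebraMap A κ)) hτ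
  have e1 := congrArg (fun X => X.map δ) hτ
  have e2 := congrArg (fun X => X.map E) hτ
  simp only [Matrix.map_mul, map_map_algebraMap] at e0
  simp only [derivation_map_mul, derivation_map_algebraMap, Matrix.zero_mul, add_zero,
    map_map_algebraMap] at e1
  simp only [hEmul, hEmul'] at e2
  -- The relation `U P_i = P_{i+1} τ` is expanded to second order and applied to `c`. Its constant
  -- term vanishes on `c` because `u x = 0`, which removes the last term in each of the two
  -- following orders.
  have hτc : (τ.map (algebraMap A κ)).mulVec c = 0 := by
    refine h.mulVec_injective (κ := κ) hi ?_
    rw [Matrix.mulVec_mulVec, ← e0, ← Matrix.mulVec_mulVec, Matrix.mulVec_zero]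
    exact hux
  obtain ⟨g, hg⟩ := hδ i (by omega) c
  rw [Matrix.mulVecLin_apply] at hg
  -- First order: modulo `u (F i)`, the vector `y` is represented by the first order part of `τ`.
  have f1 : ((P (i + 1)).map (algebraMap A κ)).mulVec ((τ.map δ).mulVec c) =
      y + linEnd κ U i (((P i).map (algebraMap A κ)).mulVec g) := by
    have := congrArg (fun X => X.mulVec c) e1
    simp only [Matrix.add_mulVec, ← Matrix.mulVec_mulVec, hτc, Matrix.mulVec_zero, add_zero] at this
    rw [← this, hg, ← linEnd_apply, map_sub, huΦ]
    abel
  -- Second order: the cross term of the derivatives of `P_{i+1}` and `τ` is `Φ (i + 1)` applied to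
  -- the vector of `f1`, modulo `F (i + 1)`, which is `t` since `Φ (i + 1)` kills `u (F i)`.
  have f2 : linEnd κ U i (((P i).map E).mulVec c) - t ∈ columnSpan κ P (i + 1) := by
    have := congrArg (fun X => X.mulVec c) e2
    simp only [Matrix.add_mulVec, ← Matrix.mulVec_mulVec, hτc, Matrix.mulVec_zero, add_zero] at this
    have h3 := hδ (i + 1) hi ((τ.map δ).mulVec c)
    rw [f1, map_add, hΦy, hΦu _ (mulVec_mem_columnSpan i g), add_zero] at h3
    rw [linEnd_apply, this, add_sub_assoc]
    exact add_mem (mulVec_mem_columnSpan _ _) h3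
  refine hxF _ (neg_mem f2) ?_
  rw [map_neg, map_sub, hL.vu i hi, hs, zero_smul, zero_sub, neg_neg, hvt]
  rfl

end LocalModel

/-! ### Frames and deformations of the fiber, for any value of `s`. -/

section LinearIndependence
variable {κ V : Type*} [Field κ] [AddCommGroup V] [Module κ V] {n r M : ℕ} {s : κ}
  {u v : ℕ → Module.End κ V} {F : ℕ → Submodule κ V}

lemma IsLinkedSpace.trans_injective (h : IsLinkedSpace n s u v) (hs : s ≠ 0) {i j : ℕ} (hi : i < n)
    (hj : j < n) : Function.Injective (trans u v i j) := by
  rw [injective_iff_map_eq_zero]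
  intro x hx
  have key : trans u v i j x = 0 → x = 0 :=
    trans_induction u v hi (p := fun _ z => z = 0 → x = 0) id
      (fun j hj _ ih h0 => ih (by
        have := h.vu j hj (trans u v i j x)
        rw [h0, map_zero] at this
        exact (smul_eq_zero.mp this.symm).resolve_left hs))
      (fun j hj _ ih h0 => ih (by
        have := h.uv j hj (trans u v i (j + 1) x)
        rw [h0, map_zero] at this
        exact (smul_eq_zero.mp this.symm).resolve_left hs)) hj
  exact key hx

/-- A family of elements of the members of a linked subspace whose transports form a basis of each
member, and which have a partner with respect to the index of the form unless `s = 0`. -/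
lemma IsLinkedSpace.exists_frame [FiniteDimensional κ V] (h : IsLinkedSpace n s u v)
    (hF : IsLinkedSubspace n r u v F) (h2 : 2 ≤ M) (hM : M ≤ 2 * n)
    (hex : s = 0 → ∀ i, i + 1 < n → ∀ x ∈ F i, u i x = 0 → ∃ z ∈ F (i + 1), v i z = x) :
    ∃ (idx : Fin r → ℕ) (e : Fin r → V), (∀ k, idx k < n) ∧ (∀ k, e k ∈ F (idx k)) ∧
      (∀ k, s = 0 ∨ ∃ j, j < n ∧ (idx k + 1) + (j + 1) = M) ∧
      ∀ j, j < n → LinearIndependent κ fun k => trans u v (idx k) j (e k) := by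
  by_cases hs : s = 0
  · obtain ⟨idx, e, hidx, he, hspan⟩ := h.exists_adapted_frame hF hs (by omega) (hex hs)
    refine ⟨idx, e, hidx, he, fun _ => Or.inl hs, fun j hj => ?_⟩
    rw [linearIndependent_iff_card_le_finrank_span, Fintype.card_fin]
    exact (hF.finrank j hj).ge.trans (Submodule.finrank_mono (hspan j hj))
  -- For `s ≠ 0` transport is injective, so a basis at any one index works. The middle zero-based
  -- index is chosen because it and its partner `M - 2 - (M - 2) / 2` are in range when `2 ≤ M ≤ 2 *
  -- n`.
  · have hi : (M - 2) / 2 < n := by omega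
    let b := Module.finBasisOfFinrankEq κ (F ((M - 2) / 2)) (hF.finrank _ hi)
    refine ⟨fun _ => (M - 2) / 2, fun k => b k, fun _ => hi, fun k => (b k).2, fun _ =>
      Or.inr ⟨M - 2 - (M - 2) / 2, by omega, by dsimp only; omega⟩, fun j hj => ?_⟩
    exact (b.linearIndependent.map' (F ((M - 2) / 2)).subtype (Submodule.ker_subtype _)).map'
      (trans u v ((M - 2) / 2) j) (LinearMap.ker_eq_bot.mpr (h.trans_injective hs hi hj))

lemma IsLinkedSubspace.span_eq [FiniteDimensional κ V] (hF : IsLinkedSubspace n r u v F)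
    {idx : Fin r → ℕ} {e : Fin r → V} (hidx : ∀ k, idx k < n) (he : ∀ k, e k ∈ F (idx k))
    (hli : ∀ j, j < n → LinearIndependent κ fun k => trans u v (idx k) j (e k)) {j : ℕ}
    (hj : j < n) : Submodule.span κ (Set.range fun k => trans u v (idx k) j (e k)) = F j := by
  refine Submodule.eq_of_le_of_finrank_eq (Submodule.span_le.mpr ?_) ?_
  · rintro _ ⟨k, rfl⟩
    exact hF.trans_mem (hidx k) hj (he k)
  · rw [finrank_span_eq_card (hli j hj), hF.finrank j hj, Fintype.card_fin]

lemma exists_linearMap_eq [FiniteDimensional κ V] {e : Fin r → V} (he : LinearIndependent κ e)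
    (w : Fin r → V) : ∃ f : Module.End κ V, ∀ k, f (e k) = w k := by
  obtain ⟨g, hg⟩ := (Fintype.linearCombination κ e).exists_leftInverse_of_injective
    (LinearMap.ker_eq_bot.mpr he.fintypeLinearCombination_injective)
  refine ⟨Fintype.linearCombination κ w ∘ₗ g, fun k => ?_⟩
  have : g (e k) = Pi.single k 1 := by
    have := LinearMap.congr_fun hg (Pi.single k 1)
    simpa using this
  simp [this]

/-- Transporting arbitrary vectors at the indices of an adapted frame gives a deformation. -/
lemma IsLinkedSpace.exists_deformation [FiniteDimensional κ V] (h : IsLinkedSpace n s u v)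
    (hF : IsLinkedSubspace n r u v F) {idx : Fin r → ℕ} {e : Fin r → V} (hidx : ∀ k, idx k < n)
    (he : ∀ k, e k ∈ F (idx k))
    (hli : ∀ j, j < n → LinearIndependent κ fun k => trans u v (idx k) j (e k))
    (w : Fin r → V) :
    ∃ Φ : ℕ → Module.End κ V, IsDeformation n u v F Φ ∧ ∀ k, Φ (idx k) (e k) = w k := by
  have hΦ : ∀ j, ∃ Φ : Module.End κ V, j < n → ∀ k, Φ (trans u v (idx k) j (e k)) =
      trans u v (idx k) j (w k) := fun j => by
    by_cases hj : j < n
    · obtain ⟨f, hf⟩ := exists_linearMap_eq (hli j hj) fun k => trans u v (idx k) j (w k)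
      exact ⟨f, fun _ => hf⟩
    · exact ⟨0, fun h => absurd h hj⟩
  choose Φ hΦ using hΦ
  have hu : ∀ j, j + 1 < n → ∀ a ∈ F j, u j (Φ j a) = Φ (j + 1) (u j a) := fun j hj a ha => by
    rw [← hF.span_eq hidx he hli (show j < n by omega)] at ha
    refine LinearMap.eqOn_span (f := u j ∘ₗ Φ j) (g := Φ (j + 1) ∘ₗ u j) ?_ ha
    rintro _ ⟨k, rfl⟩
    simp only [LinearMap.comp_apply]
    rw [hΦ j (by omega)]
    rcases le_or_gt (idx k) j with hk | hk
    · rw [← trans_succ _ _ hk, ← trans_succ _ _ hk, hΦ _ hj]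
    · rw [h.up_trans hj hk, h.up_trans hj hk, map_smul, hΦ _ hj]
  have hv : ∀ j, j + 1 < n → ∀ a ∈ F (j + 1), v j (Φ (j + 1) a) = Φ j (v j a) := fun j hj a ha => by
    rw [← hF.span_eq hidx he hli hj] at ha
    refine LinearMap.eqOn_span (f := v j ∘ₗ Φ (j + 1)) (g := Φ j ∘ₗ v j) ?_ ha
    rintro _ ⟨k, rfl⟩
    simp only [LinearMap.comp_apply]
    rw [hΦ _ hj]
    rcases le_or_gt (idx k) j with hk | hk
    · rw [h.down_trans hj hk, h.down_trans hj hk, map_smul, hΦ _ (by omega)]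
    · rw [← trans_eq_succ _ _ hk, ← trans_eq_succ _ _ hk, hΦ _ (by omega)]
  refine ⟨Φ, ⟨fun j hj a ha => ?_, fun j hj a ha => ?_⟩, fun k => ?_⟩
  · rw [hu j hj a ha, sub_self]
    exact zero_mem _
  · rw [hv j hj a ha, sub_self]
    exact zero_mem _
  · have := hΦ (idx k) (hidx k) k
    rwa [trans_self, trans_self] at this

end LinearIndependence

/-! ### Lifting an adapted frame to the coordinate ring. -/

section LocalModel
variable {R A κ : Type*} [CommRing R] [CommRing A] [Algebra R A] [Field κ] [Algebra R κ]
  [Algebra A κ] [IsScalarTower R A κ] {n d r M : ℕ}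
  {U D : ℕ → Matrix (Fin d) (Fin d) R} {P : ℕ → Matrix (Fin d) (Fin r) A}

/-- The pairings of free modules given by matrices, after extension of scalars. -/
noncomputable def matPairing (X : Type*) [CommRing X] [Algebra R X]
    (B : ℕ → ℕ → Matrix (Fin d) (Fin d) R) (i j : ℕ) :
    (Fin d → X) →ₗ[X] (Fin d → X) →ₗ[X] X :=
  Matrix.toLinearMap₂' X ((B i j).map (algebraMap R X))

lemma matPairing_apply (X : Type*) [CommRing X] [Algebra R X]
    (B : ℕ → ℕ → Matrix (Fin d) (Fin d) R) (i j : ℕ) (x y : Fin d → X) :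
    matPairing X B i j x y = x ⬝ᵥ ((B i j).map (algebraMap R X)).mulVec y :=
  Matrix.toLinearMap₂'_apply' _ _ _

lemma exists_common_denominator (hfrac : ∀ x : κ, ∃ a b : A, algebraMap A κ b ≠ 0 ∧
    algebraMap A κ b * x = algebraMap A κ a) (c : Fin r → κ) :
    ∃ (b : A) (c' : Fin r → A), algebraMap A κ b ≠ 0 ∧
      algebraMap A κ b • c = algebraMap A κ ∘ c' := by
  choose a b hb hab using hfrac
  refine ⟨∏ l, b (c l), fun l => a (c l) * ∏ m ∈ Finset.univ.erase l, b (c m), ?_, ?_⟩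
  · rw [map_prod]
    exact Finset.prod_ne_zero_iff.mpr fun l _ => hb _
  · ext l
    rw [Pi.smul_apply, smul_eq_mul, Function.comp_apply, map_mul, ← hab,
      ← Finset.mul_prod_erase _ _ (Finset.mem_univ l), map_mul]
    ring

/-- Exactness at `s = 0` gives a frame over `κ`. Clearing denominators only rescales its members by
nonzero scalars, after which they are reductions of sections over `A`. -/
lemma IsLinkedMatrix.exists_frame [Algebra.FormallySmooth R A] (h : IsLinkedMatrix n U D P)
    (hT : HasTangents κ n U D P) {s : κ} (hL : IsLinkedSpace n s (linEnd κ U) (linEnd κ D))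
    (hfrac : ∀ x : κ, ∃ a b : A, algebraMap A κ b ≠ 0 ∧ algebraMap A κ b * x = algebraMap A κ a)
    (h2 : 2 ≤ M) (hM : M ≤ 2 * n) :
    ∃ (idx : Fin r → ℕ) (c : Fin r → Fin r → A), (∀ k, idx k < n) ∧
      (∀ k, s = 0 ∨ ∃ j, j < n ∧ (idx k + 1) + (j + 1) = M) ∧
      ∀ j, j < n → LinearIndependent κ fun k => trans (linEnd κ U) (linEnd κ D) (idx k) j
        (algebraMap A κ ∘ (P (idx k)).mulVec (c k)) := by
  obtain ⟨idx, e, hidx, he, hs, hli⟩ := hL.exists_frame (h.isLinkedSubspace (κ := κ)) h2 hM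
    fun hs => h.exact hT hs hL
  choose c hc using he
  choose b c' hb hbc using fun k => exists_common_denominator hfrac (c k)
  refine ⟨idx, c', hidx, hs, fun j hj => ?_⟩
  have := (hli j hj).units_smul fun k => Units.mk0 _ (hb k)
  refine Eq.subst (motive := fun f => LinearIndependent κ f) (funext fun k => ?_) this
  symm
  rw [Pi.smul_apply', Units.smul_mk0, ← map_smul, ← hc, comp_mulVec, ← hbc,
    Matrix.mulVecLin_apply, Matrix.mulVec_smul]

end LocalModel

/-! ### Matrices of a linked alternating form. -/

section MatrixForm
variable {R : Type*} [CommRing R] {n d M : ℕ}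

/-- The matrices of a linked alternating form. -/
structure IsMatrixForm (n M : ℕ) (s : R) (U D : ℕ → Matrix (Fin d) (Fin d) R)
    (B : ℕ → ℕ → Matrix (Fin d) (Fin d) R) : Prop where
  up_left : ∀ i j, i + 1 < n → j < n → (U i).transpose * B (i + 1) j =
    s ^ (if M < (i + 1 + 1) + (j + 1) then 1 else 0) • B i j
  up_right : ∀ i j, i < n → j + 1 < n → B i (j + 1) * U j =
    s ^ (if M < (i + 1) + (j + 1 + 1) then 1 else 0) • B i j
  down_left : ∀ i j, i + 1 < n → j < n → (D i).transpose * B i j =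
    s ^ (if (i + 1) + (j + 1) < M then 1 else 0) • B (i + 1) j
  down_right : ∀ i j, i < n → j + 1 < n → B i j * D j =
    s ^ (if (i + 1) + (j + 1) < M then 1 else 0) • B i (j + 1)
  diag : ∀ i, i < n → ∀ k, B i i k k = 0
  antisymm : ∀ i j, i < n → j < n → (B i j).transpose = - B j i

variable {s : R} {U D : ℕ → Matrix (Fin d) (Fin d) R} {B : ℕ → ℕ → Matrix (Fin d) (Fin d) R}

/-- The terms for `(k, l)` and `(l, k)` cancel and the diagonal terms vanish. The separate
hypothesis on the diagonal avoids dividing by `2`. -/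
lemma dotProduct_mulVec_self_eq_zero {X : Type*} [CommRing X] (N : Matrix (Fin d) (Fin d) X)
    (hdiag : ∀ k, N k k = 0) (hanti : N.transpose = -N) (x : Fin d → X) : x ⬝ᵥ N.mulVec x = 0 := by
  have hN : ∀ k l, N l k = - N k l := fun k l => congrFun (congrFun hanti k) l
  simp only [dotProduct, Matrix.mulVec, Finset.mul_sum]
  rw [← Finset.univ.sum_product' Finset.univ fun k l => x k * (N k l * x l)]
  refine Finset.sum_involution (fun p _ => p.swap) ?_ ?_ (fun _ _ => Finset.mem_univ _)
    (fun _ _ => Prod.swap_swap _)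
  · rintro ⟨k, l⟩ -
    simp only [Prod.swap_prod_mk]
    rw [hN k l]
    ring
  · rintro ⟨k, l⟩ - hne heq
    obtain rfl : l = k := congrArg Prod.fst heq
    exact hne (by simp [hdiag])

lemma matPairing_of_mul_left (X : Type*) [CommRing X] [Algebra R X] {i i' j : ℕ}
    {N : ℕ → Matrix (Fin d) (Fin d) R} {k ε : ℕ} (h : (N k).transpose * B i j = s ^ ε • B i' j)
    (x y : Fin d → X) :
    matPairing X B i j (linEnd X N k x) y = algebraMap R X s ^ ε * matPairing X B i' j x y := by
  have h' : ((N k).map (algebraMap R X)).transpose * (B i j).map (algebraMap R X) =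
      algebraMap R X s ^ ε • (B i' j).map (algebraMap R X) := by
    rw [← Matrix.transpose_map, ← Matrix.map_mul, h, ← map_pow]
    ext
    simp
  rw [matPairing_apply, matPairing_apply, linEnd_apply, ← Matrix.vecMul_transpose,
    ← Matrix.dotProduct_mulVec, Matrix.mulVec_mulVec, h', Matrix.smul_mulVec, dotProduct_smul,
    smul_eq_mul]

lemma matPairing_of_mul_right (X : Type*) [CommRing X] [Algebra R X] {i j j' : ℕ}
    {N : ℕ → Matrix (Fin d) (Fin d) R} {k ε : ℕ} (h : B i j * N k = s ^ ε • B i j')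
    (x y : Fin d → X) :
    matPairing X B i j x (linEnd X N k y) = algebraMap R X s ^ ε * matPairing X B i j' x y := by
  have h' : (B i j).map (algebraMap R X) * (N k).map (algebraMap R X) =
      algebraMap R X s ^ ε • (B i j').map (algebraMap R X) := by
    rw [← Matrix.map_mul, h, ← map_pow]
    ext
    simp
  rw [matPairing_apply, matPairing_apply, linEnd_apply, Matrix.mulVec_mulVec, h',
    Matrix.smul_mulVec, dotProduct_smul, smul_eq_mul]

lemma IsMatrixForm.isLinkedPairing (h : IsMatrixForm n M s U D B) (X : Type*) [CommRing X]
    [Algebra R X] :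
    IsLinkedPairing n M (algebraMap R X s) (linEnd X U) (linEnd X D) (matPairing X B) where
  up_left i j hi hj := matPairing_of_mul_left X (h.up_left i j hi hj)
  up_right i j hi hj := matPairing_of_mul_right X (h.up_right i j hi hj)
  down_left i j hi hj := matPairing_of_mul_left X (h.down_left i j hi hj)
  down_right i j hi hj := matPairing_of_mul_right X (h.down_right i j hi hj)
  self_eq_zero i hi x := by
    rw [matPairing_apply]
    refine dotProduct_mulVec_self_eq_zero _ (fun k => ?_) ?_ x
    · rw [Matrix.map_apply, h.diag i hi, map_zero]
    · rw [← Matrix.transpose_map, h.antisymm i i hi hi]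
      ext
      simp
  antisymm i j hi hj _ x y := by
    rw [matPairing_apply, matPairing_apply, Matrix.dotProduct_mulVec, ← Matrix.mulVec_transpose,
      ← Matrix.transpose_map, h.antisymm i j hi hj, dotProduct_comm, ← dotProduct_neg,
      ← Matrix.neg_mulVec]
    congr 2
    ext
    simp

end MatrixForm

/-! ### Generators of the isotropic ideal and their differentials. -/

section LocalModel
variable {R A κ : Type*} [CommRing R] [CommRing A] [Algebra R A] [Field κ] [Algebra R κ]
  [Algebra A κ] [IsScalarTower R A κ] {n d r M : ℕ} {s : R}
  {U D : ℕ → Matrix (Fin d) (Fin d) R} {B : ℕ → ℕ → Matrix (Fin d) (Fin d) R}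
  {P : ℕ → Matrix (Fin d) (Fin r) A}

/-- The matrices of the pairings restricted to a linked subbundle. -/
def restrictedGram (B : ℕ → ℕ → Matrix (Fin d) (Fin d) R) (P : ℕ → Matrix (Fin d) (Fin r) A)
    (i j : ℕ) : Matrix (Fin r) (Fin r) A :=
  (P i).transpose * (B i j).map (algebraMap R A) * P j

/-- The ideal of the isotropic locus of a linked subbundle. -/
def isotropicIdeal (n : ℕ) (B : ℕ → ℕ → Matrix (Fin d) (Fin d) R)
    (P : ℕ → Matrix (Fin d) (Fin r) A) : Ideal A :=
  Ideal.span {a | ∃ i j, i < n ∧ j < n ∧ ∃ k l, a = restrictedGram B P i j k l}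

lemma restrictedGram_mem {i j : ℕ} (hi : i < n) (hj : j < n) (k l : Fin r) :
    restrictedGram B P i j k l ∈ isotropicIdeal n B P :=
  Ideal.subset_span ⟨i, j, hi, hj, k, l, rfl⟩

lemma matPairing_mulVec (i j : ℕ) (c c' : Fin r → A) :
    matPairing A B i j ((P i).mulVec c) ((P j).mulVec c') =
      c ⬝ᵥ (restrictedGram B P i j).mulVec c' := by
  rw [matPairing_apply, restrictedGram, ← Matrix.vecMul_transpose, ← Matrix.dotProduct_mulVec,
    Matrix.mulVec_mulVec, Matrix.mulVec_mulVec, Matrix.mul_assoc]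

lemma dotProduct_mulVec_mem {I : Ideal A} {N : Matrix (Fin r) (Fin r) A} (h : ∀ k l, N k l ∈ I)
    (c c' : Fin r → A) : c ⬝ᵥ N.mulVec c' ∈ I :=
  Submodule.sum_mem _ fun k _ => I.mul_mem_left _ (show ∑ l, N k l * c' l ∈ I from
    Submodule.sum_mem _ fun l _ => I.mul_mem_right _ (h k l))

lemma mul_apply_mem {I : Ideal A} {N : Matrix (Fin r) (Fin r) A} (h : ∀ k l, N k l ∈ I)
    (X Y : Matrix (Fin r) (Fin r) A) (k l : Fin r) : (X * N * Y) k l ∈ I := by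
  rw [Matrix.mul_apply]
  refine Submodule.sum_mem _ fun m _ => I.mul_mem_right _ ?_
  rw [Matrix.mul_apply]
  exact Submodule.sum_mem _ fun m' _ => I.mul_mem_left _ (h _ _)

lemma IsLinkedMatrix.exists_trans_eq_mulVec (h : IsLinkedMatrix n U D P) {i j : ℕ} (hi : i < n)
    (hj : j < n) (c : Fin r → A) :
    ∃ c', trans (linEnd A U) (linEnd A D) i j ((P i).mulVec c) = (P j).mulVec c' := by
  refine trans_induction (linEnd A U) (linEnd A D) hi (p := fun j z => ∃ c', z = (P j).mulVec c')
    ⟨c, rfl⟩ ?_ ?_ hj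
  · rintro j hj - ⟨c', hc'⟩
    obtain ⟨t, ht⟩ := h.up j hj
    exact ⟨t.mulVec c', by
      rw [hc', linEnd_apply, Matrix.mulVec_mulVec, ht, Matrix.mulVec_mulVec]⟩
  · rintro j hj - ⟨c', hc'⟩
    obtain ⟨t, ht⟩ := h.down j hj
    exact ⟨t.mulVec c', by
      rw [hc', linEnd_apply, Matrix.mulVec_mulVec, ht, Matrix.mulVec_mulVec]⟩

lemma algebraMap_linEnd (N : ℕ → Matrix (Fin d) (Fin d) R) (j : ℕ) (x : Fin d → A) :
    algebraMap A κ ∘ linEnd A N j x = linEnd κ N j (algebraMap A κ ∘ x) := by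
  rw [linEnd_apply, linEnd_apply, comp_mulVec, map_map_algebraMap]

lemma algebraMap_trans {i j : ℕ} (x : Fin d → A) (hi : i < n) (hj : j < n) :
    algebraMap A κ ∘ trans (linEnd A U) (linEnd A D) i j x =
      trans (linEnd κ U) (linEnd κ D) i j (algebraMap A κ ∘ x) :=
  map_trans _ _ _ _ (n := n) (fun x => algebraMap A κ ∘ x) (fun j _ x => algebraMap_linEnd U j x)
    (fun j _ x => algebraMap_linEnd D j x) hi hj x

/-- Up to a function invertible at the given point, the ideal of the isotropic locus is generated
by the pairings between the members of an adapted frame. -/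
lemma IsLinkedMatrix.exists_mul_mem (h : IsLinkedMatrix n U D P) (hB : IsMatrixForm n M s U D B)
    {idx : Fin r → ℕ} {c : Fin r → Fin r → A} (hidx : ∀ k, idx k < n)
    (hli : ∀ j, j < n → LinearIndependent κ fun k => trans (linEnd κ U) (linEnd κ D) (idx k) j
        (algebraMap A κ ∘ (P (idx k)).mulVec (c k))) {I : Ideal A}
    (hI : ∀ k l, matPairing A B (idx k) (idx l) ((P (idx k)).mulVec (c k))
      ((P (idx l)).mulVec (c l)) ∈ I) :
    ∃ a : A, algebraMap A κ a ≠ 0 ∧ ∀ x ∈ isotropicIdeal n B P, a * x ∈ I := by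
  -- `N j` expresses the frame transported to `j` in terms of the columns of `P j`. Its determinant
  -- does not vanish at the point because the transported frame is independent there.
  have hN : ∀ j, ∃ N : Matrix (Fin r) (Fin r) A, j < n → (algebraMap A κ N.det ≠ 0 ∧
      ∀ k, trans (linEnd A U) (linEnd A D) (idx k) j ((P (idx k)).mulVec (c k)) =
        (P j).mulVec (N.col k)) := fun j => by
    by_cases hj : j < n
    · choose c' hc' using fun k => h.exists_trans_eq_mulVec (hidx k) hj (c k)
      refine ⟨Matrix.of fun l k => c' k l, fun _ => ⟨?_, fun k => hc' k⟩⟩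
      have h1 : LinearIndependent κ ((Matrix.of fun l k => c' k l).map (algebraMap A κ)).col := by
        refine LinearIndependent.of_comp ((P j).map (algebraMap A κ)).mulVecLin ?_
        have := hli j hj
        refine Eq.subst (motive := fun f => LinearIndependent κ f) (funext fun k => ?_) this
        rw [← algebraMap_trans _ (hidx k) hj, hc', comp_mulVec]
        rfl
      rw [Matrix.linearIndependent_cols_iff_isUnit, Matrix.isUnit_iff_isUnit_det] at h1
      have h2 := h1.ne_zero
      rwa [← RingHom.mapMatrix_apply, ← RingHom.map_det] at h2
    · exact ⟨1, fun h => absurd h hj⟩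
  choose N hN using hN
  -- Two copies of the product are used because the entries at `(i, j)` need `det (N i) * det (N
  -- j)`, also when `i = j`.
  refine ⟨(∏ j ∈ Finset.range n, (N j).det) * ∏ j ∈ Finset.range n, (N j).det, ?_, ?_⟩
  · rw [map_mul, ← pow_two, map_prod]
    exact pow_ne_zero 2 (Finset.prod_ne_zero_iff.mpr fun j hj =>
      (hN j (Finset.mem_range.mp hj)).1)
  · intro x hx
    suffices isotropicIdeal n B P ≤ Submodule.comap (LinearMap.mulLeft A
      ((∏ j ∈ Finset.range n, (N j).det) * ∏ j ∈ Finset.range n, (N j).det)) I from this hx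
    refine Ideal.span_le.mpr ?_
    rintro _ ⟨i, j, hi, hj, k, l, rfl⟩
    obtain ⟨p, hp⟩ := Finset.dvd_prod_of_mem (fun j => (N j).det) (Finset.mem_range.mpr hi)
    obtain ⟨q, hq⟩ := Finset.dvd_prod_of_mem (fun j => (N j).det) (Finset.mem_range.mpr hj)
    have h1 : ∀ k l, ((N i).transpose * restrictedGram B P i j * N j) k l ∈ I := fun k l => by
      obtain ⟨m, hm⟩ := (hB.isLinkedPairing A).exists_trans_trans (hidx k) hi (hidx l) hj
        ((P (idx k)).mulVec (c k)) ((P (idx l)).mulVec (c l))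
      rw [(hN i hi).2, (hN j hj).2, matPairing_mulVec] at hm
      have h2 : ((N i).transpose * restrictedGram B P i j * N j) k l =
          (N i).col k ⬝ᵥ (restrictedGram B P i j).mulVec ((N j).col l) := by
        rw [Matrix.mul_assoc]
        rfl
      rw [h2, hm]
      exact I.mul_mem_left _ (hI k l)
    have h3 := mul_apply_mem h1 (N i).transpose.adjugate (N j).adjugate k l
    -- Adjugates undo the change of basis up to the two determinants, without inverting anything in
    -- `A`.
    have h4 : (N i).transpose.adjugate * ((N i).transpose * restrictedGram B P i j * N j) *
        (N j).adjugate = ((N i).det * (N j).det) • restrictedGram B P i j := by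
      rw [Matrix.mul_assoc, Matrix.mul_assoc, Matrix.mul_assoc, Matrix.mul_adjugate,
        ← Matrix.mul_assoc, Matrix.adjugate_mul, Matrix.det_transpose]
      simp [smul_smul, mul_comm]
    rw [h4, Matrix.smul_apply, smul_eq_mul] at h3
    have h5 : (∏ j ∈ Finset.range n, (N j).det) * (∏ j ∈ Finset.range n, (N j).det) *
        restrictedGram B P i j k l =
          p * q * ((N i).det * (N j).det * restrictedGram B P i j k l) := by
      conv_lhs =>
        congr
        congr
        · rw [hp]
        · rw [hq]
      ring
    have h6 := I.mul_mem_left (p * q) h3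
    rw [← h5] at h6
    exact h6

/-- The index set of the pairs of members of a frame. -/
abbrev Pairs (r : ℕ) : Type := {p : Fin r × Fin r // p.1 < p.2}

/-- The functions defining the isotropic locus are independent to first order. -/
lemma IsLinkedMatrix.eq_zero_of_derivation (h : IsLinkedMatrix n U D P)
    (hT : HasTangents κ n U D P)
    (hL : IsLinkedSpace n (algebraMap R κ s) (linEnd κ U) (linEnd κ D))
    (hS : IsSymplecticPairing n M (algebraMap R κ s) (linEnd κ U) (linEnd κ D) (matPairing κ B))
    (hiso : ∀ x ∈ isotropicIdeal n B P, algebraMap A κ x = 0)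
    {idx : Fin r → ℕ} {c : Fin r → Fin r → A} (hidx : ∀ k, idx k < n)
    (hs : ∀ k, algebraMap R κ s = 0 ∨ ∃ j, j < n ∧ (idx k + 1) + (j + 1) = M)
    (hli : ∀ j, j < n → LinearIndependent κ fun k => trans (linEnd κ U) (linEnd κ D) (idx k) j
        (algebraMap A κ ∘ (P (idx k)).mulVec (c k))) (a : Pairs r → κ)
    (ha : ∀ δ : Derivation R A κ, ∑ p : Pairs r, a p * δ (matPairing A B (idx p.1.1) (idx p.1.2)
      ((P (idx p.1.1)).mulVec (c p.1.1)) ((P (idx p.1.2)).mulVec (c p.1.2))) = 0) : a = 0 := by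
  have hF := h.isLinkedSubspace (κ := κ)
  set e : Fin r → Fin d → κ := fun k => algebraMap A κ ∘ (P (idx k)).mulVec (c k) with he
  have heF : ∀ k, e k ∈ columnSpan κ P (idx k) := fun k => ⟨algebraMap A κ ∘ c k, by
    rw [Matrix.mulVecLin_apply]
    exact (comp_mulVec (algebraMap A κ) _ _).symm⟩
  have hiso' : ∀ i j, i < n → j < n → ∀ x ∈ columnSpan κ P i, ∀ y ∈ columnSpan κ P j,
      matPairing κ B i j x y = 0 := by
    rintro i j hi hj _ ⟨x, rfl⟩ _ ⟨y, rfl⟩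
    rw [matPairing_apply, Matrix.mulVecLin_apply, Matrix.mulVecLin_apply,
      ← Matrix.vecMul_transpose, ← Matrix.dotProduct_mulVec, Matrix.mulVec_mulVec,
      Matrix.mulVec_mulVec, ← map_map_algebraMap (A := A) (B i j), ← Matrix.transpose_map,
      ← Matrix.map_mul, ← Matrix.map_mul]
    have : ((P i).transpose * (B i j).map (algebraMap R A) * P j).map (algebraMap A κ) =
        (0 : Matrix (Fin r) (Fin r) κ) := by
      ext k l
      exact hiso _ (restrictedGram_mem hi hj k l)
    rw [this]
    simp
  -- Arbitrary variations `w k` of the frame vectors extend by transport to a deformation, which is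
  -- realized by a derivation.
  have hδ : ∀ w : Fin r → Fin d → κ, ∃ δ : Derivation R A κ, ∀ k l,
      δ (matPairing A B (idx k) (idx l) ((P (idx k)).mulVec (c k)) ((P (idx l)).mulVec (c l))) =
        matPairing κ B (idx k) (idx l) (w k) (e l) +
          matPairing κ B (idx k) (idx l) (e k) (w l) := fun w => by
    obtain ⟨Φ, hΦ, hΦw⟩ := hL.exists_deformation hF hidx heF hli w
    obtain ⟨δ, hδ⟩ := hT Φ hΦ
    have h1 : ∀ k, δ ∘ (P (idx k)).mulVec (c k) - w k ∈ columnSpan κ P (idx k) := fun k => by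
      have h2 := hδ (idx k) (hidx k) (algebraMap A κ ∘ c k)
      have h3 : δ ∘ (P (idx k)).mulVec (c k) = ((P (idx k)).map δ).mulVec (algebraMap A κ ∘ c k) +
          ((P (idx k)).map (algebraMap A κ)).mulVec (δ ∘ c k) := by
        ext m
        simp only [Function.comp_apply, Matrix.mulVec, dotProduct, map_sum, Derivation.leibniz,
          Algebra.smul_def, Pi.add_apply, Finset.sum_add_distrib, Matrix.map_apply]
        rw [add_comm]
        congr 1
        exact Finset.sum_congr rfl fun _ _ => mul_comm _ _
      rw [← comp_mulVec, hΦw] at h2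
      rw [h3, add_sub_right_comm]
      exact add_mem h2 (mulVec_mem_columnSpan _ _)
    refine ⟨δ, fun k l => ?_⟩
    have h4 : ∀ x y : Fin d → A, δ (matPairing A B (idx k) (idx l) x y) =
        matPairing κ B (idx k) (idx l) (δ ∘ x) (algebraMap A κ ∘ y) +
          matPairing κ B (idx k) (idx l) (algebraMap A κ ∘ x) (δ ∘ y) := fun x y => by
      simp only [matPairing_apply, dotProduct, Matrix.mulVec, map_sum, Derivation.leibniz,
        Function.comp_apply, Matrix.map_apply, Derivation.map_algebraMap, mul_zero,
        add_zero, Algebra.smul_def, Finset.sum_add_distrib, map_mul, ← IsScalarTower.algebraMap_apply]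
      rw [add_comm]
      congr 1
      exact Finset.sum_congr rfl fun _ _ => mul_comm _ _
    rw [h4]
    -- The derivative of a frame vector agrees with `w` only modulo `F`; since `F` is isotropic, the
    -- discrepancy pairs to zero with the frame.
    have e1 := hiso' _ _ (hidx k) (hidx l) _ (h1 k) _ (heF l)
    have e2 := hiso' _ _ (hidx k) (hidx l) _ (heF k) _ (h1 l)
    rw [map_sub, LinearMap.sub_apply, sub_eq_zero] at e1
    rw [map_sub, sub_eq_zero] at e2
    rw [← e1, ← e2]
  -- The coefficients are extended to a strictly upper triangular matrix; `f - fᵀ` is the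
  -- antisymmetric matrix to which the symplectic lemma applies.
  let f : Fin r → Fin r → κ := fun k l => if hkl : k < l then a ⟨(k, l), hkl⟩ else 0
  have hf : ∀ T : Fin r → Fin r → κ, ∑ k, ∑ l, (f k l - f l k) * T k l =
      ∑ p : Pairs r, a p * (T p.1.1 p.1.2 - T p.1.2 p.1.1) := fun T => by
    have h1 : ∑ k, ∑ l, f l k * T k l = ∑ k, ∑ l, f k l * T l k := Finset.sum_comm
    simp only [sub_mul, Finset.sum_sub_distrib]
    rw [h1]
    simp only [← Finset.sum_sub_distrib, ← mul_sub]
    rw [← Finset.univ.sum_product' Finset.univ fun k l => f k l * (T k l - T l k),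
      Finset.univ_product_univ, ← Finset.sum_filter_of_ne (p := fun p : Fin r × Fin r => p.1 < p.2),
      Finset.sum_subtype (Finset.univ.filter fun p : Fin r × Fin r => p.1 < p.2)
        (p := fun p => p.1 < p.2) (by simp)]
    · refine Finset.sum_congr rfl fun p _ => ?_
      simp only [f, dif_pos p.2]
    · intro p _ hp
      by_contra hlt
      exact hp (by simp only [f, dif_neg hlt, zero_mul])
  have hzero := hS.eq_zero_of_sum_eq_zero hidx hli hs (c := fun k l => f k l - f l k)
    (fun k l => by ring) fun k x => by
      -- Moving only the vector `e k`, in the direction `x`, isolates the row `k` of the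
      -- antisymmetric matrix.
      obtain ⟨δ, hδ⟩ := hδ (Pi.single k x)
      rw [← ha δ]
      have h1 := hf fun k' l => matPairing κ B (idx k') (idx l) ((Pi.single k x : Fin r → Fin d → κ) k') (e l)
      rw [Finset.sum_eq_single k] at h1
      · simp only [Pi.single_eq_same] at h1
        rw [h1]
        refine Finset.sum_congr rfl fun p _ => ?_
        rw [hδ, hS.eq_neg (hidx p.1.1) (hidx p.1.2) (e p.1.1), sub_eq_add_neg]
      · intro k' _ hk'
        refine Finset.sum_eq_zero fun l _ => ?_
        rw [Pi.single_eq_of_ne hk', map_zero, LinearMap.zero_apply, mul_zero]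
      · exact fun hk => absurd (Finset.mem_univ k) hk
  ext ⟨⟨k, l⟩, hkl⟩
  have := hzero k l
  simpa [f, show k < l from hkl, (show k < l from hkl).not_gt] using this

end LocalModel

/-! ### Jacobian criterion and heights. -/

section SmoothQuotient

open KaehlerDifferential TensorProduct

/-- A retraction splits the cotangent sequence, so `Ω[B⁄P]` is a direct summand of the projective
module `Ω[B⁄R]`. It also makes the base change map injective, so `H1Cotangent P B` is the image of
`H1Cotangent R B`, which is zero. -/
lemma formallySmooth_of_retraction (R P B : Type*) [CommRing R] [CommRing P] [CommRing B]
    [Algebra R P] [Algebra R B] [Algebra P B] [IsScalarTower R P B] [Algebra.FormallySmooth R B]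
    (l : Ω[B⁄R] →ₗ[B] B ⊗[P] Ω[P⁄R]) (hl : l ∘ₗ mapBaseChange R P B = LinearMap.id) :
    Algebra.FormallySmooth P B where
  projective_kaehlerDifferential := by
    obtain ⟨-, i, hi⟩ := (((exact_mapBaseChange_map R P B).split_tfae'.out 1 0 rfl rfl).mp
      ⟨KaehlerDifferential.map_surjective R P B, l, hl⟩)
    exact Module.Projective.of_split i _ hi
  subsingleton_h1Cotangent := by
    have hinj : Function.Injective (mapBaseChange R P B) :=
      Function.LeftInverse.injective (g := l) fun x => LinearMap.congr_fun hl x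
    refine ⟨fun x y => ?_⟩
    suffices ∀ x : Algebra.H1Cotangent P B, x = 0 by rw [this x, this y]
    intro x
    have h0 : Algebra.H1Cotangent.δ R P B x = 0 := by
      apply hinj
      rw [map_zero]
      exact (Algebra.H1Cotangent.exact_δ_mapBaseChange R P B).apply_apply_eq_zero x
    obtain ⟨y, rfl⟩ := (Algebra.H1Cotangent.exact_map_δ R P B x).mp h0
    rw [Subsingleton.elim y 0, map_zero]

/-- With `p = q ∩ R`, the kernels of the maps to polynomials over the domain `R ⧸ p` that kill more
and more variables form a strictly increasing chain of primes inside `q`. -/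
lemma card_le_height {R ι : Type*} [CommRing R] [Fintype ι] (q : Ideal (MvPolynomial ι R))
    [q.IsPrime] (h : ∀ i, MvPolynomial.X i ∈ q) : (Fintype.card ι : ℕ∞) ≤ q.height := by
  classical
  let p : Ideal R := q.comap MvPolynomial.C
  have : p.IsPrime := Ideal.comap_isPrime _ _
  let e := Fintype.equivFin ι
  let φ (k : ℕ) : MvPolynomial ι R →+* MvPolynomial ι (R ⧸ p) :=
    MvPolynomial.eval₂Hom (MvPolynomial.C.comp (Ideal.Quotient.mk p))
      fun i => if (e i).val < k then 0 else MvPolynomial.X i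
  have hle : ∀ k, k ≤ Fintype.card ι → (k : ℕ∞) ≤ (RingHom.ker (φ k)).height := by
    intro k
    induction k with
    | zero => simp
    | succ k ih =>
      intro hk
      have hlt : RingHom.ker (φ k) < RingHom.ker (φ (k + 1)) := by
        refine lt_of_le_of_ne ?_ fun heq => ?_
        · let σ : MvPolynomial ι (R ⧸ p) →+* MvPolynomial ι (R ⧸ p) :=
            MvPolynomial.eval₂Hom MvPolynomial.C
              fun i => if (e i).val < k + 1 then 0 else MvPolynomial.X i
          have : φ (k + 1) = σ.comp (φ k) := by
            refine MvPolynomial.ringHom_ext (fun a => by simp [φ, σ]) fun i => ?_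
            by_cases hi : (e i).val < k
            · simp [φ, σ, hi, hi.le]
            · simp [φ, σ, hi]
          intro x hx
          rw [RingHom.mem_ker] at hx ⊢
          rw [this, RingHom.comp_apply, hx, map_zero]
        · have h1 : MvPolynomial.X (e.symm ⟨k, hk⟩) ∈ RingHom.ker (φ (k + 1)) := by
            simp [φ]
          rw [← heq] at h1
          simp [φ] at h1
      have := RingHom.ker_isPrime (φ k)
      have := RingHom.ker_isPrime (φ (k + 1))
      push_cast
      exact (add_le_add (ih (by omega)) le_rfl).trans
        (Ideal.height_add_one_le_of_lt_of_isPrime hlt)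
  refine (hle _ le_rfl).trans (Ideal.height_mono fun x hx => ?_)
  have hX : Ideal.span (Set.range (MvPolynomial.X : ι → MvPolynomial ι R)) ≤ q := by
    rw [Ideal.span_le]
    rintro _ ⟨i, rfl⟩
    exact h i
  have hx0 : MvPolynomial.constantCoeff x ∈ p := by
    have : (MvPolynomial.constantCoeff).comp (φ (Fintype.card ι)) =
        (Ideal.Quotient.mk p).comp MvPolynomial.constantCoeff := by
      refine MvPolynomial.ringHom_ext (fun a => by simp [φ]) fun i => by simp [φ]
    rw [← Ideal.Quotient.eq_zero_iff_mem, ← RingHom.comp_apply, ← this, RingHom.comp_apply,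
      RingHom.mem_ker.mp hx, map_zero]
  have h2 : x - MvPolynomial.C (MvPolynomial.constantCoeff x) ∈ q := by
    apply hX
    rw [← Set.image_univ, MvPolynomial.mem_ideal_span_X_image]
    intro m hm
    by_contra hc
    push Not at hc
    have : m = 0 := by
      ext i
      simpa using hc i
    subst this
    simp [MvPolynomial.mem_support_iff, MvPolynomial.constantCoeff_eq] at hm
  have := q.add_mem h2 hx0
  simpa using this

/-- The hypothesis says that no nonzero functional vanishes on the image of `δ ↦ (δ (f i))`, so this
map is onto `ι → κ` and hits the standard basis. -/
lemma exists_derivation_of_independent {R A κ ι : Type*} [CommRing R] [CommRing A] [Field κ]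
    [Algebra R A] [Algebra R κ] [Algebra A κ] [IsScalarTower R A κ] [Fintype ι] [DecidableEq ι]
    (f : ι → A) (hf : ∀ c : ι → κ, (∀ δ : Derivation R A κ, ∑ i, c i * δ (f i) = 0) → c = 0)
    (j : ι) : ∃ δ : Derivation R A κ, ∀ i, δ (f i) = (1 : Matrix ι ι κ) j i := by
  let T : Derivation R A κ →ₗ[κ] (ι → κ) :=
    { toFun := fun δ i => δ (f i)
      map_add' := fun _ _ => rfl
      map_smul' := fun _ _ => rfl }
  have hT : LinearMap.range T = ⊤ := by
    by_contra hne
    obtain ⟨g, hg0, hg⟩ := Submodule.exists_le_ker_of_lt_top _ (lt_top_iff_ne_top.mpr hne)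
    apply hg0
    have hc := hf (fun i => g (Pi.single i 1)) fun δ => by
      have h1 : g (T δ) = 0 := hg ⟨δ, rfl⟩
      rw [LinearMap.pi_apply_eq_sum_univ g] at h1
      rw [← h1]
      refine Finset.sum_congr rfl fun i _ => ?_
      rw [smul_eq_mul, mul_comm]
      congr 2
      ext k
      simp [Pi.single_apply, eq_comm]
    refine LinearMap.pi_ext' fun i => LinearMap.ext_ring ?_
    simpa using congrFun hc i
  obtain ⟨δ, hδ⟩ := LinearMap.range_eq_top.mp hT ((1 : Matrix ι ι κ) j)
  exact ⟨δ, fun i => congrFun hδ i⟩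

/-- The derivations dual to the `f i` lift to functionals on the projective module `Ω[B⁄R]`. Their
matrix on the `d (f i)` reduces to the identity over `κ`, hence is invertible over the local ring
`B`, and its inverse yields a retraction of `B ⊗ Ω[R[X]⁄R] → Ω[B⁄R]`. -/
lemma formallySmooth_mvPolynomial {R A B κ ι : Type*} [CommRing R] [CommRing A] [CommRing B]
    [Field κ] [Algebra R A] [Algebra R B] [Algebra A B] [IsScalarTower R A B] [Algebra R κ]
    [Algebra A κ] [Algebra B κ] [IsScalarTower R A κ] [IsScalarTower A B κ]
    [Fintype ι] [DecidableEq ι]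
    [Algebra (MvPolynomial ι R) B] [IsScalarTower R (MvPolynomial ι R) B] [IsLocalRing B]
    [Algebra.FormallyEtale A B] [Algebra.FormallySmooth R B]
    (hκ : Function.Surjective (algebraMap B κ)) (f : ι → A)
    (hf : ∀ i, algebraMap (MvPolynomial ι R) B (MvPolynomial.X i) = algebraMap A B (f i))
    (hδ : ∀ j, ∃ δ : Derivation R A κ, ∀ i, δ (f i) = (1 : Matrix ι ι κ) j i) :
    Algebra.FormallySmooth (MvPolynomial ι R) B := by
  choose δ hδ using hδ
  have hψ : ∀ j, ∃ ψ : Ω[B⁄R] →ₗ[B] B, ∀ i, algebraMap B κ (ψ (D R B (algebraMap A B (f i)))) =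
      (1 : Matrix ι ι κ) j i := by
    intro j
    let χ : Ω[B⁄R] →ₗ[B] κ := (LinearMap.liftBaseChange B (δ j).liftKaehlerDifferential) ∘ₗ
      (tensorKaehlerEquivOfFormallyEtale R A B).symm.toLinearMap
    obtain ⟨ψ, hψ⟩ := Module.projective_lifting_property (Algebra.linearMap B κ) χ hκ
    refine ⟨ψ, fun i => ?_⟩
    have := LinearMap.congr_fun hψ (D R B (algebraMap A B (f i)))
    simp only [LinearMap.comp_apply, Algebra.linearMap_apply] at this
    rw [this]
    simp [χ, hδ, tensorKaehlerEquivOfFormallyEtale_symm_D_algebraMap]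
  choose ψ hψ using hψ
  let M : Matrix ι ι B := .of fun j i => ψ j (D R B (algebraMap A B (f i)))
  have hM : M.map (algebraMap B κ) = 1 := by
    ext j i
    exact hψ j i
  have hdet : IsUnit M.det := by
    by_contra hn
    have h1 : algebraMap B κ M.det = 1 := by
      rw [RingHom.map_det, RingHom.mapMatrix_apply, hM, Matrix.det_one]
    have h2 : RingHom.ker (algebraMap B κ) = IsLocalRing.maximalIdeal B :=
      IsLocalRing.eq_maximalIdeal (RingHom.ker_isMaximal_of_surjective _ hκ)
    have h3 : M.det ∈ IsLocalRing.maximalIdeal B := hn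
    rw [← h2, RingHom.mem_ker, h1] at h3
    exact one_ne_zero h3
  let b := (mvPolynomialBasis R ι).baseChange B
  let l : Ω[B⁄R] →ₗ[B] B ⊗[MvPolynomial ι R] Ω[MvPolynomial ι R⁄R] :=
    (Fintype.linearCombination B b) ∘ₗ M⁻¹.mulVecLin ∘ₗ LinearMap.pi ψ
  refine formallySmooth_of_retraction R (MvPolynomial ι R) B l (b.ext fun i => ?_)
  have h1 : mapBaseChange R (MvPolynomial ι R) B (b i) = D R B (algebraMap A B (f i)) := by
    simp [b, mvPolynomialBasis_apply, hf]
  have h2 : (LinearMap.pi ψ) (D R B (algebraMap A B (f i))) = M.mulVec (Pi.single i 1) := by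
    ext j
    simp [M]
  simp only [LinearMap.comp_apply, h1, l, h2, Matrix.mulVecLin_apply, Matrix.mulVec_mulVec,
    Matrix.nonsing_inv_mul _ hdet, Matrix.one_mulVec, LinearMap.id_apply,
    Fintype.linearCombination_apply]
  simp [Pi.single_apply]

/-- Smoothness at the prime `𝔭` spreads out to a basic open set. The set is shrunk further so that
`h` divides `g`, that is, so that the `f i` generate the ideal of interest there. -/
lemma exists_smooth_mvPolynomial {R A κ : Type u} {ι : Type*} [CommRing R] [CommRing A] [Field κ]
    [Algebra R A] [Algebra A κ] [Algebra R κ] [IsScalarTower R A κ] [Algebra.Smooth R A]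
    [Algebra (MvPolynomial ι R) A] [IsScalarTower R (MvPolynomial ι R) A] (𝔭 : Ideal A)
    [𝔭.IsPrime] (hker : RingHom.ker (algebraMap A κ) = 𝔭)
    (hfrac : ∀ x : κ, ∃ a b : A, algebraMap A κ b ≠ 0 ∧ algebraMap A κ b * x = algebraMap A κ a)
    [Fintype ι] (f : ι → A)
    (hf : ∀ i, algebraMap (MvPolynomial ι R) A (MvPolynomial.X i) = f i)
    (hind : ∀ c : ι → κ, (∀ δ : Derivation R A κ, ∑ i, c i * δ (f i) = 0) → c = 0)
    (h : A) (hh : h ∉ 𝔭) :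
    ∃ g ∉ 𝔭, h ∣ g ∧ Algebra.Smooth (MvPolynomial ι R) (Localization.Away g) := by
  classical
  have : Algebra.FinitePresentation (MvPolynomial ι R) A :=
    Algebra.FinitePresentation.of_restrict_scalars_finitePresentation R _ A
  have : Algebra.FormallyEtale A (Localization.AtPrime 𝔭) :=
    Algebra.FormallyEtale.of_isLocalization 𝔭.primeCompl
  have : Algebra.FormallySmooth R (Localization.AtPrime 𝔭) := .comp R A _
  have hne : ∀ b, b ∉ 𝔭 ↔ algebraMap A κ b ≠ 0 := fun b => by rw [← hker, RingHom.mem_ker]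
  let θ : Localization.AtPrime 𝔭 →ₐ[A] κ := IsLocalization.liftAlgHom (M := 𝔭.primeCompl)
    (f := Algebra.ofId A κ) fun y => isUnit_iff_ne_zero.mpr ((hne y).mp y.2)
  let : Algebra (Localization.AtPrime 𝔭) κ := θ.toRingHom.toAlgebra
  have : IsScalarTower A (Localization.AtPrime 𝔭) κ :=
    .of_algebraMap_eq' θ.comp_algebraMap.symm
  have hθ : Function.Surjective (algebraMap (Localization.AtPrime 𝔭) κ) := by
    intro x
    obtain ⟨a, b, hb, hx⟩ := hfrac x
    have hb' : b ∈ 𝔭.primeCompl := (hne b).mpr hb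
    refine ⟨IsLocalization.mk' _ a (⟨b, hb'⟩ : 𝔭.primeCompl), mul_left_cancel₀ hb ?_⟩
    have h1 := congrArg (algebraMap (Localization.AtPrime 𝔭) κ)
      (IsLocalization.mk'_spec (Localization.AtPrime 𝔭) a (⟨b, hb'⟩ : 𝔭.primeCompl))
    rw [map_mul, ← IsScalarTower.algebraMap_apply, ← IsScalarTower.algebraMap_apply] at h1
    rw [hx, mul_comm, h1]
  have : Algebra.IsSmoothAt (MvPolynomial ι R) 𝔭 :=
    formallySmooth_mvPolynomial (A := A) (B := Localization.AtPrime 𝔭) (R := R) hθ f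
      (fun i => by rw [IsScalarTower.algebraMap_apply (MvPolynomial ι R) A, hf])
      (exists_derivation_of_independent f hind)
  obtain ⟨g, hg, hs⟩ := Algebra.IsSmoothAt.exists_notMem_smooth (MvPolynomial ι R) 𝔭
  refine ⟨g * h, ?_, dvd_mul_left _ _, ?_⟩
  · exact fun hgh => (Ideal.IsPrime.mem_or_mem ‹_› hgh).elim hg hh
  · rw [← Algebra.basicOpen_subset_smoothLocus_iff_smooth] at hs ⊢
    exact subset_trans (PrimeSpectrum.basicOpen_mul_le_left g h) hs

/-- Setting all variables to zero turns the base `R[X]` into `R` and the algebra `A_g` into `A_g /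
(f) ≅ C'`; smoothness is stable under base change. By `hJ` the kernel of `A → C` is generated by the
`f i` after inverting `g`. -/
lemma smooth_of_smooth_mvPolynomial {R A C C' : Type u} {ι : Type*} [CommRing R] [CommRing A] [CommRing C]
    [CommRing C'] [Algebra R A] [Algebra A C] [Algebra C C'] [Algebra R C'] [Algebra A C']
    [IsScalarTower A C C'] [IsScalarTower R A C'] [Algebra (MvPolynomial ι R) A]
    [IsScalarTower R (MvPolynomial ι R) A] (f : ι → A)
    (hf : ∀ i, algebraMap (MvPolynomial ι R) A (MvPolynomial.X i) = f i) (g : A)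
    [IsLocalization.Away (algebraMap A C g) C']
    [Algebra.Smooth (MvPolynomial ι R) (Localization.Away g)]
    (hsurj : Function.Surjective (algebraMap A C)) (hfJ : ∀ i, algebraMap A C (f i) = 0)
    (hJ : ∀ a, algebraMap A C a = 0 → g * a ∈ Ideal.span (Set.range f)) :
    Algebra.Smooth R C' := by
  let I : Ideal (MvPolynomial ι R) := Ideal.span (Set.range MvPolynomial.X)
  have hI : Ideal.map (algebraMap (MvPolynomial ι R) (Localization.Away g)) I =
      (Ideal.span (Set.range f)).map (algebraMap A (Localization.Away g)) := by
    simp only [I, Ideal.map_span, ← Set.range_comp]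
    congr 2
    ext i
    simp [IsScalarTower.algebraMap_apply (MvPolynomial ι R) A (Localization.Away g), hf]
  have hu : IsUnit (algebraMap A C' g) := by
    rw [IsScalarTower.algebraMap_apply A C C']
    exact IsLocalization.Away.algebraMap_isUnit _
  let θ : Localization.Away g →ₐ[A] C' := IsLocalization.liftAlgHom (M := Submonoid.powers g)
    (f := Algebra.ofId A C') (by rintro ⟨_, n, rfl⟩; simpa using hu.pow n)
  have hθ : Function.Surjective θ := by
    intro x
    obtain ⟨n, a, hx⟩ := IsLocalization.Away.surj (algebraMap A C g) x
    obtain ⟨a, rfl⟩ := hsurj a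
    refine ⟨IsLocalization.mk' (Localization.Away g) a (⟨g ^ n, n, rfl⟩ : Submonoid.powers g), ?_⟩
    have h1 : θ (IsLocalization.mk' (Localization.Away g) a
        (⟨g ^ n, n, rfl⟩ : Submonoid.powers g)) * algebraMap A C' (g ^ n) = algebraMap A C' a := by
      rw [← θ.commutes, ← map_mul, IsLocalization.mk'_spec, θ.commutes]
    apply (hu.pow n).mul_right_cancel
    rw [map_pow] at h1
    rw [h1, IsScalarTower.algebraMap_apply A C C', IsScalarTower.algebraMap_apply A C C', ← hx]
  have hker : RingHom.ker θ.toRingHom = Ideal.map (algebraMap _ (Localization.Away g)) I := by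
    rw [hI]
    apply le_antisymm
    · intro x hx
      obtain ⟨a, ⟨_, n, rfl⟩, rfl⟩ := IsLocalization.exists_mk'_eq (Submonoid.powers g) x
      rw [IsLocalization.mk'_mem_map_algebraMap_iff]
      have h1 : algebraMap A C' a = 0 := by
        rw [← θ.commutes, ← IsLocalization.mk'_spec (Localization.Away g) a
          (⟨g ^ n, n, rfl⟩ : Submonoid.powers g), map_mul]
        exact mul_eq_zero_of_left hx _
      rw [IsScalarTower.algebraMap_apply A C C',
        IsLocalization.map_eq_zero_iff (Submonoid.powers (algebraMap A C g))] at h1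
      obtain ⟨⟨_, k, rfl⟩, hk⟩ := h1
      refine ⟨g ^ (k + 1), ⟨k + 1, rfl⟩, ?_⟩
      rw [pow_succ', mul_assoc]
      apply hJ
      simpa using hk
    · rw [Ideal.map_le_iff_le_comap, Ideal.span_le]
      rintro _ ⟨i, rfl⟩
      change θ (algebraMap A _ (f i)) = 0
      rw [θ.commutes, IsScalarTower.algebraMap_apply A C C', hfJ, map_zero]
  have h1 : Algebra.Smooth (MvPolynomial ι R ⧸ I)
      (Localization.Away g ⧸ I.map (algebraMap (MvPolynomial ι R) (Localization.Away g))) :=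
    .of_equiv (A := (MvPolynomial ι R ⧸ I) ⊗[MvPolynomial ι R] Localization.Away g)
      (Algebra.TensorProduct.quotIdealMapEquivQuotTensor (Localization.Away g) I).symm
  have hbij : Function.Bijective (Algebra.ofId R (MvPolynomial ι R ⧸ I)) := by
    have hI0 : ∀ x ∈ I, MvPolynomial.constantCoeff x = 0 := by
      intro x hx
      have : I ≤ RingHom.ker (MvPolynomial.constantCoeff (R := R) (σ := ι)) := by
        rw [Ideal.span_le]
        rintro _ ⟨i, rfl⟩
        simp
      exact this hx
    refine ⟨fun a b hab => ?_, fun x => ?_⟩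
    · have := hI0 _ (Ideal.Quotient.eq.mp hab)
      simpa [sub_eq_zero] using this
    · obtain ⟨x, rfl⟩ := Ideal.Quotient.mk_surjective x
      induction x using MvPolynomial.induction_on with
      | C a => exact ⟨a, rfl⟩
      | add x y hx hy =>
        obtain ⟨a, ha⟩ := hx
        obtain ⟨b, hb⟩ := hy
        exact ⟨a + b, by rw [map_add, map_add, ha, hb]⟩
      | mul_X x i _ =>
        refine ⟨0, ?_⟩
        rw [map_zero, eq_comm, Ideal.Quotient.eq_zero_iff_mem]
        exact I.mul_mem_left _ (Ideal.subset_span ⟨i, rfl⟩)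
  have h2 : Algebra.Smooth R (MvPolynomial ι R ⧸ I) := .of_equiv (AlgEquiv.ofBijective _ hbij)
  have h3 : Algebra.Smooth R
      (Localization.Away g ⧸ I.map (algebraMap (MvPolynomial ι R) (Localization.Away g))) :=
    have : IsScalarTower R (MvPolynomial ι R ⧸ I)
        (Localization.Away g ⧸ I.map (algebraMap (MvPolynomial ι R) (Localization.Away g))) :=
      IsScalarTower.of_algebraMap_eq (R := R) (S := MvPolynomial ι R ⧸ I)
        (A := Localization.Away g ⧸ I.map (algebraMap (MvPolynomial ι R) (Localization.Away g)))
        fun a => congrArg (Ideal.Quotient.mk _)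
          (IsScalarTower.algebraMap_apply R (MvPolynomial ι R) (Localization.Away g) a)
    .comp R (MvPolynomial ι R ⧸ I) _
  exact .of_equiv ((Ideal.quotientEquivAlgOfEq R hker.symm).trans
    (Ideal.quotientKerAlgEquivOfSurjective (f := θ.restrictScalars R) hθ))

/-- A smooth algebra is flat, so going down holds and the height of a prime of `A_g` is at least
that of its trace on `R[X]`, which contains all the variables. -/
lemma card_le_height_of_smooth {R A : Type u} {ι : Type*} [CommRing R] [CommRing A] [Algebra R A]
    [IsNoetherianRing R] [Fintype ι] [IsNoetherianRing A] [Algebra (MvPolynomial ι R) A]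
    (𝔮 : Ideal A) [𝔮.IsPrime] (f : ι → A)
    (hf : ∀ i, algebraMap (MvPolynomial ι R) A (MvPolynomial.X i) = f i) (hf𝔮 : ∀ i, f i ∈ 𝔮)
    (g : A) (hg : g ∉ 𝔮) [Algebra.Smooth (MvPolynomial ι R) (Localization.Away g)] :
    (Fintype.card ι : ℕ∞) ≤ 𝔮.height := by
  have hd : Disjoint (Submonoid.powers g : Set A) 𝔮 := by
    rw [Ideal.disjoint_powers_iff_notMem _ (Ideal.IsPrime.isRadical ‹_›)]
    exact hg
  let Q := 𝔮.map (algebraMap A (Localization.Away g))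
  have hQ : Q.IsPrime := IsLocalization.isPrime_of_isPrime_disjoint (Submonoid.powers g) _ 𝔮 ‹_› hd
  have hQ𝔮 : Q.comap (algebraMap A (Localization.Away g)) = 𝔮 :=
    IsLocalization.under_map_of_isPrime_disjoint (Submonoid.powers g) _ ‹_› hd
  have h1 : Q.height = 𝔮.height := by
    rw [← IsLocalization.height_under (Submonoid.powers g) Q, Ideal.under_def, hQ𝔮]
  have : IsNoetherianRing (Localization.Away g) :=
    IsLocalization.isNoetherianRing (Submonoid.powers g) _ ‹_›
  rw [← h1, Ideal.height_eq_height_add_of_liesOver_of_hasGoingDown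
    (Q.under (MvPolynomial ι R)) Q]
  refine (card_le_height _ fun i => ?_).trans le_self_add
  rw [Ideal.under_def, Ideal.mem_comap,
    IsScalarTower.algebraMap_apply (MvPolynomial ι R) A, hf]
  exact Ideal.mem_map_of_mem _ (hf𝔮 i)

theorem exists_smooth_and_height_eq {R A κ : Type u} {ι : Type*} [CommRing R] [CommRing A] [Field κ]
    [Algebra R A] [Algebra A κ] [Algebra R κ] [IsScalarTower R A κ] [Algebra.Smooth R A]
    [IsNoetherianRing R] [Fintype ι] (𝔭 : Ideal A) [𝔭.IsPrime]
    (hker : RingHom.ker (algebraMap A κ) = 𝔭)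
    (hfrac : ∀ x : κ, ∃ a b : A, algebraMap A κ b ≠ 0 ∧ algebraMap A κ b * x = algebraMap A κ a)
    (f : ι → A) (J : Ideal A) (hJ : J ≤ 𝔭) (hfJ : ∀ i, f i ∈ J)
    (hind : ∀ c : ι → κ, (∀ δ : Derivation R A κ, ∑ i, c i * δ (f i) = 0) → c = 0)
    (h : A) (hh : h ∉ 𝔭) (hhJ : ∀ a ∈ J, h * a ∈ Ideal.span (Set.range f)) :
    (∃ g ∉ 𝔭, ∀ (C C' : Type u) [CommRing C] [CommRing C'] [Algebra A C] [Algebra C C']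
      [Algebra R C'] [Algebra A C'] [IsScalarTower A C C'] [IsScalarTower R A C']
      [IsLocalization.Away (algebraMap A C g) C'],
      Function.Surjective (algebraMap A C) → RingHom.ker (algebraMap A C) = J →
        Algebra.Smooth R C') ∧
    ∀ (B : Type u) [CommRing B] [Algebra A B] [IsLocalization.AtPrime B 𝔭],
      (J.map (algebraMap A B)).height = Fintype.card ι := by
  classical
  have : IsNoetherianRing A := Algebra.FiniteType.isNoetherianRing R A
  algebraize [(MvPolynomial.aeval (R := R) f).toRingHom]
  have : IsScalarTower R (MvPolynomial ι R) A :=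
    .of_algebraMap_eq' (MvPolynomial.aeval (R := R) f).comp_algebraMap.symm
  have hf : ∀ i, algebraMap (MvPolynomial ι R) A (MvPolynomial.X i) = f i :=
    MvPolynomial.aeval_X f
  obtain ⟨g, hg, ⟨k, rfl⟩, hs⟩ := exists_smooth_mvPolynomial 𝔭 hker hfrac f hf hind h hh
  refine ⟨⟨h * k, hg, ?_⟩, ?_⟩
  · intro C C' _ _ _ _ _ _ _ _ _ hsurj hker
    refine smooth_of_smooth_mvPolynomial f hf (h * k) hsurj (fun i => ?_) fun a ha => ?_
    · rw [← RingHom.mem_ker, hker]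
      exact hfJ i
    · rw [mul_comm h, mul_assoc]
      exact Ideal.mul_mem_left _ _ (hhJ a (hker ▸ ha))
  · intro B _ _ _
    have hloc : IsLocalRing B := IsLocalization.AtPrime.isLocalRing B 𝔭
    have hnoeth : IsNoetherianRing B := IsLocalization.isNoetherianRing 𝔭.primeCompl _ ‹_›
    have hle : ∀ q : Ideal B, q.IsPrime → q.under A ≤ 𝔭 := by
      intro q hq
      rw [← IsLocalization.AtPrime.under_maximalIdeal B 𝔭]
      exact Ideal.comap_mono (IsLocalRing.le_maximalIdeal hq.ne_top)
    -- `h` is invertible in the local ring, so there `J` is generated by the `f i`.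
    have hspan : J.map (algebraMap A B) =
        Ideal.span (Finset.univ.image (algebraMap A B ∘ f) : Finset B) := by
      rw [Finset.coe_image, Finset.coe_univ, Set.image_univ]
      apply le_antisymm
      · rw [Ideal.map_le_iff_le_comap]
        intro a ha
        have h1 := Ideal.mem_map_of_mem (algebraMap A B) (hhJ a ha)
        rw [Ideal.map_span, ← Set.range_comp, map_mul] at h1
        rwa [Ideal.unit_mul_mem_iff_mem] at h1
        exact IsLocalization.map_units B (⟨h, hh⟩ : 𝔭.primeCompl)
      · rw [Ideal.span_le]
        rintro _ ⟨i, rfl⟩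
        exact Ideal.mem_map_of_mem _ (hfJ i)
    apply le_antisymm
    -- Upper bound: Krull's height theorem at a minimal prime over the ideal.
    · have hne : J.map (algebraMap A B) ≠ ⊤ := by
        intro htop
        have h1 : J.map (algebraMap A B) ≤ IsLocalRing.maximalIdeal B := by
          rw [Ideal.map_le_iff_le_comap, ← Ideal.under_def, IsLocalization.AtPrime.under_maximalIdeal B 𝔭]
          exact hJ
        exact (IsLocalRing.maximalIdeal.isMaximal B).ne_top (top_le_iff.mp (htop ▸ h1))
      obtain ⟨q, hq⟩ := Ideal.nonempty_minimalPrimes hne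
      have := hq.1.1
      refine (Ideal.height_mono hq.1.2).trans ?_
      rw [hspan] at hq
      refine (Ideal.height_le_card_of_mem_minimalPrimes_span_finset hq).trans ?_
      exact_mod_cast Finset.card_image_le.trans_eq Finset.card_univ
    -- Lower bound: every minimal prime contracts to a prime of `A` containing the `f i` but not `h
    -- * k`.
    · rw [Ideal.height_eq_inf_minimalPrimes]
      refine le_iInf₂ fun q hq => ?_
      have := hq.1.1
      rw [← IsLocalization.height_under 𝔭.primeCompl q]
      refine card_le_height_of_smooth (R := R) (q.under A) f hf (fun i => ?_) (h * k)
        fun hmem => hg (hle q this hmem)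
      exact hq.1.2 (Ideal.mem_map_of_mem _ (hfJ i))

end SmoothQuotient

/-! ### Matrices over the dual numbers. -/

section DualNumbers
variable {K l m o : Type*} [Field K]

/-- The matrix `X + ε Y` over the dual numbers. -/
def dualMatrix (X Y : Matrix l m K) : Matrix l m (DualNumber K) :=
  .of fun i j => TrivSqZeroExt.inl (X i j) + TrivSqZeroExt.inr (Y i j)

omit [Field K] in
lemma dualMatrix_ext {X Y : Matrix l m (DualNumber K)}
    (h1 : X.map TrivSqZeroExt.fst = Y.map TrivSqZeroExt.fst)
    (h2 : X.map TrivSqZeroExt.snd = Y.map TrivSqZeroExt.snd) : X = Y := by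
  ext i j
  · exact congrFun₂ h1 i j
  · exact congrFun₂ h2 i j

@[simp] lemma dualMatrix_map_fst (X Y : Matrix l m K) :
    (dualMatrix X Y).map TrivSqZeroExt.fst = X := by
  ext
  simp [dualMatrix]

@[simp] lemma dualMatrix_map_snd (X Y : Matrix l m K) :
    (dualMatrix X Y).map TrivSqZeroExt.snd = Y := by
  ext
  simp [dualMatrix]

lemma map_fst_mul [Fintype m] (X : Matrix l m (DualNumber K)) (Y : Matrix m o (DualNumber K)) :
    (X * Y).map TrivSqZeroExt.fst = X.map TrivSqZeroExt.fst * Y.map TrivSqZeroExt.fst := by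
  ext i j
  simp [Matrix.mul_apply, TrivSqZeroExt.fst_sum]

lemma map_snd_mul [Fintype m] (X : Matrix l m (DualNumber K)) (Y : Matrix m o (DualNumber K)) :
    (X * Y).map TrivSqZeroExt.snd = X.map TrivSqZeroExt.fst * Y.map TrivSqZeroExt.snd +
      X.map TrivSqZeroExt.snd * Y.map TrivSqZeroExt.fst := by
  ext i j
  simp [Matrix.mul_apply, TrivSqZeroExt.snd_sum, Finset.sum_add_distrib, mul_comm]

/-- The kernel of `κ[ε] → κ` consists of elements of square zero, so it lies in every prime. This
surjectivity is what `LinkedGrassmannian.exists_ringHom` requires. -/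
lemma surjective_comap_fst :
    Function.Surjective (PrimeSpectrum.comap (TrivSqZeroExt.fstHom K K K).toRingHom) := by
  intro p
  have hker : ∀ x : DualNumber K, x.fst = 0 → x ∈ p.asIdeal := by
    intro x hx
    have : x * x = 0 := by
      ext <;> simp [hx]
    exact (or_self_iff.mp (p.2.mem_or_mem (this ▸ p.asIdeal.zero_mem)))
  refine ⟨⊥, PrimeSpectrum.ext (le_antisymm (fun x hx => hker x hx) fun x hx => ?_)⟩
  change x.fst = 0
  by_contra hne
  have h1 : x * TrivSqZeroExt.inl x.fst⁻¹ - 1 ∈ p.asIdeal := hker _ (by simp [hne])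
  have h2 : (1 : DualNumber K) ∈ p.asIdeal := by
    have := sub_mem (p.asIdeal.mul_mem_right (TrivSqZeroExt.inl x.fst⁻¹) hx) h1
    rwa [sub_sub_cancel] at this
  exact p.2.ne_top ((Ideal.eq_top_iff_one _).mpr h2)

/-- The derivation given by a homomorphism to the dual numbers. -/
def derivationOfRingHom {R A : Type*} [CommRing R] [CommRing A] [Algebra R A] [Algebra R K]
    [Algebra A K] [IsScalarTower R A K] (ψ : A →+* DualNumber K)
    (h1 : ∀ a, (ψ a).fst = algebraMap A K a)
    (h2 : ∀ a, (ψ (algebraMap R A a)).snd = 0) : Derivation R A K :=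
  Derivation.mk'
    { toFun := fun a => (ψ a).snd
      map_add' := fun a b => by simp
      map_smul' := fun a b => by
        simp [Algebra.smul_def, h1, h2, IsScalarTower.algebraMap_apply R A K] }
    fun a b => by simp [h1, Algebra.smul_def, mul_comm]

lemma exists_eq_mul_of_mulVec_mem {d r : ℕ} (X : Matrix (Fin d) (Fin r) K)
    (P : Matrix (Fin d) (Fin r) K)
    (h : ∀ c, X.mulVec c ∈ LinearMap.range P.mulVecLin) :
    ∃ t : Matrix (Fin r) (Fin r) K, X = P * t := by
  choose t ht using fun j => h (Pi.single j 1)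
  refine ⟨.of fun i j => t j i, ?_⟩
  ext i j
  have := congrFun (ht j) i
  simp only [Matrix.mulVec_single_one, Matrix.col_apply] at this
  rw [← this]
  rfl

end DualNumbers

/-- The extension by zero to the natural numbers of a family indexed by `Fin n`. -/
def extendFin {n : ℕ} {α : Type*} [Zero α] (N : Fin n → α) (j : ℕ) : α :=
  if h : j < n then N ⟨j, h⟩ else 0

lemma extendFin_of_lt {n : ℕ} {α : Type*} [Zero α] (N : Fin n → α) {j : ℕ} (h : j < n) :
    extendFin N j = N ⟨j, h⟩ := dif_pos h

/-! ### Tangent vectors of the linked Grassmannian. -/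

section
variable {S : Scheme.{u}} {n d r : ℕ} {C : Chain S n} {U : S.Opens}
  {e : ∀ i, Fin d → Γ(C.E i, U)} (he : ∀ i, IsFrame (C.E i) U (e i))

/-- The matrices of the maps up, indexed by the natural numbers. -/
noncomputable def Chain.upFamily (j : ℕ) : Matrix (Fin d) (Fin d) Γ(S, U) :=
  -- The default value `0` is harmless: every condition imposed on a chain is restricted to `j + 1 <
  -- n`.
  if h : j + 1 < n then Chain.upMatrix he ⟨j, by omega⟩ ⟨j + 1, h⟩ rfl else 0

/-- The matrices of the maps down, indexed by the natural numbers. -/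
noncomputable def Chain.downFamily (j : ℕ) : Matrix (Fin d) (Fin d) Γ(S, U) :=
  if h : j + 1 < n then Chain.downMatrix he ⟨j, by omega⟩ ⟨j + 1, h⟩ rfl else 0

lemma Chain.upFamily_of_lt {j : ℕ} (h : j + 1 < n) : Chain.upFamily he j =
    Chain.upMatrix he ⟨j, by omega⟩ ⟨j + 1, h⟩ rfl := dif_pos h

lemma Chain.downFamily_of_lt {j : ℕ} (h : j + 1 < n) : Chain.downFamily he j =
    Chain.downMatrix he ⟨j, by omega⟩ ⟨j + 1, h⟩ rfl := dif_pos h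

lemma Chain.upFamily_eq (i j : Fin n) (h : i.val + 1 = j.val) :
    Chain.upFamily he i = Chain.upMatrix he i j h := by
  obtain ⟨i, hi⟩ := i
  obtain ⟨j, hj⟩ := j
  obtain rfl : i + 1 = j := h
  exact Chain.upFamily_of_lt he hj

lemma Chain.downFamily_eq (i j : Fin n) (h : i.val + 1 = j.val) :
    Chain.downFamily he i = Chain.downMatrix he i j h := by
  obtain ⟨i, hi⟩ := i
  obtain ⟨j, hj⟩ := j
  obtain rfl : i + 1 = j := h
  exact Chain.downFamily_of_lt he hj

variable (LG : LinkedGrassmannian C r) {V : LG.scheme.Opens} (hVU : V ≤ LG.hom ⁻¹ᵁ U) {c : Fin n → ℕ}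
  {P : ∀ i, Matrix (Fin d) (Fin r ⊕ Fin (c i)) Γ(LG.scheme, V)}
  {Q : ∀ i, Matrix (Fin r ⊕ Fin (c i)) (Fin d) Γ(LG.scheme, V)}
  (hPQ : ∀ i, P i * Q i = 1) (hQP : ∀ i, Q i * P i = 1)
  (HP : ∀ i, (LG.univ.F i).SpannedBy (he i) hVU ((P i).submatrix id Sum.inl))
  [Algebra Γ(S, U) Γ(LG.scheme, V)]
  (halg : algebraMap Γ(S, U) Γ(LG.scheme, V) = fnHom LG.hom hVU)

/-- The matrices spanning the universal subbundles, indexed by the natural numbers. -/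
def spanFamily (P : ∀ i, Matrix (Fin d) (Fin r ⊕ Fin (c i)) Γ(LG.scheme, V)) (j : ℕ) :
    Matrix (Fin d) (Fin r) Γ(LG.scheme, V) := extendFin (fun i => (P i).submatrix id Sum.inl) j

lemma spanFamily_coe (P : ∀ i, Matrix (Fin d) (Fin r ⊕ Fin (c i)) Γ(LG.scheme, V)) (i : Fin n) :
    spanFamily LG P i = (P i).submatrix id Sum.inl := extendFin_of_lt _ i.2

include hQP HP halg in
lemma LinkedGrassmannian.isLinkedMatrix :
    IsLinkedMatrix n (Chain.upFamily he) (Chain.downFamily he) (spanFamily LG P) where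
  up j hj := by
    rw [halg, Chain.upFamily_of_lt he hj, spanFamily_coe LG P ⟨j, by omega⟩,
      spanFamily_coe LG P ⟨j + 1, hj⟩]
    exact LG.exists_up_eq he hVU HP _ _ _
  down j hj := by
    rw [halg, Chain.downFamily_of_lt he hj, spanFamily_coe LG P ⟨j, by omega⟩,
      spanFamily_coe LG P ⟨j + 1, hj⟩]
    exact LG.exists_down_eq he hVU HP _ _ _
  leftInverse j hj := by
    rw [spanFamily_coe LG P ⟨j, hj⟩]
    exact ⟨_, submatrix_mul_eq_one (hQP _)⟩

include hPQ hQP HP halg in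
-- A deformation `Φ` is the linked subbundle over `κ[ε]` spanned by the columns of `P + ε Φ P`. The
-- linked Grassmannian being a moduli space, it comes from a ring map `A → κ[ε]`, whose `ε`-part is
-- the derivation sought.
lemma LinkedGrassmannian.hasTangents (hU : IsAffineOpen U) (hV : IsAffineOpen V) (κ : Type u)
    [Field κ] [Algebra Γ(S, U) κ] [Algebra Γ(LG.scheme, V) κ]
    [IsScalarTower Γ(S, U) Γ(LG.scheme, V) κ] :
    HasTangents κ n (Chain.upFamily he) (Chain.downFamily he) (spanFamily LG P) := by
  intro Φ hΦ
  have hlin := LG.isLinkedMatrix he hVU hQP HP halg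
  set π := algebraMap Γ(LG.scheme, V) κ
  let F (i : Fin n) : Matrix (Fin d) (Fin d) κ := LinearMap.toMatrix' (Φ i)
  have hF : ∀ (i : Fin n) v, (F i).mulVec v = Φ i v := fun i v => by
    rw [LinearMap.toMatrix'_mulVec]
  let p (i : Fin n) : Matrix (Fin d) (Fin r) κ := ((P i).submatrix id Sum.inl).map π
  have hp : ∀ i : Fin n, (spanFamily LG P i).map π = p i := fun i => by rw [spanFamily_coe]
  have hpQP : ∀ i, (Q i).map π * (P i).map π = 1 := fun i => by
    rw [← Matrix.map_mul, hQP, Matrix.map_one _ (map_zero _) (map_one _)]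
  have hpPQ : ∀ i, (P i).map π * (Q i).map π = 1 := fun i => by
    rw [← Matrix.map_mul, hPQ, Matrix.map_one _ (map_zero _) (map_one _)]
  -- `Q₁ = (1 + ε F) P` has the inverse `Q₂ = Q (1 - ε F)`.
  let Q₁ (i : Fin n) := dualMatrix ((P i).map π) (F i * (P i).map π)
  let Q₂ (i : Fin n) := dualMatrix ((Q i).map π) (-((Q i).map π * F i))
  have h1fst : ∀ (m : Type) [DecidableEq m],
      (1 : Matrix m m (DualNumber κ)).map TrivSqZeroExt.fst = 1 := fun m _ =>
    Matrix.map_one _ rfl rfl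
  have h1snd : ∀ (m : Type) [DecidableEq m],
      (1 : Matrix m m (DualNumber κ)).map TrivSqZeroExt.snd = 0 := fun m _ => by
    ext i j
    by_cases hij : i = j
    · subst hij
      simp
    · simp [hij]
  have hinl : ∀ N : Matrix (Fin d) (Fin d) Γ(S, U),
      N.map ((TrivSqZeroExt.inlHom κ κ).comp (algebraMap Γ(S, U) κ)) =
        dualMatrix (N.map (algebraMap Γ(S, U) κ)) 0 := fun N => by
    ext <;> simp [dualMatrix]
  have hsub : ∀ i, (Q₁ i).submatrix id Sum.inl = dualMatrix (p i) (F i * p i) := fun i => by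
    apply dualMatrix_ext <;> rw [← Matrix.submatrix_map]
    · simp [Q₁, p, Matrix.submatrix_map]
    · simp only [Q₁, dualMatrix_map_snd]
      rfl
  -- Over `κ[ε]` the factorization required of a linked subbundle has constant part inherited from
  -- `P`, and its `ε`-part is exactly the condition in `IsDeformation`.
  have hlink : ∀ (i j : Fin n) (N : Matrix (Fin d) (Fin d) Γ(S, U)),
      (∃ t : Matrix (Fin r) (Fin r) Γ(LG.scheme, V), N.map (algebraMap Γ(S, U) Γ(LG.scheme, V)) * spanFamily LG P i =
        spanFamily LG P j * t) →
      (∀ a ∈ columnSpan κ (spanFamily LG P) i, (N.map (algebraMap Γ(S, U) κ)).mulVec (Φ i a) -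
        Φ j ((N.map (algebraMap Γ(S, U) κ)).mulVec a) ∈ columnSpan κ (spanFamily LG P) j) →
      ∃ t : Matrix (Fin r) (Fin r) (DualNumber κ),
        N.map ((TrivSqZeroExt.inlHom κ κ).comp (algebraMap Γ(S, U) κ)) *
          (Q₁ i).submatrix id Sum.inl = (Q₁ j).submatrix id Sum.inl * t := by
    rintro i j N ⟨t, ht⟩ hN
    have ht0 := congrArg (fun X => X.map π) ht
    simp only [Matrix.map_mul, hp, π, map_map_algebraMap] at ht0
    obtain ⟨t₁, ht₁⟩ := exists_eq_mul_of_mulVec_mem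
      (N.map (algebraMap Γ(S, U) κ) * (F i * p i) - F j * (N.map (algebraMap Γ(S, U) κ) * p i))
      (p j) fun v => by
        have := hN ((p i).mulVec v) ⟨v, by rw [Matrix.mulVecLin_apply, hp]⟩
        rw [columnSpan, hp] at this
        rw [Matrix.sub_mulVec]
        simp only [← Matrix.mulVec_mulVec, hF]
        exact this
    refine ⟨dualMatrix (t.map π) t₁, ?_⟩
    rw [hsub, hsub, hinl]
    apply dualMatrix_ext
    · simp only [map_fst_mul, dualMatrix_map_fst]
      exact ht0
    · simp only [map_snd_mul, dualMatrix_map_snd, dualMatrix_map_fst, Matrix.zero_mul, add_zero]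
      rw [← ht₁, Matrix.mul_assoc, ← ht0, sub_add_cancel]
  obtain ⟨ψ, hψ1, hψ2, hψ3⟩ := LinkedGrassmannian.exists_ringHom he LG hU hV hVU
    (P := fun i => (P i).submatrix id Sum.inl) (fun i => submatrix_mul_eq_one (hQP i)) HP
    (TrivSqZeroExt.fstHom κ κ κ).toRingHom surjective_comap_fst π
    ((TrivSqZeroExt.inlHom κ κ).comp (algebraMap Γ(S, U) κ))
    (fun a => by
      rw [← halg]
      exact IsScalarTower.algebraMap_apply _ _ _ _)
    c Q₁ Q₂
    (fun i => by
      apply dualMatrix_ext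
      · simp [Q₁, Q₂, map_fst_mul, hpPQ, h1fst]
      · simp [Q₁, Q₂, map_snd_mul, h1snd, Matrix.mul_assoc, hpPQ, ← Matrix.mul_assoc _ _ (F i)])
    (fun i => by
      apply dualMatrix_ext
      · simp [Q₁, Q₂, map_fst_mul, hpQP, h1fst]
      · simp [Q₁, Q₂, map_snd_mul, h1snd, Matrix.mul_assoc])
    (fun i j h => by
      rw [← Chain.upFamily_eq]
      have hj : i.val + 1 < n := h ▸ j.2
      refine hlink i j _ ?_ ?_
      · rw [← h]; exact hlin.up i hj
      · rw [← h]; exact hΦ.up i hj)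
    (fun i j h => by
      rw [← Chain.downFamily_eq]
      have hj : i.val + 1 < n := h ▸ j.2
      refine hlink j i _ ?_ ?_
      · rw [← h]; exact hlin.down i hj
      · rw [← h]; exact hΦ.down i hj)
    (fun i => ⟨1, 1, by rw [hsub, Matrix.mul_one]; exact (dualMatrix_map_fst _ _).symm,
      by rw [hsub, Matrix.mul_one]; exact dualMatrix_map_fst _ _⟩)
  refine ⟨derivationOfRingHom ψ hψ1 fun a => ?_, fun j hj v => ?_⟩
  · rw [halg, hψ2]
    simp
  · obtain ⟨t, ht⟩ := hψ3 ⟨j, hj⟩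
    rw [hsub] at ht
    have e0 := congrArg (fun X => X.map TrivSqZeroExt.fst) ht
    have e1 := congrArg (fun X => X.map TrivSqZeroExt.snd) ht
    simp only [map_fst_mul, map_snd_mul, dualMatrix_map_fst, dualMatrix_map_snd] at e0 e1
    have hψ0 : (((P ⟨j, hj⟩).submatrix id Sum.inl).map ψ).map TrivSqZeroExt.fst = p ⟨j, hj⟩ := by
      ext k l
      exact hψ1 _
    -- The change of columns is the identity modulo `ε`, so the `ε`-part of `P` is `F P` up to
    -- columns in the span of `P`.
    have ht0 : t.map TrivSqZeroExt.fst = 1 := by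
      have hinv : ((Q ⟨j, hj⟩).submatrix Sum.inl id).map π * p ⟨j, hj⟩ = 1 := by
        rw [← Matrix.map_mul, submatrix_mul_eq_one (hQP _),
          Matrix.map_one _ (map_zero _) (map_one _)]
      rw [hψ0] at e0
      rw [← Matrix.one_mul (t.map _), ← hinv, Matrix.mul_assoc, ← e0]
    have hδ : (spanFamily LG P j).map (derivationOfRingHom ψ hψ1 fun a => by
        rw [halg, hψ2]; simp) = (((P ⟨j, hj⟩).submatrix id Sum.inl).map ψ).map
          TrivSqZeroExt.snd := by
      rw [spanFamily_coe LG P ⟨j, hj⟩]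
      rfl
    rw [hδ, e1, ht0, Matrix.mul_one, hp ⟨j, hj⟩, Matrix.add_mulVec, ← Matrix.mulVec_mulVec,
      ← Matrix.mulVec_mulVec, hF, add_sub_cancel_right, columnSpan, hp ⟨j, hj⟩]
    exact ⟨_, rfl⟩

end

/-! ### Kernel and image conditions under field extension. -/

section FieldExtension
variable {k K : Type*} [Field k] [Field K] {l m o : Type*} [Fintype l] [Fintype m] [Fintype o]

/-- A section of the map onto its range, composed with a projection to the range, gives `Y`. Such a
`Y` turns inclusions of kernels and images into matrix identities, which survive any extension of
the field; the fiber conditions are given over a residue field of `S` but needed over one of the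
linked Grassmannian. -/
lemma exists_mul_mul_self [DecidableEq l] [DecidableEq m] (A : Matrix l m k) :
    ∃ Y : Matrix m l k, A * Y * A = A := by
  obtain ⟨g, hg⟩ := A.mulVecLin.rangeRestrict.exists_rightInverse_of_surjective
    A.mulVecLin.range_rangeRestrict
  obtain ⟨p, hp⟩ := (LinearMap.range A.mulVecLin).exists_isCompl
  obtain ⟨q, hq⟩ := (LinearMap.range A.mulVecLin).subtype.exists_leftInverse_of_injective
    (Submodule.ker_subtype _)
  refine ⟨LinearMap.toMatrix' (g ∘ₗ q), ?_⟩
  apply Matrix.toLin'.injective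
  ext1 i
  refine LinearMap.ext fun v => ?_
  simp only [Matrix.toLin'_mul, LinearMap.comp_apply, Matrix.toLin'_toMatrix']
  have h1 := LinearMap.congr_fun hq ⟨A.mulVec (Pi.single i v), ⟨_, rfl⟩⟩
  have h2 := LinearMap.congr_fun hg ⟨A.mulVec (Pi.single i v), ⟨_, rfl⟩⟩
  simp only [LinearMap.comp_apply, LinearMap.id_apply, Submodule.subtype_apply] at h1 h2
  simp only [LinearMap.single_apply, Matrix.toLin'_apply]
  rw [h1]
  exact congrArg Subtype.val h2

omit [Fintype o] in
lemma eq_zero_of_map_mulVec_eq_zero [DecidableEq m] (φ : k →+* K) (A : Matrix l m k) (B : Matrix o m k)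
    (h : ∀ v, A.mulVec v = 0 → B.mulVec v = 0) (v : m → K) (hv : (A.map φ).mulVec v = 0) :
    (B.map φ).mulVec v = 0 := by
  classical
  obtain ⟨Y, hY⟩ := exists_mul_mul_self A
  have hB : B = B * Y * A := by
    rw [← sub_eq_zero]
    apply Matrix.toLin'.injective
    refine LinearMap.ext fun w => ?_
    have h1 : A.mulVec (w - Y.mulVec (A.mulVec w)) = 0 := by
      rw [Matrix.mulVec_sub, Matrix.mulVec_mulVec, Matrix.mulVec_mulVec, hY, sub_self]
    have h2 := h _ h1
    rw [Matrix.mulVec_sub, Matrix.mulVec_mulVec, Matrix.mulVec_mulVec] at h2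
    rw [Matrix.toLin'_apply, Matrix.sub_mulVec, h2, map_zero, LinearMap.zero_apply]
  rw [hB, Matrix.map_mul, ← Matrix.mulVec_mulVec, hv, Matrix.mulVec_zero]

lemma exists_map_mulVec_eq [DecidableEq m] (φ : k →+* K) (A : Matrix l m k) (C : Matrix m o k)
    (h : ∀ v, A.mulVec v = 0 → ∃ w, C.mulVec w = v) (v : m → K) (hv : (A.map φ).mulVec v = 0) :
    ∃ w, (C.map φ).mulVec w = v := by
  classical
  obtain ⟨Y, hY⟩ := exists_mul_mul_self C
  have h1 := eq_zero_of_map_mulVec_eq_zero φ A (C * Y - 1) (fun w hw => by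
    obtain ⟨w, rfl⟩ := h w hw
    rw [Matrix.mulVec_mulVec, Matrix.sub_mul, hY, Matrix.one_mul, sub_self, Matrix.zero_mulVec])
    v hv
  refine ⟨(Y.map φ).mulVec v, ?_⟩
  rw [Matrix.mulVec_mulVec, ← Matrix.map_mul]
  have h2 : (C * Y - 1).map φ = (C * Y).map φ - 1 := by
    rw [Matrix.map_sub _ (map_sub φ), Matrix.map_one _ (map_zero _) (map_one _)]
  rwa [h2, Matrix.sub_mulVec, Matrix.one_mulVec, sub_eq_zero] at h1

end FieldExtension

/-! ### Fibers, frames and the matrices of the chain and the form. -/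

section Fiber
variable {X : Scheme.{u}} {U : X.Opens}

lemma le_preimage_fromSpecResidueField {x : X} (hx : x ∈ U) :
    ⊤ ≤ X.fromSpecResidueField x ⁻¹ᵁ U := fun y _ => by
  change X.fromSpecResidueField x y ∈ U
  rwa [Scheme.fromSpecResidueField_apply]

lemma fnHom_fromSpecResidueField {x : X} (hx : x ∈ U) (a : Γ(X, U)) :
    specGlobal (X.residueField x) (fnHom (X.fromSpecResidueField x)
      (le_preimage_fromSpecResidueField hx) a) = X.evaluation U x hx a := by
  have hle : ⊤ ≤ Spec.map (X.residue x) ⁻¹ᵁ X.fromSpecStalk x ⁻¹ᵁ U :=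
    le_preimage_fromSpecResidueField hx
  rw [← fnHom_fnHom (Spec.map (X.residue x)) (X.fromSpecStalk x) (X.fromSpecResidueField x) rfl
    le_rfl hle (le_preimage_fromSpecResidueField hx)]
  have h1 : fnHom (X.fromSpecStalk x) (le_refl (X.fromSpecStalk x ⁻¹ᵁ U)) a =
      resHom le_top ((specGlobal (X.presheaf.stalk x)).symm (X.presheaf.germ U x hx a)) := by
    rw [fnHom_app, Scheme.fromSpecStalk_app hx]
    rfl
  rw [h1, fnHom_resHom]
  refine (fnHom_specMap (X.residue x).hom _ _).trans ?_
  rw [RingEquiv.apply_symm_apply]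
  rfl

end Fiber

section MatrixRelations
variable {X : Scheme.{u}} {M N : X.Modules} {U : X.Opens} {ι ι' : Type} [Fintype ι] [Fintype ι']
  {e : ι → Γ(M, U)} {e' : ι' → Γ(N, U)}

omit [Fintype ι] in
lemma IsFrame.sum_matrix (he : IsFrame M U e) (he' : IsFrame N U e') (f : M ⟶ N) (k : ι) :
    f.app U (e k) = ∑ l, he.matrix he' f l k • e' l := by
  rw [← he'.sum_coord le_rfl (f.app U (e k))]
  refine Finset.sum_congr rfl fun l _ => ?_
  rw [res_self]
  rfl

lemma IsFrame.matrix_mul_matrix [DecidableEq ι] (he : IsFrame M U e) (he' : IsFrame N U e')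
    (f : M ⟶ N) (g : N ⟶ M) (a : Γ(X, U)) (h : ∀ x, g.app U (f.app U x) = a • x) :
    he'.matrix he g * he.matrix he' f = a • 1 := by
  ext l k
  have h1 : g.app U (f.app U (e k)) =
      ∑ m, (he'.matrix he g * he.matrix he' f) m k • res M le_rfl (e m) := by
    rw [he.sum_matrix he' f k, map_sum]
    simp only [Scheme.Modules.Hom.app_smul, he'.sum_matrix he g, Finset.smul_sum, smul_smul,
      res_self]
    rw [Finset.sum_comm]
    refine Finset.sum_congr rfl fun m _ => ?_
    rw [Matrix.mul_apply, Finset.sum_smul]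
    exact Finset.sum_congr rfl fun _ _ => by rw [mul_comm]
  rw [h] at h1
  have h2 := congrFun (he.coord_eq le_rfl _ _ h1) l
  rw [map_smul, ← res_self le_rfl (e k), he.coord_res] at h2
  rw [← h2, Pi.smul_apply, Matrix.smul_apply, Matrix.one_apply, Pi.single_apply]

variable {N' : X.Modules} {ι'' : Type} {e'' : ι'' → Γ(N', U)}

omit [Fintype ι] in
lemma Pairing.gram_left (he : IsFrame M U e) (he' : IsFrame N U e') (f : M ⟶ N)
    (B : Pairing N N') (B' : Pairing M N') (a : Γ(X, U))
    (h : ∀ x y, B.app U (f.app U x) y = a * B'.app U x y) :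
    (he.matrix he' f).transpose * B.gram e' e'' = a • B'.gram e e'' := by
  ext k l
  refine Eq.trans ?_ (h (e k) (e'' l))
  rw [he.sum_matrix he' f, map_sum, LinearMap.sum_apply, Matrix.mul_apply]
  refine Finset.sum_congr rfl fun m _ => ?_
  rw [map_smul, LinearMap.smul_apply]
  rfl

omit [Fintype ι] in
lemma Pairing.gram_right (he : IsFrame M U e) (he' : IsFrame N U e') (f : M ⟶ N)
    (B : Pairing N' N) (B' : Pairing N' M) (a : Γ(X, U))
    (h : ∀ x y, B.app U x (f.app U y) = a * B'.app U x y) :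
    B.gram e'' e' * he.matrix he' f = a • B'.gram e'' e := by
  ext k l
  refine Eq.trans ?_ (h (e'' k) (e l))
  rw [he.sum_matrix he' f, map_sum, Matrix.mul_apply]
  refine Finset.sum_congr rfl fun m _ => ?_
  rw [map_smul, smul_eq_mul, mul_comm]
  rfl

end MatrixRelations

section ChainMatrices
variable {S : Scheme.{u}} {n d r M : ℕ} {C : Chain S n} {U : S.Opens}
  {e : ∀ i, Fin d → Γ(C.E i, U)} (he : ∀ i, IsFrame (C.E i) U (e i)) {s : Γ(S, ⊤)} {B : Form C}

/-- The Gram matrices of a form, indexed by the natural numbers. -/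
noncomputable def Form.gramFamily (B : Form C) (e : ∀ i, Fin d → Γ(C.E i, U)) (i j : ℕ) :
    Matrix (Fin d) (Fin d) Γ(S, U) :=
  if h : i < n ∧ j < n then (B ⟨i, h.1⟩ ⟨j, h.2⟩).gram (e _) (e _) else 0

lemma Form.gramFamily_of_lt {i j : ℕ} (hi : i < n) (hj : j < n) :
    B.gramFamily e i j = (B ⟨i, hi⟩ ⟨j, hj⟩).gram (e _) (e _) := dif_pos ⟨hi, hj⟩

lemma Form.gramFamily_coe (i j : Fin n) :
    B.gramFamily e i j = (B i j).gram (e _) (e _) := dif_pos ⟨i.2, j.2⟩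

lemma IsLinkedAlternating.isMatrixForm (hB : IsLinkedAlternating C s M B) :
    IsMatrixForm n M (resO (le_top : U ≤ ⊤) s) (Chain.upFamily he) (Chain.downFamily he)
      (B.gramFamily e) where
  up_left i j hi hj := by
    rw [Chain.upFamily_of_lt he hi, Form.gramFamily_of_lt hi hj,
      Form.gramFamily_of_lt (by omega) hj]
    exact Pairing.gram_left _ _ _ _ _ _ (hB.up_left ⟨i, _⟩ ⟨i + 1, hi⟩ ⟨j, hj⟩ rfl U)
  up_right i j hi hj := by
    rw [Chain.upFamily_of_lt he hj, Form.gramFamily_of_lt hi hj,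
      Form.gramFamily_of_lt hi (by omega)]
    exact Pairing.gram_right _ _ _ _ _ _ (hB.up_right ⟨i, hi⟩ ⟨j, _⟩ ⟨j + 1, hj⟩ rfl U)
  down_left i j hi hj := by
    rw [Chain.downFamily_of_lt he hi, Form.gramFamily_of_lt hi hj,
      Form.gramFamily_of_lt (by omega) hj]
    exact Pairing.gram_left _ _ _ _ _ _ (hB.down_left ⟨i, _⟩ ⟨i + 1, hi⟩ ⟨j, hj⟩ rfl U)
  down_right i j hi hj := by
    rw [Chain.downFamily_of_lt he hj, Form.gramFamily_of_lt hi hj,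
      Form.gramFamily_of_lt hi (by omega)]
    exact Pairing.gram_right _ _ _ _ _ _ (hB.down_right ⟨i, hi⟩ ⟨j, _⟩ ⟨j + 1, hj⟩ rfl U)
  diag i hi k := by
    rw [Form.gramFamily_of_lt hi hi]
    exact hB.self_eq_zero _ _ _
  antisymm i j hi hj := by
    rw [Form.gramFamily_of_lt hi hj, Form.gramFamily_of_lt hj hi]
    ext k l
    rw [Matrix.transpose_apply, Matrix.neg_apply]
    by_cases hij : i = j
    · subst hij
      have h := hB.self_eq_zero ⟨i, hi⟩ U (e _ k + e _ l)
      simp only [map_add, LinearMap.add_apply, hB.self_eq_zero, zero_add, add_zero] at h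
      exact eq_neg_of_add_eq_zero_left h
    · exact hB.antisymm _ _ (fun h => hij (Fin.mk.inj h)) _ _ _

lemma Chain.IsLinked.downFamily_mul_upFamily (hC : C.IsLinked d s) (j : ℕ) (hj : j + 1 < n) :
    Chain.downFamily he j * Chain.upFamily he j = resO (le_top : U ≤ ⊤) s • 1 := by
  rw [Chain.upFamily_of_lt he hj, Chain.downFamily_of_lt he hj]
  exact (he _).matrix_mul_matrix _ _ _ _ (hC.down_up _ _ _ U)

lemma Chain.IsLinked.upFamily_mul_downFamily (hC : C.IsLinked d s) (j : ℕ) (hj : j + 1 < n) :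
    Chain.upFamily he j * Chain.downFamily he j = resO (le_top : U ≤ ⊤) s • 1 := by
  rw [Chain.upFamily_of_lt he hj, Chain.downFamily_of_lt he hj]
  exact (he _).matrix_mul_matrix _ _ _ _ (hC.up_down _ _ _ U)

end ChainMatrices

section FiberCoordinates
variable {X : Scheme.{u}} {M N : X.Modules} {U : X.Opens} {ι ι' : Type} [Fintype ι] [Fintype ι']
  {e : ι → Γ(M, U)} {e' : ι' → Γ(N, U)}

/-- The coordinates on the fiber given by a frame. -/
noncomputable def IsFrame.fiberCoord (he : IsFrame M U e) {x : X} (hx : x ∈ U) :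
    Fiber M x ≃+ (ι → X.residueField x) :=
  (he.pcoord (X.fromSpecResidueField x) (le_preimage_fromSpecResidueField hx)).toAddEquiv.trans
    (AddEquiv.piCongrRight fun _ => (specGlobal (X.residueField x)).toAddEquiv)

omit [Fintype ι] [Fintype ι'] in
lemma map_map_fnHom_fromSpecResidueField {x : X} (hx : x ∈ U) (A : Matrix ι ι' Γ(X, U)) :
    (A.map (fnHom (X.fromSpecResidueField x) (le_preimage_fromSpecResidueField hx))).map
      (specGlobal (X.residueField x)) = A.map (X.evaluation U x hx).hom := by
  ext i j
  exact fnHom_fromSpecResidueField hx _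

lemma IsFrame.fiberCoord_fiberMap (he : IsFrame M U e) (he' : IsFrame N U e') (f : M ⟶ N) {x : X}
    (hx : x ∈ U) (v : Fiber M x) : he'.fiberCoord hx (fiberMap f x v) =
      ((he.matrix he' f).map (X.evaluation U x hx).hom).mulVec (he.fiberCoord hx v) := by
  have h := he.pcoord_pullMap he' f (X.fromSpecResidueField x)
    (le_preimage_fromSpecResidueField hx) v
  rw [← map_map_fnHom_fromSpecResidueField]
  exact (congrArg (fun c => specGlobal (X.residueField x) ∘ c) h).trans
    (comp_mulVec (specGlobal (X.residueField x)).toRingHom _ _)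

lemma Pairing.IsPullback.app_eq_fiberCoord {B : Pairing M N} {x : X}
    {B' : Pairing (pull (X.fromSpecResidueField x) M) (pull (X.fromSpecResidueField x) N)}
    (H : B.IsPullback (X.fromSpecResidueField x) B') (he : IsFrame M U e) (he' : IsFrame N U e')
    (hx : x ∈ U) (v : Fiber M x) (w : Fiber N x) :
    specGlobal (X.residueField x) (B'.app ⊤ v w) = dotProduct (he.fiberCoord hx v)
      (((B.gram e e').map (X.evaluation U x hx).hom).mulVec (he'.fiberCoord hx w)) := by
  rw [H.app_eq he he' (le_preimage_fromSpecResidueField hx) v w,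
    ← map_map_fnHom_fromSpecResidueField]
  refine (RingHom.map_dotProduct (specGlobal (X.residueField x)).toRingHom _ _).trans ?_
  rw [comp_mulVec]
  rfl

end FiberCoordinates

/-! ### The fiber conditions over an extension of the residue field. -/

section FiberConditions
variable {S : Scheme.{u}} {n d M : ℕ} {C : Chain S n} {U : S.Opens}
  {e : ∀ i, Fin d → Γ(C.E i, U)} (he : ∀ i, IsFrame (C.E i) U (e i)) {s : Γ(S, ⊤)} {B : Form C}
  {x : S} (hx : x ∈ U) {κ : Type u} [Field κ] [Algebra Γ(S, U) κ]
  (φ : S.residueField x →+* κ) (hφ : algebraMap Γ(S, U) κ = φ.comp (S.evaluation U x hx).hom)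

include hφ in
lemma map_algebraMap_eq_map_map {ι ι' : Type} (A : Matrix ι ι' Γ(S, U)) :
    A.map (algebraMap Γ(S, U) κ) = (A.map (S.evaluation U x hx).hom).map φ := by
  rw [hφ]
  rfl

include hφ in
lemma Γevaluation_eq_zero (h : algebraMap Γ(S, U) κ (resO (le_top : U ≤ ⊤) s) = 0) :
    S.Γevaluation x s = 0 := by
  rw [hφ, RingHom.comp_apply, map_eq_zero] at h
  rw [← h]
  exact (congr(S.residue x ($(S.presheaf.germ_res (homOfLE le_top) x hx) s))).symm

include hφ in
lemma Chain.IsLinked.isLinkedSpace (hC : C.IsLinked d s) :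
    IsLinkedSpace n (algebraMap Γ(S, U) κ (resO (le_top : U ≤ ⊤) s))
      (linEnd κ (Chain.upFamily he)) (linEnd κ (Chain.downFamily he)) := by
  have hmul : ∀ (N N' : Matrix (Fin d) (Fin d) Γ(S, U)) (a : Γ(S, U)), N * N' = a • 1 →
      ∀ v : Fin d → κ, (N.map (algebraMap Γ(S, U) κ)).mulVec
        ((N'.map (algebraMap Γ(S, U) κ)).mulVec v) = algebraMap Γ(S, U) κ a • v := by
    intro N N' a h v
    have h1 : (a • (1 : Matrix (Fin d) (Fin d) Γ(S, U))).map (algebraMap Γ(S, U) κ) =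
        algebraMap Γ(S, U) κ a • 1 := by
      ext i j
      by_cases hij : i = j <;> simp [hij]
    rw [Matrix.mulVec_mulVec, ← Matrix.map_mul, h, h1, Matrix.smul_mulVec, Matrix.one_mulVec]
  refine ⟨fun j hj v => hmul _ _ _ (hC.downFamily_mul_upFamily he j hj) v,
    fun j hj v => hmul _ _ _ (hC.upFamily_mul_downFamily he j hj) v, ?_, ?_, ?_, ?_⟩
  · intro hs j hj v hv
    have hs := Γevaluation_eq_zero hx φ hφ hs
    rw [linEnd_apply, map_algebraMap_eq_map_map hx φ hφ, Chain.downFamily_of_lt he hj] at hv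
    simp only [linEnd_apply, map_algebraMap_eq_map_map hx φ hφ, Chain.upFamily_of_lt he hj]
    refine exists_map_mulVec_eq φ _ _ (fun w hw => ?_) v hv
    obtain ⟨w, rfl⟩ := ((he ⟨j + 1, hj⟩).fiberCoord hx).surjective w
    rw [← IsFrame.fiberCoord_fiberMap, map_eq_zero_iff _ (AddEquiv.injective _),
      hC.ker_down x hs] at hw
    obtain ⟨w', rfl⟩ := hw
    exact ⟨_, ((he _).fiberCoord_fiberMap (he _) _ hx w').symm⟩
  · intro hs j hj v hv
    have hs := Γevaluation_eq_zero hx φ hφ hs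
    rw [linEnd_apply, map_algebraMap_eq_map_map hx φ hφ, Chain.upFamily_of_lt he hj] at hv
    simp only [linEnd_apply, map_algebraMap_eq_map_map hx φ hφ, Chain.downFamily_of_lt he hj]
    refine exists_map_mulVec_eq φ _ _ (fun w hw => ?_) v hv
    obtain ⟨w, rfl⟩ := ((he ⟨j, by omega⟩).fiberCoord hx).surjective w
    rw [← IsFrame.fiberCoord_fiberMap, map_eq_zero_iff _ (AddEquiv.injective _),
      hC.ker_up x hs] at hw
    obtain ⟨w', rfl⟩ := hw
    exact ⟨_, ((he _).fiberCoord_fiberMap (he _) _ hx w').symm⟩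
  · intro hs j hj v hv
    have hs := Γevaluation_eq_zero hx φ hφ hs
    have hj' : j + 1 < n := by omega
    rw [linEnd_apply, linEnd_apply, map_algebraMap_eq_map_map hx φ hφ,
      map_algebraMap_eq_map_map hx φ hφ, Matrix.mulVec_mulVec, ← Matrix.map_mul,
      Chain.upFamily_of_lt he hj, Chain.upFamily_of_lt he hj'] at hv
    rw [linEnd_apply, map_algebraMap_eq_map_map hx φ hφ, Chain.upFamily_of_lt he hj']
    refine eq_zero_of_map_mulVec_eq_zero φ _ _ (fun w hw => ?_) v hv
    obtain ⟨w, rfl⟩ := ((he ⟨j, by omega⟩).fiberCoord hx).surjective w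
    rw [← Matrix.mulVec_mulVec, ← IsFrame.fiberCoord_fiberMap, ← IsFrame.fiberCoord_fiberMap,
      map_eq_zero_iff _ (AddEquiv.injective _)] at hw
    rw [← IsFrame.fiberCoord_fiberMap, map_eq_zero_iff _ (AddEquiv.injective _)]
    exact hC.im_up_inf_ker_up x hs _ _ _ _ _ _ hw
  · intro hs j hj v hv
    have hs := Γevaluation_eq_zero hx φ hφ hs
    have hj' : j + 1 < n := by omega
    rw [linEnd_apply, linEnd_apply, map_algebraMap_eq_map_map hx φ hφ,
      map_algebraMap_eq_map_map hx φ hφ, Matrix.mulVec_mulVec, ← Matrix.map_mul,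
      Chain.downFamily_of_lt he hj, Chain.downFamily_of_lt he hj'] at hv
    rw [linEnd_apply, map_algebraMap_eq_map_map hx φ hφ, Chain.downFamily_of_lt he hj]
    refine eq_zero_of_map_mulVec_eq_zero φ _ _ (fun w hw => ?_) v hv
    obtain ⟨w, rfl⟩ := ((he ⟨j + 1 + 1, hj⟩).fiberCoord hx).surjective w
    rw [← Matrix.mulVec_mulVec, ← IsFrame.fiberCoord_fiberMap, ← IsFrame.fiberCoord_fiberMap,
      map_eq_zero_iff _ (AddEquiv.injective _)] at hw
    rw [← IsFrame.fiberCoord_fiberMap, map_eq_zero_iff _ (AddEquiv.injective _)]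
    exact hC.im_down_inf_ker_down x hs _ _ _ _ _ _ hw

lemma mulVec_eq_zero_of_forall_dotProduct {K : Type*} [CommRing K] (N : Matrix (Fin d) (Fin d) K)
    (y : Fin d → K) (h : ∀ x, x ⬝ᵥ N.mulVec y = 0) : N.mulVec y = 0 :=
  dotProduct_eq_zero _ fun x => by rw [dotProduct_comm]; exact h x

include hφ in
lemma mulVec_eq_zero_of_forall_residueField (G N : Matrix (Fin d) (Fin d) Γ(S, U))
    (h : ∀ w, (G.map (S.evaluation U x hx).hom).mulVec w = 0 →
      (N.map (S.evaluation U x hx).hom).mulVec w = 0) (y : Fin d → κ)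
    (hy : ∀ v, v ⬝ᵥ (G.map (algebraMap Γ(S, U) κ)).mulVec y = 0) :
    (N.map (algebraMap Γ(S, U) κ)).mulVec y = 0 := by
  have h1 := mulVec_eq_zero_of_forall_dotProduct _ _ hy
  rw [map_algebraMap_eq_map_map hx φ hφ] at h1 ⊢
  exact eq_zero_of_map_mulVec_eq_zero φ _ _ h y h1

/-- The degeneracy is defined through the left argument, while the kernel of the Gram matrix
concerns the right one; antisymmetry exchanges them. -/
lemma Pairing.mulVec_eq_zero_of_degeneracyEqKerAt {X : Scheme.{u}} {E E' : X.Modules}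
    {U : X.Opens} {x : X} (hx : x ∈ U) {e : Fin d → Γ(E, U)} {e' : Fin d → Γ(E', U)}
    (he : IsFrame E U e) (he' : IsFrame E' U e') (B : Pairing E E)
    (hanti : (B.gram e e).transpose = - B.gram e e) (f : E ⟶ E') (hB : B.DegeneracyEqKerAt f x)
    (w : Fin d → X.residueField x)
    (hw : ((B.gram e e).map (X.evaluation U x hx).hom).mulVec w = 0) :
    ((he.matrix he' f).map (X.evaluation U x hx).hom).mulVec w = 0 := by
  obtain ⟨B', hB', hd⟩ := hB
  obtain ⟨w, rfl⟩ := (he.fiberCoord hx).surjective w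
  rw [← he.fiberCoord_fiberMap he', map_eq_zero_iff _ (AddEquiv.injective _), ← hd w]
  intro v
  refine (specGlobal (X.residueField x)).injective ?_
  rw [hB'.app_eq_fiberCoord he he hx, map_zero, Matrix.dotProduct_mulVec, ← Matrix.mulVec_transpose,
    ← Matrix.transpose_map, hanti]
  have h1 : (-B.gram e e).map (X.evaluation U x hx).hom =
      -(B.gram e e).map (X.evaluation U x hx).hom := by
    ext
    simp
  rw [h1, Matrix.neg_mulVec, hw, neg_zero, zero_dotProduct]

lemma Pairing.eq_zero_of_nondegenerateAt {X : Scheme.{u}} {E E' : X.Modules}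
    {U : X.Opens} {x : X} (hx : x ∈ U) {e : Fin d → Γ(E, U)} {e' : Fin d → Γ(E', U)}
    (he : IsFrame E U e) (he' : IsFrame E' U e') (B : Pairing E E') (hB : B.NondegenerateAt x)
    (w : Fin d → X.residueField x)
    (hw : ((B.gram e e').map (X.evaluation U x hx).hom).mulVec w = 0) : w = 0 := by
  obtain ⟨B', hB', -, hnd⟩ := hB
  obtain ⟨w, rfl⟩ := (he'.fiberCoord hx).surjective w
  rw [map_eq_zero_iff _ (AddEquiv.injective _)]
  refine hnd w fun v => (specGlobal (X.residueField x)).injective ?_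
  rw [hB'.app_eq_fiberCoord he he' hx, hw, dotProduct_zero, map_zero]

include hφ in
lemma IsLinkedSymplectic.isSymplecticPairing (hB : IsLinkedSymplectic C s M B) :
    IsSymplecticPairing n M (algebraMap Γ(S, U) κ (resO (le_top : U ≤ ⊤) s))
      (linEnd κ (Chain.upFamily he)) (linEnd κ (Chain.downFamily he))
      (matPairing κ (B.gramFamily e)) := by
  have hM := hB.toIsLinkedAlternating.isMatrixForm he
  refine ⟨hM.isLinkedPairing κ, hB.two_le, hB.le_two_mul, ?_, ?_, ?_⟩
  · intro i j hi hj hij y hy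
    simp only [matPairing_apply] at hy
    -- Nondegeneracy is treated as the inclusion of the kernel of the Gram matrix in that of the
    -- identity matrix.
    have := mulVec_eq_zero_of_forall_residueField hx φ hφ _ 1 (fun w hw => ?_) y hy
    · rwa [Matrix.map_one _ (map_zero _) (map_one _), Matrix.one_mulVec] at this
    · rw [Form.gramFamily_of_lt hi hj] at hw
      rw [Pairing.eq_zero_of_nondegenerateAt hx (he _) (he _) _
        (hB.nondegenerate ⟨i, hi⟩ ⟨j, hj⟩ hij x) w hw, Matrix.mulVec_zero]
  · intro hs hM' i hi hiM y hy
    simp only [matPairing_apply] at hy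
    refine mulVec_eq_zero_of_forall_residueField hx φ hφ _ _ (fun w hw => ?_) y hy
    have ha := hM.antisymm _ _ hi hi
    rw [Form.gramFamily_of_lt hi hi] at hw ha
    rw [Chain.downFamily_of_lt he hi]
    exact Pairing.mulVec_eq_zero_of_degeneracyEqKerAt hx (he _) (he _) _ ha _
      (hB.degeneracy_down hM' x (Γevaluation_eq_zero hx φ hφ hs) _ _ _ hiM) w hw
  · intro hs hM' i hi hiM y hy
    have hi' : i < n := by omega
    simp only [matPairing_apply] at hy
    refine mulVec_eq_zero_of_forall_residueField hx φ hφ _ _ (fun w hw => ?_) y hy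
    have ha := hM.antisymm _ _ hi' hi'
    rw [Form.gramFamily_of_lt hi' hi'] at hw ha
    rw [Chain.upFamily_of_lt he hi]
    exact Pairing.mulVec_eq_zero_of_degeneracyEqKerAt hx (he _) (he _) _ ha _
      (hB.degeneracy_up hM' x (Γevaluation_eq_zero hx φ hφ hs) _ _ _ hiM) w hw

end FiberConditions

lemma card_pairs (r : ℕ) : Fintype.card (Pairs r) = r.choose 2 := by
  rw [Fintype.card_subtype]
  exact (Fintype.card_product_filter_lt (α := Fin r)).trans (by simp)

/-! ### The theorem for the local model. -/

section LocalModel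
variable {R A κ : Type u} [CommRing R] [CommRing A] [Algebra R A] [Field κ] [Algebra R κ]
  [Algebra A κ] [IsScalarTower R A κ] {n d r M : ℕ} {U D : ℕ → Matrix (Fin d) (Fin d) R}
  {B : ℕ → ℕ → Matrix (Fin d) (Fin d) R} {P : ℕ → Matrix (Fin d) (Fin r) A} {s : R}

/-- Smoothness and codimension of the isotropic locus at a point of a smooth local model. -/
theorem IsLinkedMatrix.smooth_and_height [Algebra.Smooth R A] [IsNoetherianRing R]
    (h : IsLinkedMatrix n U D P) (hT : HasTangents κ n U D P) (hB : IsMatrixForm n M s U D B)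
    (hL : IsLinkedSpace n (algebraMap R κ s) (linEnd κ U) (linEnd κ D))
    (hS : IsSymplecticPairing n M (algebraMap R κ s) (linEnd κ U) (linEnd κ D) (matPairing κ B))
    (𝔭 : Ideal A) [𝔭.IsPrime] (hker : RingHom.ker (algebraMap A κ) = 𝔭)
    (hfrac : ∀ x : κ, ∃ a b : A, algebraMap A κ b ≠ 0 ∧ algebraMap A κ b * x = algebraMap A κ a)
    (hle : isotropicIdeal n B P ≤ 𝔭) :
    (∃ g ∉ 𝔭, ∀ (E E' : Type u) [CommRing E] [CommRing E'] [Algebra A E] [Algebra E E']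
      [Algebra R E'] [Algebra A E'] [IsScalarTower A E E'] [IsScalarTower R A E']
      [IsLocalization.Away (algebraMap A E g) E'],
      Function.Surjective (algebraMap A E) →
        RingHom.ker (algebraMap A E) = isotropicIdeal n B P → Algebra.Smooth R E') ∧
    ∀ (E : Type u) [CommRing E] [Algebra A E] [IsLocalization.AtPrime E 𝔭],
      ((isotropicIdeal n B P).map (algebraMap A E)).height = (r.choose 2 : ℕ) := by
  obtain ⟨idx, c, hidx, hs, hli⟩ := h.exists_frame hT hL hfrac hS.two_le hS.le_two_mul
  let f (p : Pairs r) : A := matPairing A B (idx p.1.1) (idx p.1.2)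
    ((P (idx p.1.1)).mulVec (c p.1.1)) ((P (idx p.1.2)).mulVec (c p.1.2))
  have hfJ : ∀ p, f p ∈ isotropicIdeal n B P := fun p => by
    simp only [f, matPairing_mulVec]
    exact dotProduct_mulVec_mem (restrictedGram_mem (hidx _) (hidx _)) _ _
  -- Only the pairs `k < l` are needed: the form is alternating on the diagonal, and `⟨e_l, e_k⟩ =
  -- -⟨e_k, e_l⟩`.
  obtain ⟨a, ha, haJ⟩ := h.exists_mul_mem hB hidx hli (I := Ideal.span (Set.range f)) fun k l => by
    rcases lt_trichotomy k l with hkl | rfl | hkl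
    · exact Ideal.subset_span ⟨⟨(k, l), hkl⟩, rfl⟩
    · rw [(hB.isLinkedPairing A).self_eq_zero _ (hidx k)]
      exact zero_mem _
    · rw [(hB.isLinkedPairing A).eq_neg (hidx k) (hidx l)]
      exact neg_mem (Ideal.subset_span ⟨⟨(l, k), hkl⟩, rfl⟩)
  have hmem : ∀ x, x ∈ 𝔭 ↔ algebraMap A κ x = 0 := fun x => by rw [← hker, RingHom.mem_ker]
  rw [← card_pairs]
  exact exists_smooth_and_height_eq 𝔭 hker hfrac f _ hle hfJ
    (h.eq_zero_of_derivation hT hL hS (fun x hx => (hmem x).mp (hle hx)) hidx hs hli)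
    a (fun hm => ha ((hmem a).mp hm)) haJ

end LocalModel

/-! ### Affine neighbourhoods, stalks and smooth points. -/

section Scheme
variable {X : Scheme.{u}}

lemma mem_iInf_opens {n : ℕ} {W : Fin n → X.Opens} {x : X} (h : ∀ i, x ∈ W i) : x ∈ ⨅ i, W i := by
  rw [← SetLike.mem_coe, TopologicalSpace.Opens.coe_iInf, Set.mem_iInter]
  exact h

lemma exists_affine_le {W : X.Opens} {x : X} (hx : x ∈ W) :
    ∃ V : X.Opens, IsAffineOpen V ∧ x ∈ V ∧ V ≤ W := by
  obtain ⟨_, ⟨V, hV, rfl⟩, hxV, hVW⟩ := X.isBasis_affineOpens.exists_subset_of_mem_open hx W.2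
  exact ⟨V, hV, hxV, hVW⟩

lemma exists_frames {S : Scheme.{u}} {n d : ℕ} {C : Chain S n} (hC : ∀ i, IsVectorBundle (C.E i) d)
    (x : S) : ∃ U : S.Opens, IsAffineOpen U ∧ x ∈ U ∧
      ∃ e : ∀ i, Fin d → Γ(C.E i, U), ∀ i, IsFrame (C.E i) U (e i) := by
  choose W hxW e he using fun i => hC i x
  obtain ⟨U, hU, hxU, hUW⟩ := exists_affine_le (mem_iInf_opens hxW)
  exact ⟨U, hU, hxU, fun i => _, fun i => (he i).restrict (hUW.trans (iInf_le _ i))⟩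

variable {V : X.Opens} {x : X}

lemma isLocalization_germ (hV : IsAffineOpen V) (hx : x ∈ V) :
    letI := (X.presheaf.germ V x hx).hom.toAlgebra
    IsLocalization.AtPrime (X.presheaf.stalk x) (hV.primeIdealOf ⟨x, hx⟩).asIdeal :=
  hV.isLocalization_stalk ⟨x, hx⟩

lemma ker_evaluation (hV : IsAffineOpen V) (hx : x ∈ V) :
    RingHom.ker (X.evaluation V x hx).hom = (hV.primeIdealOf ⟨x, hx⟩).asIdeal := by
  let := (X.presheaf.germ V x hx).hom.toAlgebra
  have := isLocalization_germ hV hx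
  rw [← IsLocalization.AtPrime.under_maximalIdeal (X.presheaf.stalk x)
    (hV.primeIdealOf ⟨x, hx⟩).asIdeal]
  ext a
  rw [RingHom.mem_ker, Ideal.under_def, Ideal.mem_comap]
  exact Ideal.Quotient.eq_zero_iff_mem

lemma exists_germ_mul_eq (hV : IsAffineOpen V) (hx : x ∈ V) (y : X.presheaf.stalk x) :
    ∃ a b : Γ(X, V), X.evaluation V x hx b ≠ 0 ∧
      X.presheaf.germ V x hx b * y = X.presheaf.germ V x hx a := by
  let := (X.presheaf.germ V x hx).hom.toAlgebra
  have := isLocalization_germ hV hx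
  obtain ⟨a, b, rfl⟩ := IsLocalization.exists_mk'_eq (hV.primeIdealOf ⟨x, hx⟩).asIdeal.primeCompl y
  exact ⟨a, b, fun h => b.2 ((ker_evaluation hV hx).le h), IsLocalization.mk'_spec' _ _ _⟩

lemma exists_mul_eq_zero_of_germ_eq_zero (hV : IsAffineOpen V) (hx : x ∈ V) (a : Γ(X, V))
    (h : X.presheaf.germ V x hx a = 0) : ∃ b, X.evaluation V x hx b ≠ 0 ∧ b * a = 0 := by
  let := (X.presheaf.germ V x hx).hom.toAlgebra
  have := isLocalization_germ hV hx
  obtain ⟨b, hb⟩ := (IsLocalization.map_eq_zero_iff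
    (hV.primeIdealOf ⟨x, hx⟩).asIdeal.primeCompl (X.presheaf.stalk x) a).mp h
  exact ⟨b, fun h => b.2 ((ker_evaluation hV hx).le h), hb⟩

lemma exists_evaluation_mul_eq (hV : IsAffineOpen V) (hx : x ∈ V) (y : X.residueField x) :
    ∃ a b : Γ(X, V), X.evaluation V x hx b ≠ 0 ∧
      X.evaluation V x hx b * y = X.evaluation V x hx a := by
  obtain ⟨y, rfl⟩ := X.residue_surjective x y
  obtain ⟨a, b, hb, hab⟩ := exists_germ_mul_eq hV hx y
  exact ⟨a, b, hb, ((X.residue x).hom.map_mul _ _).symm.trans (congrArg (X.residue x) hab)⟩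

lemma evaluation_fnHom {Y : Scheme.{u}} (f : X ⟶ Y) {U : Y.Opens} (h : V ≤ f ⁻¹ᵁ U) (hx : x ∈ V)
    (a : Γ(Y, U)) : X.evaluation V x hx (fnHom f h a) =
      f.residueFieldMap x (Y.evaluation U (f x) (h hx) a) := by
  rw [Scheme.evaluation_naturality_apply f x (h hx) a]
  exact congr(X.residue x ($(X.presheaf.germ_res (homOfLE h) x hx) (f.app U a)))

lemma smooth_appLE {S : Scheme.{u}} (p : X ⟶ S) {W : X.Opens} (hW : Smooth (W.ι ≫ p))
    {U : S.Opens} (hU : IsAffineOpen U) (hV : IsAffineOpen V) (hVU : V ≤ p ⁻¹ᵁ U) (hVW : V ≤ W) :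
    (fnHom p hVU).Smooth := by
  have h1 : Smooth (V.ι ≫ p) := by
    rw [← X.homOfLE_ι hVW, Category.assoc]
    infer_instance
  have : IsAffine V := hV
  have h2 : ⊤ ≤ (V.ι ≫ p) ⁻¹ᵁ U := by
    rw [Scheme.Hom.comp_preimage, ← V.ι_preimage_self]
    exact V.ι.preimage_mono hVU
  have h3 := HasRingHomProperty.appLE @Smooth (V.ι ≫ p) h1 ⟨U, hU⟩ ⟨⊤, isAffineOpen_top V⟩ h2
  rw [← Scheme.Hom.appLE_comp_appLE V.ι p U V ⊤ hVU V.ι_preimage_self.ge] at h3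
  rwa [CommRingCat.hom_comp, RingHom.Smooth.respectsIso.cancel_right_isIso] at h3

lemma isSmoothPoint_of_smooth {S : Scheme.{u}} (p : X ⟶ S) {U : S.Opens} (hU : IsAffineOpen U)
    (hV : IsAffineOpen V) (hVU : V ≤ p ⁻¹ᵁ U) (h : (fnHom p hVU).Smooth) (hx : x ∈ V) :
    IsSmoothPoint p x := by
  have : IsAffine V := hV
  have : IsAffine U := hU
  have h1 : Smooth (p.resLE U V hVU) := by
    rw [HasRingHomProperty.iff_of_isAffine (P := @Smooth), Scheme.Hom.appTop,
      Scheme.Hom.resLE_app_top, CommRingCat.hom_comp,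
      RingHom.Smooth.respectsIso.cancel_left_isIso, CommRingCat.hom_comp,
      RingHom.Smooth.respectsIso.cancel_right_isIso]
    exact h
  refine ⟨V, hx, ?_⟩
  rw [← p.resLE_comp_ι hVU]
  infer_instance

end Scheme

/-! ### Closed subschemes in an affine chart. -/

section ClosedImmersion
variable {Z X S : Scheme.{u}} (ι : Z ⟶ X) [IsClosedImmersion ι] {V : X.Opens} {z : Z}

lemma fnHom_surjective (hV : IsAffineOpen V) :
    Function.Surjective (fnHom ι (le_refl (ι ⁻¹ᵁ V))) := by
  intro b
  obtain ⟨a, ha⟩ := ι.app_surjective V hV b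
  exact ⟨a, (fnHom_app ι a).trans ha⟩

/-- Up to a unit, an element of the stalk is the germ of a function on `V`. If its restriction to
`Z` has zero germ, it is killed by a function on `ι ⁻¹ᵁ V` not vanishing at `z`; such a function
lifts to `V`, where its germ is again a unit. -/
lemma ker_stalkMap (hV : IsAffineOpen V) (hz : ι z ∈ V) :
    RingHom.ker (ι.stalkMap z).hom =
      (RingHom.ker (fnHom ι (le_refl (ι ⁻¹ᵁ V)))).map (X.presheaf.germ V (ι z) hz).hom := by
  have hg (a : Γ(X, V)) : ι.stalkMap z (X.presheaf.germ V (ι z) hz a) =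
      Z.presheaf.germ (ι ⁻¹ᵁ V) z hz (fnHom ι (le_refl (ι ⁻¹ᵁ V)) a) := by
    rw [fnHom_app]
    exact Scheme.Hom.germ_stalkMap_apply ι V z hz a
  have hu (b : Γ(X, V)) (hb : X.evaluation V (ι z) hz b ≠ 0) :
      IsUnit (X.presheaf.germ V (ι z) hz b) := by
    rw [← not_not (a := IsUnit _), ← mem_nonunits_iff, ← IsLocalRing.mem_maximalIdeal,
      ← IsLocalRing.residue_eq_zero_iff]
    exact hb
  apply le_antisymm
  · intro y hy
    obtain ⟨a, b, hb, hab⟩ := exists_germ_mul_eq hV hz y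
    have h1 : Z.presheaf.germ (ι ⁻¹ᵁ V) z hz (fnHom ι (le_refl (ι ⁻¹ᵁ V)) a) = 0 := by
      rw [← hg, ← hab, map_mul, (RingHom.mem_ker.mp hy : ι.stalkMap z y = 0), mul_zero]
    obtain ⟨c, hc, hca⟩ := exists_mul_eq_zero_of_germ_eq_zero (hV.preimage ι) hz _ h1
    obtain ⟨c, rfl⟩ := fnHom_surjective ι hV c
    rw [evaluation_fnHom ι le_rfl (x := z) hz] at hc
    have hc' : X.evaluation V (ι z) hz c ≠ 0 := fun h => hc (by rw [h, map_zero])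
    rw [← Ideal.unit_mul_mem_iff_mem _ (hu b hb), hab, ← Ideal.unit_mul_mem_iff_mem _ (hu c hc'),
      ← map_mul]
    exact Ideal.mem_map_of_mem (X.presheaf.germ V (ι z) hz).hom ((map_mul _ _ _).trans hca)
  · rw [Ideal.map_le_iff_le_comap]
    intro a ha
    rw [Ideal.mem_comap, RingHom.mem_ker]
    exact (hg a).trans (by rw [RingHom.mem_ker.mp ha, map_zero])

/-- The locus in `ι ⁻¹ᵁ V` where `g` does not vanish is an affine neighbourhood of `z` whose ring is
the localization away from `g`. The hypothesis `h` ranges over all models `E` of the quotient so as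
to apply to the sections of `Z` themselves. -/
lemma isSmoothPoint_comp (p : X ⟶ S) {U : S.Opens} (hU : IsAffineOpen U) (hV : IsAffineOpen V)
    (hVU : V ≤ p ⁻¹ᵁ U) (hz : ι z ∈ V) (g : Γ(X, V)) (hg : X.evaluation V (ι z) hz g ≠ 0)
    (h : let := (fnHom p hVU).toAlgebra
      ∀ (E E' : Type u) [CommRing E] [CommRing E'] [Algebra Γ(X, V) E] [Algebra E E']
      [Algebra Γ(S, U) E'] [Algebra Γ(X, V) E'] [IsScalarTower Γ(X, V) E E']
      [IsScalarTower Γ(S, U) Γ(X, V) E'] [IsLocalization.Away (algebraMap Γ(X, V) E g) E'],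
      Function.Surjective (algebraMap Γ(X, V) E) →
        RingHom.ker (algebraMap Γ(X, V) E) = RingHom.ker (fnHom ι (le_refl (ι ⁻¹ᵁ V))) →
          Algebra.Smooth Γ(S, U) E') : IsSmoothPoint (ι ≫ p) z := by
  let E := Γ(Z, ι ⁻¹ᵁ V)
  let gE : E := fnHom ι (le_refl (ι ⁻¹ᵁ V)) g
  let D := Z.basicOpen gE
  have hD : D ≤ ι ⁻¹ᵁ V := Z.basicOpen_le gE
  have hDU : D ≤ (ι ≫ p) ⁻¹ᵁ U := hD.trans (ι.preimage_mono hVU)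
  have hzD : z ∈ D := by
    rw [← Z.evaluation_ne_zero_iff_mem_basicOpen z hz, evaluation_fnHom ι le_rfl hz]
    exact (map_ne_zero _).mpr hg
  let := (fnHom p hVU).toAlgebra
  let := (fnHom ι (le_refl (ι ⁻¹ᵁ V))).toAlgebra
  let : Algebra E Γ(Z, D) := (Z.presheaf.map (homOfLE hD).op).hom.toAlgebra
  let : Algebra Γ(X, V) Γ(Z, D) := (fnHom ι hD).toAlgebra
  let : Algebra Γ(S, U) Γ(Z, D) := (fnHom (ι ≫ p) hDU).toAlgebra
  have : IsScalarTower Γ(X, V) E Γ(Z, D) := .of_algebraMap_eq fun a =>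
    (resHom_fnHom ι le_rfl hD a).symm
  have : IsScalarTower Γ(S, U) Γ(X, V) Γ(Z, D) := .of_algebraMap_eq fun a =>
    (fnHom_fnHom ι p (ι ≫ p) rfl hVU hD hDU a).symm
  have : IsLocalization.Away (algebraMap Γ(X, V) E g) Γ(Z, D) :=
    (hV.preimage ι).isLocalization_basicOpen gE
  exact isSmoothPoint_of_smooth (ι ≫ p) hU ((hV.preimage ι).basicOpen gE) hDU
    (h E Γ(Z, D) (fnHom_surjective ι hV) rfl) hzD

end ClosedImmersion

/-! ### Proof of the theorem. -/

section Main
variable {S : Scheme.{u}} {n d r M : ℕ} {C : Chain S n} {s : Γ(S, ⊤)} {B : Form C}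

lemma isotropicIdeal_gramFamily {U : S.Opens} {e : ∀ i, Fin d → Γ(C.E i, U)}
    (LG : LinkedGrassmannian C r) {V : LG.scheme.Opens} (hVU : V ≤ LG.hom ⁻¹ᵁ U) {c : Fin n → ℕ}
    (P : ∀ i, Matrix (Fin d) (Fin r ⊕ Fin (c i)) Γ(LG.scheme, V))
    [Algebra Γ(S, U) Γ(LG.scheme, V)]
    (halg : algebraMap Γ(S, U) Γ(LG.scheme, V) = fnHom LG.hom hVU) :
    isotropicIdeal n (B.gramFamily e) (spanFamily LG P) = isotropyIdeal LG hVU (e := e) P B := by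
  refine congrArg Ideal.span (Set.ext fun a => ⟨?_, ?_⟩)
  · rintro ⟨i, j, hi, hj, k, l, rfl⟩
    refine ⟨⟨i, hi⟩, ⟨j, hj⟩, k, l, ?_⟩
    rw [restrictedGram, halg, spanFamily_coe LG P ⟨i, hi⟩, spanFamily_coe LG P ⟨j, hj⟩,
      Form.gramFamily_of_lt hi hj]
  · rintro ⟨i, j, k, l, rfl⟩
    refine ⟨i, j, i.2, j.2, k, l, ?_⟩
    rw [restrictedGram, halg, spanFamily_coe, spanFamily_coe, Form.gramFamily_coe]

/-- Around every point, the universal subbundles are spanned by the columns of matrices. -/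
lemma LinkedGrassmannian.exists_matrices {U : S.Opens} {e : ∀ i, Fin d → Γ(C.E i, U)}
    (he : ∀ i, IsFrame (C.E i) U (e i)) (LG : LinkedGrassmannian C r) {x : LG.scheme}
    {W : LG.scheme.Opens} (hxW : x ∈ W) (hxU : x ∈ LG.hom ⁻¹ᵁ U) :
    ∃ V : LG.scheme.Opens, IsAffineOpen V ∧ x ∈ V ∧ V ≤ W ∧ ∃ (hVU : V ≤ LG.hom ⁻¹ᵁ U)
      (c : Fin n → ℕ) (P : ∀ i, Matrix (Fin d) (Fin r ⊕ Fin (c i)) Γ(LG.scheme, V))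
      (Q : ∀ i, Matrix (Fin r ⊕ Fin (c i)) (Fin d) Γ(LG.scheme, V)),
      (∀ i, P i * Q i = 1) ∧ (∀ i, Q i * P i = 1) ∧
      ∀ i, (LG.univ.F i).SpannedBy (he i) hVU ((P i).submatrix id Sum.inl) := by
  choose W' hW' c P Q hx hPQ hQP HP using fun i => (LG.univ.F i).exists_spannedBy (he i) x hxU
  obtain ⟨V, hV, hxV, hVW⟩ := exists_affine_le (W := W ⊓ LG.hom ⁻¹ᵁ U ⊓ ⨅ i, W' i)
    ⟨⟨hxW, hxU⟩, mem_iInf_opens hx⟩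
  have hVW' (i) : V ≤ W' i := (hVW.trans inf_le_right).trans (iInf_le _ i)
  refine ⟨V, hV, hxV, (hVW.trans inf_le_left).trans inf_le_left,
    (hVW.trans inf_le_left).trans inf_le_right, c, fun i => (P i).map (resHom (hVW' i)),
    fun i => (Q i).map (resHom (hVW' i)), fun i => ?_, fun i => ?_, fun i => (HP i).mono (hVW' i)⟩
  · rw [← Matrix.map_mul, hPQ, Matrix.map_one _ (map_zero _) (map_one _)]
  · rw [← Matrix.map_mul, hQP, Matrix.map_one _ (map_zero _) (map_one _)]

/-- The isotropic locus is smooth of codimension `r.choose 2` at the smooth points of the linked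
Grassmannian, over a locally noetherian base. -/
theorem IsotropicGrassmannian.isSmoothPoint_and_codimAt_eq [IsLocallyNoetherian S]
    (hC : C.IsLinked d s) (hB : IsLinkedSymplectic C s M B) (LG : LinkedGrassmannian C r)
    (LSG : IsotropicGrassmannian LG B) (z : LSG.scheme) (hz : IsSmoothPoint LG.hom (LSG.ι z)) :
    IsSmoothPoint (LSG.ι ≫ LG.hom) z ∧ codimAt LSG.ι z = (r.choose 2 : ℕ∞) := by
  have := LSG.isClosedImmersion
  set x := LSG.ι z with hxdef
  obtain ⟨W, hxW, hW⟩ := hz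
  obtain ⟨U, hU, hxU, e, he⟩ := exists_frames hC.isVectorBundle (LG.hom x)
  obtain ⟨V, hV, hx, hVW, hVU, c, P, Q, hPQ, hQP, HP⟩ := LG.exists_matrices he hxW hxU
  have : IsNoetherianRing Γ(S, U) := IsLocallyNoetherian.component_noetherian ⟨U, hU⟩
  let := (fnHom LG.hom hVU).toAlgebra
  have halg : algebraMap Γ(S, U) Γ(LG.scheme, V) = fnHom LG.hom hVU := rfl
  have hsm : Algebra.Smooth Γ(S, U) Γ(LG.scheme, V) := smooth_appLE LG.hom hW hU hV hVU hVW
  let κ := LG.scheme.residueField x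
  let : Algebra Γ(LG.scheme, V) κ := (LG.scheme.evaluation V x hx).hom.toAlgebra
  let : Algebra Γ(S, U) κ := ((LG.scheme.evaluation V x hx).hom.comp (fnHom LG.hom hVU)).toAlgebra
  have : IsScalarTower Γ(S, U) Γ(LG.scheme, V) κ := .of_algebraMap_eq fun _ => rfl
  -- `κ` extends the residue field of `S` at the image of `x`, where the conditions on the chain and
  -- the form are stated.
  have hφ : algebraMap Γ(S, U) κ = (LG.hom.residueFieldMap x).hom.comp
      (S.evaluation U (LG.hom x) hxU).hom := RingHom.ext fun a => evaluation_fnHom LG.hom hVU hx a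
  have hJ : RingHom.ker (fnHom LSG.ι (le_refl (LSG.ι ⁻¹ᵁ V))) =
      isotropicIdeal n (B.gramFamily e) (spanFamily LG P) :=
    (IsotropicGrassmannian.ker_eq he LG hVU hPQ hQP HP LSG hV).trans
      (isotropicIdeal_gramFamily LG hVU P halg).symm
  have hmem (a : Γ(LG.scheme, V)) : a ∈ (hV.primeIdealOf ⟨x, hx⟩).asIdeal ↔
      LG.scheme.evaluation V x hx a = 0 := by
    rw [← ker_evaluation hV hx]
    rfl
  -- The point `x` lies on the closed subscheme, so functions restricting to zero there vanish at
  -- `x`.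
  have hle : isotropicIdeal n (B.gramFamily e) (spanFamily LG P) ≤
      (hV.primeIdealOf ⟨x, hx⟩).asIdeal := by
    intro a ha
    rw [← hJ, RingHom.mem_ker] at ha
    have h := evaluation_fnHom LSG.ι (le_refl (LSG.ι ⁻¹ᵁ V)) hx a
    rw [ha, map_zero] at h
    exact (hmem a).mpr ((map_eq_zero _).mp h.symm)
  obtain ⟨⟨g, hg, h1⟩, h2⟩ := (LG.isLinkedMatrix he hVU hQP HP halg).smooth_and_height
    (LG.hasTangents he hVU hPQ hQP HP halg hU hV κ)
    (hB.toIsLinkedAlternating.isMatrixForm he) (hC.isLinkedSpace he hxU _ hφ)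
    (hB.isSymplecticPairing he hxU _ hφ) (hV.primeIdealOf ⟨x, hx⟩).asIdeal
    (ker_evaluation hV hx) (exists_evaluation_mul_eq hV hx) hle
  rw [← hJ] at h1 h2
  refine ⟨isSmoothPoint_comp LSG.ι LG.hom hU hV hVU hx g (mt (hmem g).mpr hg) h1, ?_⟩
  let := (LG.scheme.presheaf.germ V x hx).hom.toAlgebra
  have := isLocalization_germ hV hx
  rw [codimAt, ker_stalkMap LSG.ι hV hx]
  exact h2 (LG.scheme.presheaf.stalk x)

end Main

end LinkedSymplectic

theorem theorem1p2 {S : AlgebraicGeometry.Scheme.{u}}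
    (hS : LinkedSymplectic.IsRegularScheme S)
    {n d r M : ℕ} (hrd : r < d) (s : Γ(S, ⊤))
    (C : LinkedSymplectic.Chain S n) (hC : C.IsLinked d s)
    (B : LinkedSymplectic.Form C) (hB : LinkedSymplectic.IsLinkedSymplectic C s M B)
    (LG : LinkedSymplectic.LinkedGrassmannian C r)
    (LSG : LinkedSymplectic.IsotropicGrassmannian LG B)
    (z : LSG.scheme) (hz : LinkedSymplectic.IsSmoothPoint LG.hom (LSG.ι z)) :
    LinkedSymplectic.IsSmoothPoint (LSG.ι ≫ LG.hom) z ∧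
      LinkedSymplectic.codimAt LSG.ι z = (r.choose 2 : ℕ∞) := by
  have := hS.1
  exact LSG.isSmoothPoint_and_codimAt_eq hC hB LG z hz
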